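/- Let $F$ be the free group with basis $\mathbf{x}$, let $F_1=F$ and $F_{m+1}=[F,F_m]$ for $m\ge 1$ be the terms of its lower central series, and let $(\mathbf{x}:\mathbf{r},\mathbf{s})$ be a group presentation, where $\mathbf{r}$ and $\mathbf{s}$ are disjoint (possibly infinite or empty) subsets of $F$. Assume that there is a positive integer $n$ such that $\mathbf{r}\cup\mathbf{s}\subseteq F_n$ and such that the elements $uF_{n+1}$ $(u\in\mathbf{r}\cup\mathbf{s})$ are linearly independent (as a family indexed by $\mathbf{r}\cup\mathbf{s}$, over $\mathbb{Z}$) in the abelian group $F_n/F_{n+1}$. Let $R$ and $S$ be the normal closures of $\mathbf{r}$ and $\mathbf{s}$ in $F$. Then \[R\cap S\subseteq [R,F]\cap[S,F],\] and moreover $R\cap S\subseteq F_{n+1}$, and the two-complex $K$ modelled on $(\mathbf{x}:\mathbf{r},\mathbf{s})$ is Cockcroft. Here $K$ has one $0$-cell, one $1$-cell for each element of $\mathbf{x}$, and one $2$-cell for each $u\in\mathbf{r}\cup\mathbf{s}$, attached to the wedge of circles $K^{(1)}$ along the loop that spells $u$; and $K$ is Cockcroft if each continuous map $S^2\to K$ is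 homologically trivial, i.e. induces the zero map $H_2(S^2;\mathbb{Z})\to H_2(K;\mathbb{Z})$ (equivalently, the Hurewicz map $\pi_2(K,z)\to H_2(K)$ is zero for every base point $z$). -/

import Mathlib

open CategoryTheory Topology

universe u

noncomputable section

/-! ### The lower central series and its quotients -/

/-- The `n`-th term `G_n` of the lower central series of a group, for `n ≥ 1`, numbered so that
`G_1 = G` and `G_{n+1} = [G, G_n]`. -/
def lcsTerm (G : Type u) [Group G] (n : ℕ) : Subgroup G :=
  (⊤ : Subgroup G).lowerCentralSeries (n - 1)

theorem lcsTerm_one (G : Type u) [Group G] : lcsTerm G 1 = ⊤ := rfl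

theorem lcsTerm_succ (G : Type u) [Group G] (n : ℕ) (hn : 1 ≤ n) :
    lcsTerm G (n + 1) = ⁅(⊤ : Subgroup G), lcsTerm G n⁆ := by
  obtain ⟨m, rfl⟩ : ∃ m, n = m + 1 := ⟨n - 1, by omega⟩
  rw [Subgroup.commutator_comm]
  rfl

instance lcsTerm_normal (G : Type u) [Group G] (n : ℕ) : (lcsTerm G n).Normal := by
  unfold lcsTerm; infer_instance

theorem commutator_lcsTerm_le (G : Type u) [Group G] (n : ℕ) :
    ⁅lcsTerm G n, lcsTerm G n⁆ ≤ lcsTerm G (n + 1) := by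
  rcases Nat.eq_zero_or_pos n with rfl | hn
  · exact le_top
  · rw [lcsTerm_succ G n hn]
    exact Subgroup.commutator_mono le_top le_rfl

/-- The lower central quotient `G_n / G_{n+1}`. -/
abbrev LcsQuotient (G : Type u) [Group G] (n : ℕ) : Type u :=
  ↥(lcsTerm G n) ⧸ (lcsTerm G (n + 1)).subgroupOf (lcsTerm G n)

/-- `G_n / G_{n+1}` is commutative; the group structure is the usual one of the quotient. -/
instance lcsQuotientCommGroup (G : Type u) [Group G] (n : ℕ) : CommGroup (LcsQuotient G n) :=
  { (inferInstance : Group (LcsQuotient G n)) with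
    mul_comm := by
      rintro ⟨a⟩ ⟨b⟩
      refine QuotientGroup.eq.mpr ?_
      rw [Subgroup.mem_subgroupOf]
      have h := commutator_lcsTerm_le G n
        (Subgroup.commutator_mem_commutator (inv_mem b.2) (inv_mem a.2))
      simpa [commutatorElement_def, mul_assoc] using h }

/-- The coset `g G_{n+1}` of an element `g` of `G_n`, in the quotient `G_n / G_{n+1}` written
additively, so that it is an element of a `ℤ`-module. -/
def lcsClass {G : Type u} [Group G] (n : ℕ) (g : G) (hg : g ∈ lcsTerm G n) :
    Additive (LcsQuotient G n) :=
  Additive.ofMul (QuotientGroup.mk (⟨g, hg⟩ : ↥(lcsTerm G n)))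

/-! ### The two-complex modelled on a presentation -/

/-- The identifications that turn the disjoint union of a point and of one copy of the interval
`[0, 1]` for each `x : X` into a wedge of circles: all endpoints are glued to the point. -/
inductive WedgeRel (X : Type u) :
    Unit ⊕ (Σ _ : X, unitInterval) → Unit ⊕ (Σ _ : X, unitInterval) → Prop
  | zero (x : X) : WedgeRel X (Sum.inr ⟨x, 0⟩) (Sum.inl ())
  | one (x : X) : WedgeRel X (Sum.inr ⟨x, 1⟩) (Sum.inl ())

/-- The wedge of circles indexed by `X`, with the quotient (that is, the weak) topology: one
`0`-cell, and one oriented `1`-cell for each `x : X`. -/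
def WedgeOfCircles (X : Type u) : Type u := Quot (WedgeRel X)

instance WedgeOfCircles.instTopologicalSpace (X : Type u) : TopologicalSpace (WedgeOfCircles X) :=
  inferInstanceAs (TopologicalSpace (Quot (WedgeRel X)))

/-- The `0`-cell. -/
def WedgeOfCircles.base (X : Type u) : WedgeOfCircles X := Quot.mk _ (Sum.inl ())

/-- The loop that runs once around the circle indexed by `x`. -/
def WedgeOfCircles.loop {X : Type u} (x : X) :
    Path (WedgeOfCircles.base X) (WedgeOfCircles.base X) where
  toFun t := Quot.mk _ (Sum.inr ⟨x, t⟩)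
  continuous_toFun :=
    continuous_quot_mk.comp (continuous_inr.comp (continuous_sigmaMk (σ := fun _ : X => unitInterval)))
  source' := Quot.sound (WedgeRel.zero x)
  target' := Quot.sound (WedgeRel.one x)

/-- The loop that traverses the circle `x` once, forwards for the letter `x` (coded as
`(x, true)`) and backwards for the letter `x⁻¹` (coded as `(x, false)`). -/
def WedgeOfCircles.letterLoop {X : Type u} (a : X × Bool) :
    Path (WedgeOfCircles.base X) (WedgeOfCircles.base X) :=
  if a.2 = true then WedgeOfCircles.loop a.1 else (WedgeOfCircles.loop a.1).symm

/-- The loop that spells a word, letter after letter. -/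
def WedgeOfCircles.wordLoop {X : Type u} :
    List (X × Bool) → Path (WedgeOfCircles.base X) (WedgeOfCircles.base X)
  | [] => Path.refl _
  | a :: w => (WedgeOfCircles.letterLoop a).trans (WedgeOfCircles.wordLoop w)

open Classical in
/-- The loop in the wedge of circles that spells the reduced word of an element of the free
group. -/
def WedgeOfCircles.relatorLoop {X : Type u} (r : FreeGroup X) :
    Path (WedgeOfCircles.base X) (WedgeOfCircles.base X) :=
  WedgeOfCircles.wordLoop r.toWord

/-- The closed unit disc in the plane. -/
abbrev ClosedDisc : Type := Metric.closedBall (0 : ℂ) 1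

/-- The point `exp (2 π i t)` of the boundary circle of the disc. -/
def discBoundary (t : unitInterval) : ClosedDisc :=
  ⟨Complex.exp (2 * Real.pi * (t : ℝ) * Complex.I), by
    rw [mem_closedBall_zero_iff]
    have h := Complex.norm_exp_ofReal_mul_I (2 * Real.pi * (t : ℝ))
    push_cast at h
    exact h.le⟩

/-- The identifications that attach one disc for each relator `u ∈ rels` to the wedge of circles,
along the loop that spells `u`. -/
inductive PresentationRel {X : Type u} (rels : Set (FreeGroup X)) :
    WedgeOfCircles X ⊕ (Σ _ : rels, ClosedDisc) →
      WedgeOfCircles X ⊕ (Σ _ : rels, ClosedDisc) → Prop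
  | attach (u : rels) (t : unitInterval) :
      PresentationRel rels (Sum.inr ⟨u, discBoundary t⟩)
        (Sum.inl (WedgeOfCircles.relatorLoop (u : FreeGroup X) t))

/-- The two-complex modelled on the presentation `(X : rels)`: one `0`-cell, one `1`-cell for each
generator, and one `2`-cell for each relator, attached along the loop that spells it; it carries
the quotient (weak) topology. -/
def PresentationComplex {X : Type u} (rels : Set (FreeGroup X)) : Type u :=
  Quot (PresentationRel rels)

instance PresentationComplex.instTopologicalSpace {X : Type u} (rels : Set (FreeGroup X)) :
    TopologicalSpace (PresentationComplex rels) :=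
  inferInstanceAs (TopologicalSpace (Quot (PresentationRel rels)))

/-! ### The Cockcroft property -/

/-- The functor `H_2( - ; ℤ)` of singular homology with integral coefficients. -/
def singularH2 : TopCat.{u} ⥤ ModuleCat.{u} ℤ :=
  (AlgebraicTopology.singularHomologyFunctor (ModuleCat.{u} ℤ) 2).obj
    (ModuleCat.of ℤ (ULift.{u} ℤ))

/-- A space `K` is Cockcroft if each spherical map `S² → K` is homologically trivial, that is,
induces the zero map `H_2(S²; ℤ) → H_2(K; ℤ)`. Equivalently, the Hurewicz map
`π_2(K, z) → H_2(K; ℤ)` is trivial for every base point `z`. -/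
def IsCockcroft (K : Type u) [TopologicalSpace K] : Prop :=
  ∀ f : TopCat.sphere.{u} 2 ⟶ TopCat.of K, singularH2.map f = 0

end

/-!
The statements about `R ∩ S` are algebra. Modulo `[R, F]` an element of `R` is a product of powers
of elements of `r`, since the conjugation becomes trivial; likewise for `S` (`exists_exponents`).
As `[R, F]` and `[S, F]` lie in `F_{n+1}`, the class in `F_n / F_{n+1}` of an element of `R ∩ S` is a
combination of the classes of `r`, and also of those of `s`. Linear independence makes both
combinations trivial, so that the element lies in `[R, F] ∩ [S, F]`.

For the Cockcroft property, let `f` be a map to the two-complex `K` from a space `Y` with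
`H_1(Y) = 0`, such as the sphere, and let `z` be a `2`-cycle of `Y`. The complex is covered by an
open collar of its one-skeleton and by the open discs; the intersection consists of open annuli, one
for each relator. After subdivision, `z` is homologous to `zA + zB`, with `zA` mapped to the collar
and `zB` to the discs, and the image of the common boundary `∂ zB = - ∂ zA` winds a certain number of
times around each annulus. The winding number around the annulus of `u` is the degree of the cycle
`f z` on the disc of `u`, and the point is that all these numbers vanish
(`SChain.winding_bdry_eq_zero`).

To this end the paths in the collar are given a holonomy in `F`: an `F`-valued cochain, flat on the
triangles in the collar, which takes the value `u ^ w`, up to a gauge transformation, on the paths in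
the annulus of `u` with winding number `w` (`PresentationComplex.exists_cochains`). On the wedge of
circles such a cochain is obtained from a form of van Kampen's theorem
(`SSimplex.exists_flat_extension`, `WedgeOfCircles.exists_holonomy`), and the collar retracts to the
wedge. Let `A ⊆ Y` be the preimage of the collar. If the holonomy of the paths in `A` has been gauged
into `F_j`, for some `j < n`, then its class in `F_j / F_{j+1}` is an ordinary `1`-cocycle on `A`.
Each `1`-cycle in `A` bounds in `Y`, hence is the sum of a boundary in `A` and of the boundary of a
chain in the preimage of the discs. The cocycle vanishes on the former, and on the latter it is a
combination of classes of relators, which are trivial in `F_j / F_{j+1}`. Hence it is a coboundary,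
and the holonomy can be gauged into `F_{j+1}` (`SChain.exists_gauge`). When `j = n` is reached, the
class of the holonomy in `F_n / F_{n+1}` vanishes on `∂ zA`. But its value on `∂ zB = - ∂ zA` is
the sum of the classes of the relators weighted by the winding numbers, and so linear independence
shows that these vanish.

The image of `∂ zB` is thus a boundary in the annuli, and `f z` is homologous to the sum of a cycle in
the discs and of a cycle in the collar. The first is a boundary because the discs are contractible,
the second because the collar retracts, by a homotopy inside `K`, to a wedge of circles, whose
second homology is trivial (`WedgeOfCircles.exists_bdry`).

The argument is carried out with explicit singular chains, `SChain`, in low degrees. They are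
identified with Mathlib's singular chain complex to deduce homotopy invariance and to return to the
functor `singularH2` (`SChain.push_homologous`, `SChain.singularH2_map_eq_zero`).
-/

/-! ### Singular chains with integral coefficients -/

/-- A singular `n`-simplex of `Y`. -/
abbrev SSimplex (n : ℕ) (Y : Type*) [TopologicalSpace Y] : Type _ :=
  C(stdSimplex ℝ (Fin (n + 1)), Y)

namespace SSimplex

variable {Y Z : Type*} [TopologicalSpace Y] [TopologicalSpace Z] {n : ℕ}

/-- The `i`-th face. -/
noncomputable def face (σ : SSimplex (n + 1) Y) (i : Fin (n + 2)) : SSimplex n Y :=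
  σ.comp ⟨stdSimplex.map i.succAbove, stdSimplex.continuous_map _⟩

/-- The `i`-th vertex. -/
noncomputable def vtx (σ : SSimplex n Y) (i : Fin (n + 1)) : Y := σ (stdSimplex.vertex i)

theorem vtx_face (σ : SSimplex (n + 1) Y) (i : Fin (n + 2)) (j : Fin (n + 1)) :
    (face σ i).vtx j = σ.vtx (i.succAbove j) := by
  simp [face, vtx, stdSimplex.map_vertex]

theorem vtx_face_two (σ : SSimplex 2 Y) :
    (face σ 2).vtx 0 = σ.vtx 0 ∧ (face σ 2).vtx 1 = σ.vtx 1 ∧ (face σ 0).vtx 0 = σ.vtx 1 ∧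
      (face σ 0).vtx 1 = σ.vtx 2 ∧ (face σ 1).vtx 0 = σ.vtx 0 ∧ (face σ 1).vtx 1 = σ.vtx 2 :=
  ⟨vtx_face σ 2 0, vtx_face σ 2 1, vtx_face σ 0 0, vtx_face σ 0 1, vtx_face σ 1 0, vtx_face σ 1 1⟩

theorem comp_face (f : C(Y, Z)) (σ : SSimplex (n + 1) Y) (i : Fin (n + 2)) :
    face (f.comp σ) i = f.comp (face σ i) := rfl

/-- The simplex lies in the set `A`. -/
def In (σ : SSimplex n Y) (A : Set Y) : Prop := ∀ t, σ t ∈ A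

theorem In.face {σ : SSimplex (n + 1) Y} {A : Set Y} (h : σ.In A) (i : Fin (n + 2)) :
    (face σ i).In A := fun _ => h _

theorem In.comp {σ : SSimplex n Y} {A : Set Y} (h : σ.In A) {m : ℕ}
    (g : C(stdSimplex ℝ (Fin (m + 1)), stdSimplex ℝ (Fin (n + 1)))) :
    In (σ.comp g : SSimplex m Y) A := fun _ => h _

end SSimplex

/-- Singular `n`-chains with integral coefficients. -/
abbrev SChain (n : ℕ) (Y : Type*) [TopologicalSpace Y] : Type _ := SSimplex n Y →₀ ℤ

namespace SChain

open SSimplex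

variable {Y Z : Type*} [TopologicalSpace Y] [TopologicalSpace Z] {n : ℕ}

/-- The basis chain of a simplex. -/
noncomputable abbrev of (σ : SSimplex n Y) : SChain n Y := Finsupp.single σ 1

/-- The boundary operator. -/
noncomputable def bdry : SChain (n + 1) Y →ₗ[ℤ] SChain n Y :=
  Finsupp.linearCombination ℤ fun σ => ∑ i : Fin (n + 2), (-1 : ℤ) ^ (i : ℕ) • of (face σ i)

/-- The chain map induced by a continuous map. -/
noncomputable def push (f : C(Y, Z)) : SChain n Y →ₗ[ℤ] SChain n Z :=
  Finsupp.lmapDomain ℤ ℤ fun σ => f.comp σ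

/-- The chains all of whose simplices lie in `A`. -/
noncomputable def supp (n : ℕ) (A : Set Y) : Submodule ℤ (SChain n Y) :=
  Finsupp.supported ℤ ℤ {σ | σ.In A}

@[simp] theorem push_of (f : C(Y, Z)) (σ : SSimplex n Y) : push f (of σ) = of (f.comp σ) := by
  simp [push]

theorem bdry_of (σ : SSimplex (n + 1) Y) :
    bdry (of σ) = ∑ i : Fin (n + 2), (-1 : ℤ) ^ (i : ℕ) • of (face σ i) := by
  simp [bdry]

theorem bdry_of_one (σ : SSimplex 1 Y) : bdry (of σ) = of (face σ 0) - of (face σ 1) := by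
  simp [bdry_of, Fin.sum_univ_succ, sub_eq_add_neg]

theorem bdry_of_two (σ : SSimplex 2 Y) :
    bdry (of σ) = of (face σ 0) - of (face σ 1) + of (face σ 2) := by
  simp [bdry_of, Fin.sum_univ_succ]; abel

theorem bdry_of_three (σ : SSimplex 3 Y) :
    bdry (of σ) = of (face σ 0) - of (face σ 1) + of (face σ 2) - of (face σ 3) := by
  simp [bdry_of, Fin.sum_univ_succ, pow_succ]; abel

/-- Linear maps on chains that agree on simplices are equal. -/
theorem hom_ext {M : Type*} [AddCommGroup M] [Module ℤ M] {f g : SChain n Y →ₗ[ℤ] M}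
    (h : ∀ σ, f (of σ) = g (of σ)) : f = g :=
  Finsupp.lhom_ext' fun σ => LinearMap.ext_ring (h σ)

theorem bdry_push (f : C(Y, Z)) (z : SChain (n + 1) Y) : bdry (push f z) = push f (bdry z) := by
  have : (bdry ∘ₗ push f : SChain (n + 1) Y →ₗ[ℤ] _) = push f ∘ₗ bdry := hom_ext fun σ => by
    simp only [LinearMap.comp_apply, push_of, bdry_of, map_sum, map_smul, comp_face]
  exact LinearMap.congr_fun this z

theorem push_comp {T : Type*} [TopologicalSpace T] (g : C(Z, T)) (f : C(Y, Z)) (z : SChain n Y) :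
    push (g.comp f) z = push g (push f z) := by
  have : push (n := n) (g.comp f) = push g ∘ₗ push f := hom_ext fun σ => by
    simp [ContinuousMap.comp_assoc]
  exact LinearMap.congr_fun this z

theorem push_id (z : SChain n Y) : push (ContinuousMap.id Y) z = z := by
  have : push (n := n) (ContinuousMap.id Y) = LinearMap.id := hom_ext fun σ => by simp
  exact LinearMap.congr_fun this z

theorem push_injective {f : C(Y, Z)} (hf : Function.Injective f) :
    Function.Injective (push (n := n) f) :=
  Finsupp.mapDomain_injective fun _ _ h => ContinuousMap.ext fun t => hf (DFunLike.congr_fun h t)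

/-- Two linear maps that agree on the simplices in `A` agree on the chains in `A`. -/
theorem eqOn_supp {M : Type*} [AddCommGroup M] {A : Set Y} {f g : SChain n Y →ₗ[ℤ] M}
    (h : ∀ σ : SSimplex n Y, σ.In A → f (of σ) = g (of σ)) {z : SChain n Y} (hz : z ∈ supp n A) :
    f z = g z := by
  rw [supp, Finsupp.supported_eq_span_single] at hz
  exact LinearMap.eqOn_span (by rintro _ ⟨σ, hσ, rfl⟩; exact h σ hσ) hz

theorem map_mem_of_supp {M : Type*} [AddCommGroup M] {A : Set Y} {f : SChain n Y →ₗ[ℤ] M}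
    {p : Submodule ℤ M} (h : ∀ σ : SSimplex n Y, σ.In A → f (of σ) ∈ p) {z : SChain n Y}
    (hz : z ∈ supp n A) : f z ∈ p := by
  rw [supp, Finsupp.supported_eq_span_single] at hz
  have : Submodule.span ℤ ((fun σ : SSimplex n Y => of σ) '' {σ | σ.In A}) ≤ p.comap f :=
    Submodule.span_le.2 (by rintro _ ⟨σ, hσ, rfl⟩; exact h σ hσ)
  exact this hz

theorem of_mem_supp {A : Set Y} {σ : SSimplex n Y} (h : σ.In A) : of σ ∈ supp n A :=
  Finsupp.single_mem_supported ℤ 1 h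

theorem bdry_mem_supp {A : Set Y} {z : SChain (n + 1) Y} (hz : z ∈ supp (n + 1) A) :
    bdry z ∈ supp n A :=
  map_mem_of_supp (fun σ hσ => by
    rw [bdry_of]
    exact Submodule.sum_mem _ fun i _ => Submodule.smul_mem _ _ (of_mem_supp (hσ.face i))) hz

theorem push_mem_supp {A : Set Y} {B : Set Z} {f : C(Y, Z)} (hf : ∀ y ∈ A, f y ∈ B)
    {z : SChain n Y} (hz : z ∈ supp n A) : push f z ∈ supp n B :=
  map_mem_of_supp (fun σ hσ => by
    rw [push_of]; exact of_mem_supp fun t => hf _ (hσ t)) hz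

theorem mem_supp_univ (z : SChain n Y) : z ∈ supp n (Set.univ : Set Y) := by
  intro σ _ t; trivial

theorem supp_mono {A B : Set Y} (h : A ⊆ B) : supp n A ≤ supp n B :=
  Finsupp.supported_mono fun _ hσ t => h (hσ t)

theorem mem_supp_inter {A B : Set Y} {z : SChain n Y} (hA : z ∈ supp n A) (hB : z ∈ supp n B) :
    z ∈ supp n (A ∩ B) := fun _ hσ t => ⟨hA hσ t, hB hσ t⟩

/-- If, for each simplex `σ` in `A`, the simplex `g ∘ σ` factors through `i`, then the chains in
`A` are sent by `g` to images of chains under `i`. -/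
theorem exists_push_eq {T : Type*} [TopologicalSpace T] {A : Set Y} {g : C(Y, Z)} {i : C(T, Z)}
    (h : ∀ σ : SSimplex n Y, σ.In A → ∃ σ' : SSimplex n T, i.comp σ' = g.comp σ)
    {z : SChain n Y} (hz : z ∈ supp n A) : ∃ z' : SChain n T, push i z' = push g z := by
  have : push g z ∈ LinearMap.range (push (n := n) i) := map_mem_of_supp (fun σ hσ => by
    obtain ⟨σ', h'⟩ := h σ hσ
    exact ⟨of σ', by rw [push_of, push_of, h']⟩) hz
  exact this

theorem exists_comp_eq_of_isEmbedding {i : C(Y, Z)} (hi : IsEmbedding i) {σ : SSimplex n Z}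
    (hσ : σ.In (Set.range i)) : ∃ σ' : SSimplex n Y, i.comp σ' = σ := by
  choose s hs using hσ
  refine ⟨⟨s, hi.continuous_iff.2 ?_⟩, ContinuousMap.ext hs⟩
  convert σ.continuous using 1
  exact funext hs

/-- Chains in the image of an embedding lift. -/
theorem exists_push_eq_of_isEmbedding {i : C(Y, Z)} (hi : IsEmbedding i) {z : SChain n Z}
    (hz : z ∈ supp n (Set.range i)) : ∃ z' : SChain n Y, push i z' = z := by
  have := exists_push_eq (n := n) (g := ContinuousMap.id Z) (i := i) (A := Set.range i)
    (fun σ hσ => exists_comp_eq_of_isEmbedding hi hσ) hz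
  simpa only [push_id] using this

/-- The homomorphism on `0`-chains given by a function on points. -/
noncomputable def ext0 {M : Type*} [AddCommGroup M] (φ : Y → M) : SChain 0 Y →ₗ[ℤ] M :=
  Finsupp.linearCombination ℤ fun σ => φ (σ.vtx 0)

theorem ext0_bdry_of {M : Type*} [AddCommGroup M] (φ : Y → M) (γ : SSimplex 1 Y) :
    ext0 φ (bdry (of γ)) = φ (γ.vtx 1) - φ (γ.vtx 0) := by
  rw [bdry_of_one, map_sub]
  simp [ext0, vtx_face]

/-- The `0`-simplex at a point. -/
def pt0 (y : Y) : SSimplex 0 Y := ContinuousMap.const _ y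

theorem eq_pt0 (σ : SSimplex 0 Y) : σ = pt0 (σ.vtx 0) := by
  ext t
  rw [Subsingleton.elim t (stdSimplex.vertex 0)]
  rfl

theorem bdry_of_one_eq (γ : SSimplex 1 Y) :
    bdry (of γ) = of (pt0 (γ.vtx 1)) - of (pt0 (γ.vtx 0)) := by
  rw [bdry_of_one, eq_pt0 (face γ 0), eq_pt0 (face γ 1), vtx_face, vtx_face]
  rfl

end SChain

/-! ### Affine simplices and midpoint subdivision -/

namespace SSimplex

open SChain

variable {Y : Type*} [TopologicalSpace Y] {m n : ℕ}

/-- The affine map from the standard simplex with prescribed images of the vertices. -/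
noncomputable def aff (v : Fin (m + 1) → stdSimplex ℝ (Fin (n + 1))) :
    C(stdSimplex ℝ (Fin (m + 1)), stdSimplex ℝ (Fin (n + 1))) where
  toFun t := ⟨∑ i, t i • (v i : Fin (n + 1) → ℝ),
    (convex_stdSimplex ℝ _).sum_mem (fun i _ => stdSimplex.zero_le t i) (stdSimplex.sum_eq_one t)
      fun i _ => (v i).2⟩
  continuous_toFun := by
    refine Continuous.subtype_mk (continuous_finsetSum _ fun i _ => ?_) _
    exact ((continuous_apply i).comp continuous_subtype_val).smul continuous_const

theorem aff_coe (v : Fin (m + 1) → stdSimplex ℝ (Fin (n + 1))) (t : stdSimplex ℝ (Fin (m + 1))) :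
    (aff v t).1 = ∑ i, t.1 i • (v i).1 := rfl

@[simp] theorem aff_vertex (v : Fin (m + 1) → stdSimplex ℝ (Fin (n + 1))) (i : Fin (m + 1)) :
    aff v (stdSimplex.vertex i) = v i := by
  apply Subtype.ext
  rw [aff_coe, Finset.sum_eq_single i]
  · simp
  · intro j _ hj
    simp [hj]
  · simp

theorem aff_map {k : ℕ} (v : Fin (m + 1) → stdSimplex ℝ (Fin (n + 1)))
    (f : Fin (k + 1) → Fin (m + 1)) (t : stdSimplex ℝ (Fin (k + 1))) : aff v (stdSimplex.map f t) = aff (v ∘ f) t := by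
  apply Subtype.ext
  rw [aff_coe, aff_coe]
  have : ∀ i, (stdSimplex.map f t).1 i = ∑ j with f j = i, t.1 j := fun i =>
    FunOnFinite.linearMap_apply_apply ℝ ℝ f t.1 i
  simp only [this, Finset.sum_smul]
  rw [← Finset.sum_fiberwise (g := f)]
  refine Finset.sum_congr rfl fun i _ => Finset.sum_congr rfl fun j hj => ?_
  rw [Finset.mem_filter] at hj
  simp [hj.2]

theorem aff_aff {k : ℕ} (v : Fin (m + 1) → stdSimplex ℝ (Fin (n + 1)))
    (w : Fin (k + 1) → stdSimplex ℝ (Fin (m + 1))) :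
    (aff v).comp (aff w) = aff fun i => aff v (w i) := by
  ext t : 1
  apply Subtype.ext
  rw [ContinuousMap.comp_apply, aff_coe, aff_coe]
  simp only [aff_coe, Finset.smul_sum, smul_smul, Finset.sum_apply, Finset.sum_smul]
  rw [Finset.sum_comm]
  rfl

theorem aff_id : aff (stdSimplex.vertex (S := ℝ) (X := Fin (n + 1))) = ContinuousMap.id _ := by
  ext t : 1
  apply Subtype.ext
  rw [aff_coe]
  ext j
  rw [Finset.sum_apply, Finset.sum_eq_single j]
  · simp
  · intro i _ hi; simp [hi.symm]
  · simp

/-- The midpoint of two points of the standard simplex. -/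
noncomputable def mid (a b : stdSimplex ℝ (Fin (n + 1))) : stdSimplex ℝ (Fin (n + 1)) :=
  ⟨midpoint ℝ (a : Fin (n + 1) → ℝ) b, (convex_stdSimplex ℝ _).midpoint_mem a.2 b.2⟩

theorem mid_coe (a b : stdSimplex ℝ (Fin (n + 1))) : (mid a b).1 = (2⁻¹ : ℝ) • (a.1 + b.1) := by
  exact (midpoint_eq_smul_add ℝ a.1 b.1).trans (by norm_num)

theorem aff_mid (v : Fin (m + 1) → stdSimplex ℝ (Fin (n + 1))) (a b : stdSimplex ℝ (Fin (m + 1))) :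
    aff v (mid a b) = mid (aff v a) (aff v b) := by
  apply Subtype.ext
  simp only [mid_coe, aff_coe, ← Finset.sum_add_distrib, Finset.smul_sum]
  refine Finset.sum_congr rfl fun i _ => ?_
  rw [← add_smul, smul_smul]
  rfl

/-- The affine `m`-simplex with vertices `v` inside the simplex `σ`. -/
noncomputable def sub (σ : SSimplex n Y) (v : Fin (m + 1) → stdSimplex ℝ (Fin (n + 1))) :
    SSimplex m Y :=
  ContinuousMap.comp σ (aff v)

theorem face_sub (σ : SSimplex n Y) (v : Fin (m + 2) → stdSimplex ℝ (Fin (n + 1)))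
    (i : Fin (m + 2)) : face (σ.sub v) i = σ.sub (v ∘ i.succAbove) := by
  ext t
  simp [face, sub, aff_map]

theorem sub_sub {k : ℕ} (σ : SSimplex n Y) (v : Fin (m + 1) → stdSimplex ℝ (Fin (n + 1)))
    (w : Fin (k + 1) → stdSimplex ℝ (Fin (m + 1))) :
    (σ.sub v).sub w = σ.sub fun i => aff v (w i) := by
  rw [sub, sub, ContinuousMap.comp_assoc, aff_aff]; rfl

theorem sub_vertex (σ : SSimplex n Y) : σ.sub stdSimplex.vertex = σ := by
  rw [sub, aff_id]; rfl

@[simp] theorem vtx_sub (σ : SSimplex n Y) (v : Fin (m + 1) → stdSimplex ℝ (Fin (n + 1)))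
    (i : Fin (m + 1)) : (σ.sub v).vtx i = σ (v i) := by
  simp [vtx, sub]

theorem In.sub {σ : SSimplex n Y} {A : Set Y} (h : σ.In A)
    (v : Fin (m + 1) → stdSimplex ℝ (Fin (n + 1))) : (σ.sub v).In A := h.comp _

/-- The `i`-th vertex of the standard simplex. -/
noncomputable abbrev e (i : Fin (n + 1)) : stdSimplex ℝ (Fin (n + 1)) := stdSimplex.vertex i

theorem face_sub_two (σ : SSimplex n Y) (a b c : stdSimplex ℝ (Fin (n + 1))) :
    face (σ.sub ![a, b, c]) 0 = σ.sub ![b, c] ∧ face (σ.sub ![a, b, c]) 1 = σ.sub ![a, c] ∧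
      face (σ.sub ![a, b, c]) 2 = σ.sub ![a, b] := by
  simp only [face_sub]
  refine ⟨?_, ?_, ?_⟩ <;> congr 1 <;> ext i : 1 <;> fin_cases i <;> rfl

theorem face_sub_three (σ : SSimplex n Y) (a b c d : stdSimplex ℝ (Fin (n + 1))) :
    face (σ.sub ![a, b, c, d]) 0 = σ.sub ![b, c, d] ∧
    face (σ.sub ![a, b, c, d]) 1 = σ.sub ![a, c, d] ∧
      face (σ.sub ![a, b, c, d]) 2 = σ.sub ![a, b, d] ∧
      face (σ.sub ![a, b, c, d]) 3 = σ.sub ![a, b, c] := by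
  simp only [face_sub]
  refine ⟨?_, ?_, ?_, ?_⟩ <;> congr 1 <;> ext i : 1 <;> fin_cases i <;> rfl

theorem sub_vertex_one (σ : SSimplex 1 Y) : σ.sub ![e 0, e 1] = σ := by
  rw [← σ.sub_vertex]
  simp only [sub_sub]
  congr 1; ext i : 1; fin_cases i <;> simp

theorem sub_vertex_two (σ : SSimplex 2 Y) : σ.sub ![e 0, e 1, e 2] = σ := by
  rw [← σ.sub_vertex]
  simp only [sub_sub]
  congr 1; ext i : 1; fin_cases i <;> simp

theorem face_two (σ : SSimplex 2 Y) : face σ 0 = σ.sub ![e 1, e 2] ∧ face σ 1 = σ.sub ![e 0, e 2] ∧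
    face σ 2 = σ.sub ![e 0, e 1] := by
  have := face_sub_two σ (e 0) (e 1) (e 2)
  rwa [sub_vertex_two] at this

theorem sub_sub_two (σ : SSimplex n Y) (v : Fin (m + 1) → stdSimplex ℝ (Fin (n + 1)))
    (a b : stdSimplex ℝ (Fin (m + 1))) :
    (σ.sub v).sub ![a, b] = σ.sub ![aff v a, aff v b] := by
  rw [sub_sub]; congr 1; ext i : 1; fin_cases i <;> rfl

theorem sub_sub_three (σ : SSimplex n Y) (v : Fin (m + 1) → stdSimplex ℝ (Fin (n + 1)))
    (a b c : stdSimplex ℝ (Fin (m + 1))) :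
    (σ.sub v).sub ![a, b, c] = σ.sub ![aff v a, aff v b, aff v c] := by
  rw [sub_sub]; congr 1; ext i : 1; fin_cases i <;> rfl

theorem aff_mem_ball (v : Fin (m + 1) → stdSimplex ℝ (Fin (n + 1))) {x : stdSimplex ℝ (Fin (n + 1))}
    {δ : ℝ} (h : ∀ i, dist (v i) x < δ) (t : stdSimplex ℝ (Fin (m + 1))) :
    dist (aff v t) x < δ := by
  have := (convex_ball (x : Fin (n + 1) → ℝ) δ).sum_mem (t := Finset.univ) (w := fun i => t i)
    (z := fun i => (v i : Fin (n + 1) → ℝ)) (fun i _ => stdSimplex.zero_le t i)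
    (stdSimplex.sum_eq_one t) (fun i _ => h i)
  exact this

theorem dist_mid_mid (a b c : stdSimplex ℝ (Fin (n + 1))) :
    dist (mid a b) (mid a c) = dist b c / 2 := by
  change dist (midpoint ℝ (a : Fin (n + 1) → ℝ) b) (midpoint ℝ (a : Fin (n + 1) → ℝ) c) =
    dist (b : Fin (n + 1) → ℝ) c / 2
  rw [dist_eq_norm, dist_eq_norm, midpoint_eq_smul_add, midpoint_eq_smul_add, ← smul_sub,
    norm_smul]
  norm_num
  ring

theorem mid_comm (a b : stdSimplex ℝ (Fin (n + 1))) : mid a b = mid b a :=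
  Subtype.ext (midpoint_comm (R := ℝ) a.1 b.1)

theorem mid_self (a : stdSimplex ℝ (Fin (n + 1))) : mid a a = a := Subtype.ext (midpoint_self ℝ a.1)

/-- Midpoint subdivision, in the form of an induction principle on paths: by Lebesgue's number
lemma, finitely many subdivisions make all pieces lie in `A` or in `B`. -/
theorem induction_one {A B : Set Y} (hA : IsOpen A) (hB : IsOpen B) (hAB : A ∪ B = Set.univ)
    {P : SSimplex 1 Y → Prop} (small : ∀ γ : SSimplex 1 Y, γ.In A ∨ γ.In B → P γ)
    (step : ∀ γ : SSimplex 1 Y, P (γ.sub ![e 0, mid (e 0) (e 1)]) →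
      P (γ.sub ![mid (e 0) (e 1), e 1]) → P γ) (γ : SSimplex 1 Y) : P γ := by
  obtain ⟨δ, hδ, h⟩ := lebesgue_number_lemma_of_metric
    (s := (Set.univ : Set (stdSimplex ℝ (Fin 2)))) isCompact_univ
    (c := fun b : Bool => γ ⁻¹' (if b then A else B))
    (by rintro (_ | _) <;> simp only [Bool.false_eq_true, if_true, if_false]
        exacts [hB.preimage γ.continuous, hA.preimage γ.continuous])
    (by intro x _
        have : γ x ∈ A ∪ B := hAB ▸ trivial
        rcases this with h | h
        · exact Set.mem_iUnion.2 ⟨true, h⟩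
        · exact Set.mem_iUnion.2 ⟨false, h⟩)
  have key : ∀ k : ℕ, ∀ a b, dist a b < δ * 2 ^ k → P (γ.sub ![a, b]) := by
    intro k
    induction k with
    | zero =>
      intro a b hab
      obtain ⟨i, hi⟩ := h a trivial
      have hin : ∀ t, aff ![a, b] t ∈ Metric.ball a δ := fun t => aff_mem_ball _ (by
        intro j; fin_cases j
        · simpa using hδ
        · simpa [dist_comm b a] using hab) t
      apply small
      cases i
      · exact Or.inr fun t => hi (hin t)
      · exact Or.inl fun t => hi (hin t)
    | succ k ih =>
      intro a b hab
      have hab' : dist a b / 2 < δ * 2 ^ k := by rw [pow_succ] at hab; linarith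
      apply step
      · rw [sub_sub_two, aff_mid]
        simp only [aff_vertex]
        apply ih
        have := dist_mid_mid a a b
        rw [mid_self] at this
        simpa [this] using hab'
      · rw [sub_sub_two, aff_mid]
        simp only [aff_vertex]
        apply ih
        have := dist_mid_mid b a b
        rw [mid_self, mid_comm] at this
        simpa [this] using hab'
  obtain ⟨k, hk⟩ := pow_unbounded_of_one_lt (dist (e 0 : stdSimplex ℝ (Fin 2)) (e 1) / δ)
    (one_lt_two (α := ℝ))
  rw [← γ.sub_vertex_one]
  exact key k _ _ (by rwa [div_lt_iff₀' hδ] at hk)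

/-- Midpoint subdivision, in the form of an induction principle on singular triangles; each step
cuts a triangle into the three triangles at its vertices and the central one. -/
theorem induction_two {A B : Set Y} (hA : IsOpen A) (hB : IsOpen B) (hAB : A ∪ B = Set.univ)
    {P : SSimplex 2 Y → Prop} (small : ∀ σ : SSimplex 2 Y, σ.In A ∨ σ.In B → P σ)
    (step : ∀ σ : SSimplex 2 Y, P (σ.sub ![e 0, mid (e 0) (e 1), mid (e 0) (e 2)]) →
      P (σ.sub ![mid (e 0) (e 1), e 1, mid (e 1) (e 2)]) →
      P (σ.sub ![mid (e 0) (e 2), mid (e 1) (e 2), e 2]) →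
      P (σ.sub ![mid (e 0) (e 1), mid (e 0) (e 2), mid (e 1) (e 2)]) → P σ)
    (σ : SSimplex 2 Y) : P σ := by
  obtain ⟨δ, hδ, h⟩ := lebesgue_number_lemma_of_metric
    (s := (Set.univ : Set (stdSimplex ℝ (Fin 3)))) isCompact_univ
    (c := fun b : Bool => σ ⁻¹' (if b then A else B))
    (by rintro (_ | _) <;> simp only [Bool.false_eq_true, if_true, if_false]
        exacts [hB.preimage σ.continuous, hA.preimage σ.continuous])
    (by intro x _
        have : σ x ∈ A ∪ B := hAB ▸ trivial
        rcases this with h | h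
        · exact Set.mem_iUnion.2 ⟨true, h⟩
        · exact Set.mem_iUnion.2 ⟨false, h⟩)
  have key : ∀ k : ℕ, ∀ a b c, dist a b < δ * 2 ^ k → dist a c < δ * 2 ^ k →
      dist b c < δ * 2 ^ k → P (σ.sub ![a, b, c]) := by
    intro k
    induction k with
    | zero =>
      intro a b c hab hac _
      obtain ⟨i, hi⟩ := h a trivial
      have hin : ∀ t, aff ![a, b, c] t ∈ Metric.ball a δ := fun t => aff_mem_ball _ (by
        intro j; fin_cases j
        · simpa using hδ
        · simpa [dist_comm b a] using hab
        · simpa [dist_comm c a] using hac) t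
      apply small
      cases i
      · exact Or.inr fun t => hi (hin t)
      · exact Or.inl fun t => hi (hin t)
    | succ k ih =>
      intro a b c hab hac hbc
      have hab' : dist a b / 2 < δ * 2 ^ k := by rw [pow_succ] at hab; linarith
      have hac' : dist a c / 2 < δ * 2 ^ k := by rw [pow_succ] at hac; linarith
      have hbc' : dist b c / 2 < δ * 2 ^ k := by rw [pow_succ] at hbc; linarith
      have h1 : ∀ x y : stdSimplex ℝ (Fin 3), dist x (mid x y) = dist x y / 2 := fun x y => by
        simpa [mid_self] using dist_mid_mid x x y
      have h2 : ∀ x y : stdSimplex ℝ (Fin 3), dist (mid x y) y = dist x y / 2 := fun x y => by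
        rw [mid_comm, dist_comm, h1, dist_comm]
      have h3 : ∀ x y z : stdSimplex ℝ (Fin 3), dist (mid x z) (mid y z) = dist x y / 2 :=
        fun x y z => by rw [mid_comm x, mid_comm y, dist_mid_mid]
      have h4 : ∀ x y z : stdSimplex ℝ (Fin 3), dist (mid x y) (mid y z) = dist x z / 2 :=
        fun x y z => by rw [mid_comm x, dist_mid_mid]
      apply step <;> rw [sub_sub_three] <;> simp only [aff_mid, aff_vertex] <;> apply ih <;>
        simpa [h1, h2, h3, h4, dist_mid_mid]
  obtain ⟨k, hk⟩ := pow_unbounded_of_one_lt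
    (Metric.diam (Set.univ : Set (stdSimplex ℝ (Fin 3))) / δ) (one_lt_two (α := ℝ))
  rw [div_lt_iff₀' hδ] at hk
  have hd : ∀ a b : stdSimplex ℝ (Fin 3), dist a b < δ * 2 ^ k := fun a b =>
    (Metric.dist_le_diam_of_mem isCompact_univ.isBounded trivial trivial).trans_lt hk
  rw [← σ.sub_vertex_two]
  exact key k _ _ _ (hd _ _) (hd _ _) (hd _ _)

end SSimplex

/-! ### Small chains -/

namespace SChain

open SSimplex

variable {Y : Type*} [TopologicalSpace Y] {n : ℕ}

/-- Midpoint subdivision of `1`-chains. -/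
noncomputable def sd1 : SChain 1 Y →ₗ[ℤ] SChain 1 Y :=
  Finsupp.linearCombination ℤ fun γ =>
    of (γ.sub ![e 0, mid (e 0) (e 1)]) + of (γ.sub ![mid (e 0) (e 1), e 1])

/-- Midpoint subdivision of `2`-chains: a triangle is cut into the three triangles at its vertices
and the central triangle, which is oriented the other way. -/
noncomputable def sd2 : SChain 2 Y →ₗ[ℤ] SChain 2 Y :=
  Finsupp.linearCombination ℤ fun σ =>
    of (σ.sub ![e 0, mid (e 0) (e 1), mid (e 0) (e 2)]) +
    of (σ.sub ![mid (e 0) (e 1), e 1, mid (e 1) (e 2)]) +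
    of (σ.sub ![mid (e 0) (e 2), mid (e 1) (e 2), e 2]) -
    of (σ.sub ![mid (e 0) (e 1), mid (e 0) (e 2), mid (e 1) (e 2)])

/-- The chain homotopy from the identity to the subdivision, in degree `1`. In degree `0`, where
the subdivision is the identity, the homotopy is zero. -/
noncomputable def sdT1 : SChain 1 Y →ₗ[ℤ] SChain 2 Y :=
  Finsupp.linearCombination ℤ fun γ => of (γ.sub ![e 0, mid (e 0) (e 1), e 1])

/-- The chain homotopy from the identity to the subdivision, in degree `2`: the cone, with apex the
vertex `0`, on the cycle `sd2 σ - σ - sdT1 (bdry σ)`. -/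
noncomputable def sdT2 : SChain 2 Y →ₗ[ℤ] SChain 3 Y :=
  Finsupp.linearCombination ℤ fun σ =>
    of (σ.sub ![e 0, e 0, mid (e 0) (e 1), mid (e 0) (e 2)]) +
    of (σ.sub ![e 0, mid (e 0) (e 1), e 1, mid (e 1) (e 2)]) +
    of (σ.sub ![e 0, mid (e 0) (e 2), mid (e 1) (e 2), e 2]) -
    of (σ.sub ![e 0, mid (e 0) (e 1), mid (e 0) (e 2), mid (e 1) (e 2)]) -
    of (σ.sub ![e 0, e 0, e 1, e 2]) - of (σ.sub ![e 0, e 1, mid (e 1) (e 2), e 2]) +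
    of (σ.sub ![e 0, e 0, mid (e 0) (e 2), e 2]) - of (σ.sub ![e 0, e 0, mid (e 0) (e 1), e 1])

theorem bdry_sub_two {m : ℕ} (σ : SSimplex m Y) (a b c : stdSimplex ℝ (Fin (m + 1))) :
    bdry (of (σ.sub ![a, b, c])) = of (σ.sub ![b, c]) - of (σ.sub ![a, c]) + of (σ.sub ![a, b]) := by
  obtain ⟨h0, h1, h2⟩ := face_sub_two σ a b c
  rw [bdry_of_two, h0, h1, h2]

theorem bdry_sub_three {m : ℕ} (σ : SSimplex m Y) (a b c d : stdSimplex ℝ (Fin (m + 1))) :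
    bdry (of (σ.sub ![a, b, c, d])) = of (σ.sub ![b, c, d]) - of (σ.sub ![a, c, d]) +
      of (σ.sub ![a, b, d]) - of (σ.sub ![a, b, c]) := by
  obtain ⟨h0, h1, h2, h3⟩ := face_sub_three σ a b c d
  rw [bdry_of_three, h0, h1, h2, h3]

theorem sd1_sub {m : ℕ} (σ : SSimplex m Y) (a b : stdSimplex ℝ (Fin (m + 1))) :
    sd1 (of (σ.sub ![a, b])) = of (σ.sub ![a, mid a b]) + of (σ.sub ![mid a b, b]) := by
  simp [sd1, sub_sub_two, aff_mid]

theorem sdT1_sub {m : ℕ} (σ : SSimplex m Y) (a b : stdSimplex ℝ (Fin (m + 1))) :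
    sdT1 (of (σ.sub ![a, b])) = of (σ.sub ![a, mid a b, b]) := by
  simp [sdT1, sub_sub_three, aff_mid]

theorem bdry_two_eq (σ : SSimplex 2 Y) : bdry (of σ) =
    of (σ.sub ![e 1, e 2]) - of (σ.sub ![e 0, e 2]) + of (σ.sub ![e 0, e 1]) := by
  obtain ⟨h0, h1, h2⟩ := face_two σ
  rw [bdry_of_two, h0, h1, h2]

theorem bdry_sd2 (z : SChain 2 Y) : bdry (sd2 z) = sd1 (bdry z) := by
  have : (bdry ∘ₗ sd2 : SChain 2 Y →ₗ[ℤ] _) = sd1 ∘ₗ bdry := hom_ext fun σ => by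
    simp only [LinearMap.comp_apply, bdry_two_eq, map_add, map_sub, sd1_sub]
    simp only [sd2, Finsupp.linearCombination_single, one_smul, map_add, map_sub, bdry_sub_two]
    abel
  exact LinearMap.congr_fun this z

theorem bdry_sdT1 (z : SChain 1 Y) : bdry (sdT1 z) = sd1 z - z := by
  have : (bdry ∘ₗ sdT1 : SChain 1 Y →ₗ[ℤ] _) = sd1 - LinearMap.id := hom_ext fun γ => by
    simp only [LinearMap.comp_apply, sdT1, sd1, Finsupp.linearCombination_single, one_smul,
      LinearMap.sub_apply, bdry_sub_two, sub_vertex_one, LinearMap.id_apply]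
    abel
  exact LinearMap.congr_fun this z

theorem bdry_sdT2 (z : SChain 2 Y) : bdry (sdT2 z) = sd2 z - z - sdT1 (bdry z) := by
  have : (bdry ∘ₗ sdT2 : SChain 2 Y →ₗ[ℤ] _) = sd2 - LinearMap.id - sdT1 ∘ₗ bdry :=
    hom_ext fun σ => by
      simp only [LinearMap.comp_apply, LinearMap.sub_apply, bdry_two_eq, map_add, map_sub,
        sdT1_sub, LinearMap.id_apply]
      simp only [sdT2, sd2, Finsupp.linearCombination_single, one_smul, map_add, map_sub,
        bdry_sub_three, sub_vertex_two]
      abel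
  exact LinearMap.congr_fun this z

theorem sd1_mem_supp {A : Set Y} {z : SChain 1 Y} (hz : z ∈ supp 1 A) : sd1 z ∈ supp 1 A :=
  map_mem_of_supp (fun σ hσ => by
    simp only [sd1, Finsupp.linearCombination_single, one_smul]
    exact add_mem (of_mem_supp (hσ.sub _)) (of_mem_supp (hσ.sub _))) hz

theorem sdT1_mem_supp {A : Set Y} {z : SChain 1 Y} (hz : z ∈ supp 1 A) : sdT1 z ∈ supp 2 A :=
  map_mem_of_supp (fun σ hσ => by
    simp only [sdT1, Finsupp.linearCombination_single, one_smul]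
    exact of_mem_supp (hσ.sub _)) hz

theorem sd2_mem_supp {A : Set Y} {z : SChain 2 Y} (hz : z ∈ supp 2 A) : sd2 z ∈ supp 2 A :=
  map_mem_of_supp (fun σ hσ => by
    simp only [sd2, Finsupp.linearCombination_single, one_smul]
    exact sub_mem (add_mem (add_mem (of_mem_supp (hσ.sub _)) (of_mem_supp (hσ.sub _)))
      (of_mem_supp (hσ.sub _))) (of_mem_supp (hσ.sub _))) hz

theorem iterate_mem {S : Submodule ℤ (SChain n Y)} {f : SChain n Y →ₗ[ℤ] SChain n Y}
    (h : ∀ z ∈ S, f z ∈ S) (m : ℕ) {z : SChain n Y} (hz : z ∈ S) : (f ^ m) z ∈ S := by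
  induction m with
  | zero => exact hz
  | succ m ih => rw [pow_succ', Module.End.mul_apply]; exact h _ ih

/-- The chains that a power of `f` moves into an `f`-stable submodule `S`. -/
def absorbed (S : Submodule ℤ (SChain n Y)) (f : SChain n Y →ₗ[ℤ] SChain n Y)
    (h : ∀ z ∈ S, f z ∈ S) : Submodule ℤ (SChain n Y) where
  carrier := {z | ∃ m : ℕ, (f ^ m) z ∈ S}
  add_mem' := by
    rintro a b ⟨k, hk⟩ ⟨l, hl⟩
    refine ⟨k + l, ?_⟩
    rw [map_add]
    refine add_mem ?_ ?_
    · rw [add_comm, pow_add, Module.End.mul_apply]; exact iterate_mem h l hk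
    · rw [pow_add, Module.End.mul_apply]; exact iterate_mem h k hl
  zero_mem' := ⟨0, by simp⟩
  smul_mem' := by
    rintro c a ⟨k, hk⟩
    exact ⟨k, by rw [map_smul]; exact S.smul_mem c hk⟩

theorem mem_absorbed_of_map_mem {S : Submodule ℤ (SChain n Y)} {f : SChain n Y →ₗ[ℤ] SChain n Y}
    {h : ∀ z ∈ S, f z ∈ S} {z : SChain n Y} (hz : f z ∈ absorbed S f h) : z ∈ absorbed S f h := by
  obtain ⟨m, hm⟩ := hz
  exact ⟨m + 1, by rwa [pow_succ, Module.End.mul_apply]⟩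

theorem absorbed_eq_top {S : Submodule ℤ (SChain n Y)} {f : SChain n Y →ₗ[ℤ] SChain n Y}
    {h : ∀ z ∈ S, f z ∈ S} (hof : ∀ σ, of σ ∈ absorbed S f h) (z : SChain n Y) :
    z ∈ absorbed S f h :=
  map_mem_of_supp (f := LinearMap.id) (fun σ _ => hof σ) (mem_supp_univ z)

theorem sup_stable {S T : Submodule ℤ (SChain n Y)} {f : SChain n Y →ₗ[ℤ] SChain n Y}
    (hS : ∀ z ∈ S, f z ∈ S) (hT : ∀ z ∈ T, f z ∈ T) : ∀ z ∈ S ⊔ T, f z ∈ S ⊔ T := by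
  intro z hz
  obtain ⟨a, ha, b, hb, rfl⟩ := Submodule.mem_sup.1 hz
  rw [map_add]
  exact Submodule.add_mem_sup (hS a ha) (hT b hb)

variable {A B : Set Y}

theorem exists_sd1_pow_mem (hA : IsOpen A) (hB : IsOpen B) (hAB : A ∪ B = Set.univ)
    (z : SChain 1 Y) : ∃ m : ℕ, (sd1 ^ m) z ∈ supp 1 A ⊔ supp 1 B := by
  refine absorbed_eq_top (h := sup_stable (fun _ => sd1_mem_supp) fun _ => sd1_mem_supp)
    (fun σ => ?_) z
  refine induction_one (P := fun σ => of σ ∈ absorbed _ _ _) hA hB hAB (fun γ h => ⟨0, ?_⟩)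
    (fun γ h1 h2 => ?_) σ
  · rcases h with h | h
    · exact Submodule.mem_sup_left (of_mem_supp h)
    · exact Submodule.mem_sup_right (of_mem_supp h)
  · apply mem_absorbed_of_map_mem
    simp only [sd1, Finsupp.linearCombination_single, one_smul]
    exact add_mem h1 h2

theorem exists_sd2_pow_mem (hA : IsOpen A) (hB : IsOpen B) (hAB : A ∪ B = Set.univ)
    (z : SChain 2 Y) : ∃ m : ℕ, (sd2 ^ m) z ∈ supp 2 A ⊔ supp 2 B := by
  refine absorbed_eq_top (h := sup_stable (fun _ => sd2_mem_supp) fun _ => sd2_mem_supp)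
    (fun σ => ?_) z
  refine induction_two (P := fun σ => of σ ∈ absorbed _ _ _) hA hB hAB (fun γ h => ⟨0, ?_⟩)
    (fun γ h1 h2 h3 h4 => ?_) σ
  · rcases h with h | h
    · exact Submodule.mem_sup_left (of_mem_supp h)
    · exact Submodule.mem_sup_right (of_mem_supp h)
  · apply mem_absorbed_of_map_mem
    simp only [sd2, Finsupp.linearCombination_single, one_smul]
    exact sub_mem (add_mem (add_mem h1 h2) h3) h4

/-- A `1`-chain differs from its subdivisions by boundaries, within each set that contains it; it
need not be a cycle, since the subdivision fixes the `0`-chains. -/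
theorem sd1_pow_homologous {S : Set Y} (m : ℕ) {y : SChain 1 Y} (hy : y ∈ supp 1 S) :
    ∃ t ∈ supp 2 S, (sd1 ^ m) y = y + bdry t := by
  induction m with
  | zero => exact ⟨0, zero_mem _, by simp⟩
  | succ m ih =>
    obtain ⟨t, ht, h⟩ := ih
    refine ⟨t + sdT1 ((sd1 ^ m) y), add_mem ht (sdT1_mem_supp (iterate_mem
      (fun _ => sd1_mem_supp) m hy)), ?_⟩
    rw [map_add, bdry_sdT1, h, pow_succ', Module.End.mul_apply, h]
    abel

theorem bdry_sd2_pow (m : ℕ) (z : SChain 2 Y) : bdry ((sd2 ^ m) z) = (sd1 ^ m) (bdry z) := by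
  induction m with
  | zero => rfl
  | succ m ih =>
    rw [pow_succ', pow_succ', Module.End.mul_apply, Module.End.mul_apply, bdry_sd2, ih]

theorem sd2_pow_homologous (m : ℕ) {z : SChain 2 Y} (hz : bdry z = 0) :
    ∃ t, (sd2 ^ m) z = z + bdry t := by
  induction m with
  | zero => exact ⟨0, by simp⟩
  | succ m ih =>
    obtain ⟨t, h⟩ := ih
    refine ⟨t + sdT2 ((sd2 ^ m) z), ?_⟩
    rw [map_add, bdry_sdT2, bdry_sd2_pow, hz, map_zero, map_zero, sub_zero, h, pow_succ',
      Module.End.mul_apply, h]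
    abel

/-- Up to a boundary, a `1`-chain is a sum of chains in the members of an open cover `{A, B}`. -/
theorem exists_small_one (hA : IsOpen A) (hB : IsOpen B) (hAB : A ∪ B = Set.univ)
    (z : SChain 1 Y) :
    ∃ zA ∈ supp 1 A, ∃ zB ∈ supp 1 B, ∃ t, zA + zB = z + bdry t := by
  obtain ⟨m, hm⟩ := exists_sd1_pow_mem hA hB hAB z
  obtain ⟨zA, hzA, zB, hzB, h⟩ := Submodule.mem_sup.1 hm
  obtain ⟨t, -, ht⟩ := sd1_pow_homologous m (mem_supp_univ z)
  exact ⟨zA, hzA, zB, hzB, t, h.trans ht⟩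

/-- A `2`-cycle is homologous to a sum of chains in the members of an open cover `{A, B}`. -/
theorem exists_small_two (hA : IsOpen A) (hB : IsOpen B) (hAB : A ∪ B = Set.univ)
    {z : SChain 2 Y} (hz : bdry z = 0) :
    ∃ zA ∈ supp 2 A, ∃ zB ∈ supp 2 B, ∃ t, zA + zB = z + bdry t := by
  obtain ⟨m, hm⟩ := exists_sd2_pow_mem hA hB hAB z
  obtain ⟨zA, hzA, zB, hzB, h⟩ := Submodule.mem_sup.1 hm
  obtain ⟨t, ht⟩ := sd2_pow_homologous m hz
  exact ⟨zA, hzA, zB, hzB, t, h.trans ht⟩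

/-- A `1`-chain in `A` that bounds also bounds a sum of chains in the members of the open cover
`{A, B}`: a filling is subdivided, and the difference between the boundary and its subdivision is
filled inside `A`. -/
theorem exists_small_filling (hA : IsOpen A) (hB : IsOpen B) (hAB : A ∪ B = Set.univ)
    {z : SChain 2 Y} (hz : bdry z ∈ supp 1 A) :
    ∃ zA ∈ supp 2 A, ∃ zB ∈ supp 2 B, bdry z = bdry zA + bdry zB := by
  obtain ⟨m, hm⟩ := exists_sd2_pow_mem hA hB hAB z
  obtain ⟨zA, hzA, zB, hzB, h⟩ := Submodule.mem_sup.1 hm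
  obtain ⟨t, htA, ht⟩ := sd1_pow_homologous m hz
  refine ⟨zA - t, sub_mem hzA htA, zB, hzB, ?_⟩
  rw [← bdry_sd2_pow, ← h, map_add] at ht
  rw [map_sub, sub_add_eq_add_sub, ht, add_sub_cancel_right]

theorem bdry_bdry (z : SChain 2 Y) : bdry (bdry z) = 0 := by
  have : (bdry ∘ₗ bdry : SChain 2 Y →ₗ[ℤ] SChain 0 Y) = 0 := hom_ext fun σ => by
    simp [bdry_of_two, bdry_of_one_eq, vtx_face_two]
  exact LinearMap.congr_fun this z

theorem bdry_bdry_three (z : SChain 3 Y) : bdry (bdry z) = 0 := by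
  have : (bdry ∘ₗ bdry : SChain 3 Y →ₗ[ℤ] SChain 1 Y) = 0 := hom_ext fun σ => by
    have h : ∀ (i : Fin 4) (j : Fin 3), face (face σ i) j =
        σ.comp ⟨stdSimplex.map (i.succAbove ∘ j.succAbove), stdSimplex.continuous_map _⟩ := by
      intro i j
      ext t
      simp only [face, ContinuousMap.comp_apply, ContinuousMap.coe_mk]
      rw [stdSimplex.map_comp_apply]
    have c : ∀ (i k : Fin 4) (j l : Fin 3), i.succAbove ∘ j.succAbove = k.succAbove ∘ l.succAbove →
        face (face σ i) j = face (face σ k) l := fun i k j l hh => by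
      rw [h, h]; simp only [hh]
    rw [LinearMap.comp_apply, bdry_of_three]
    simp only [map_add, map_sub, bdry_of_two]
    rw [c 1 0 0 0 (by decide), c 2 0 0 1 (by decide), c 3 0 0 2 (by decide), c 2 1 1 1 (by decide),
      c 3 1 1 2 (by decide), c 3 2 2 2 (by decide), LinearMap.zero_apply]
    abel
  exact LinearMap.congr_fun this z

end SChain

/-! ### Flat non-abelian cochains -/

namespace SSimplex

variable {Y : Type*} [TopologicalSpace Y] {G : Type*} [Group G]

/-- The cochain `h`, with values in a group that need not be abelian, is multiplicative around the
triangle `σ`: its value on the edge from `0` to `2` is the product along the two other edges. -/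
def FlatOn (h : SSimplex 1 Y → G) (σ : SSimplex 2 Y) : Prop :=
  h (face σ 2) * h (face σ 0) = h (face σ 1)

theorem flatOn_sub {m : ℕ} {h : SSimplex 1 Y → G} {σ : SSimplex m Y}
    {a b c : stdSimplex ℝ (Fin (m + 1))} :
    FlatOn h (σ.sub ![a, b, c]) ↔ h (σ.sub ![a, b]) * h (σ.sub ![b, c]) = h (σ.sub ![a, c]) := by
  obtain ⟨h0, h1, h2⟩ := face_sub_two σ a b c
  rw [FlatOn, h0, h1, h2]

/-- The product of the values of `h` over the `2 ^ m` pieces of the `m`-th subdivision. -/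
noncomputable def subdivProd (h : SSimplex 1 Y → G) : ℕ → SSimplex 1 Y → G
  | 0, γ => h γ
  | m + 1, γ => subdivProd h m (γ.sub ![e 0, mid (e 0) (e 1)]) *
      subdivProd h m (γ.sub ![mid (e 0) (e 1), e 1])

/-- **Van Kampen's theorem**, for cochains: a function on paths that is flat on the triangles in
the members of an open cover `{A, B}` agrees, on the paths in `A` and the paths in `B`, with one
that is flat on all triangles. Its value on a path is the product over the pieces of a subdivision,
which does not change once the pieces are small. -/
theorem exists_flat_extension {A B : Set Y} (hA : IsOpen A) (hB : IsOpen B)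
    (hAB : A ∪ B = Set.univ) (h0 : SSimplex 1 Y → G)
    (hflat : ∀ σ : SSimplex 2 Y, σ.In A ∨ σ.In B → FlatOn h0 σ) :
    ∃ h : SSimplex 1 Y → G, (∀ σ, FlatOn h σ) ∧
      ∀ γ : SSimplex 1 Y, γ.In A ∨ γ.In B → h γ = h0 γ := by
  have hsmall : ∀ (m : ℕ) (γ : SSimplex 1 Y), γ.In A ∨ γ.In B → subdivProd h0 m γ = h0 γ := by
    intro m
    induction m with
    | zero => exact fun γ _ => rfl
    | succ m ih =>
      intro γ hγ
      rw [subdivProd, ih _ (hγ.imp (fun h => h.sub _) fun h => h.sub _),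
        ih _ (hγ.imp (fun h => h.sub _) fun h => h.sub _)]
      have := flatOn_sub.1 (hflat (γ.sub ![e 0, mid (e 0) (e 1), e 1])
        (hγ.imp (fun h => h.sub _) fun h => h.sub _))
      rwa [sub_vertex_one] at this
  have hlim : ∀ γ, ∃ c M, ∀ m ≥ M, subdivProd h0 m γ = c := by
    intro γ
    refine induction_one (P := fun γ => ∃ c M, ∀ m ≥ M, subdivProd h0 m γ = c) hA hB hAB
      (fun γ hγ => ⟨h0 γ, 0, fun m _ => hsmall m γ hγ⟩) ?_ γ
    rintro γ ⟨c, M, hc⟩ ⟨c', M', hc'⟩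
    refine ⟨c * c', max M M' + 1, fun m hm => ?_⟩
    obtain ⟨k, rfl⟩ : ∃ k, m = k + 1 := ⟨m - 1, by omega⟩
    rw [subdivProd, hc k (by omega), hc' k (by omega)]
  choose h M hM using hlim
  have heq : ∀ γ : SSimplex 1 Y, γ.In A ∨ γ.In B → h γ = h0 γ := fun γ hγ => by
    rw [← hM γ _ le_rfl, hsmall _ _ hγ]
  have hmul : ∀ {k : ℕ} (σ : SSimplex k Y) (a b), h (σ.sub ![a, b]) =
      h (σ.sub ![a, mid a b]) * h (σ.sub ![mid a b, b]) := by
    intro k σ a b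
    set γ := σ.sub ![a, b]
    have h1 : γ.sub ![e 0, mid (e 0) (e 1)] = σ.sub ![a, mid a b] := by
      simp [γ, sub_sub_two, aff_mid]
    have h2 : γ.sub ![mid (e 0) (e 1), e 1] = σ.sub ![mid a b, b] := by
      simp [γ, sub_sub_two, aff_mid]
    rw [← h1, ← h2, ← hM γ (max (M γ) (max (M (γ.sub ![e 0, mid (e 0) (e 1)]))
        (M (γ.sub ![mid (e 0) (e 1), e 1]))) + 1) (by omega), subdivProd,
      hM _ _ (by omega), hM _ _ (by omega)]
  refine ⟨h, fun σ => ?_, heq⟩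
  refine induction_two hA hB hAB (fun σ hσ => ?_) (fun σ f1 f2 f3 f4 => ?_) σ
  · rw [FlatOn, heq _ (hσ.imp (fun h => h.face _) fun h => h.face _),
      heq _ (hσ.imp (fun h => h.face _) fun h => h.face _),
      heq _ (hσ.imp (fun h => h.face _) fun h => h.face _)]
    exact hflat σ hσ
  · -- The four small triangles are multiplied together along the edges of the large one.
    rw [flatOn_sub] at f1 f2 f3 f4
    obtain ⟨d0, d1, d2⟩ := face_two σ
    rw [FlatOn, d0, d1, d2, hmul σ (e 0) (e 1), hmul σ (e 1) (e 2), hmul σ (e 0) (e 2), ← f1, ← f3,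
      mul_assoc, ← mul_assoc (h (σ.sub ![mid (e 0) (e 1), e 1])), f2, ← f4]
    simp only [mul_assoc]

theorem flat_mul {h : SSimplex 1 Y → G} (hf : ∀ σ, FlatOn h σ) {m : ℕ} (σ : SSimplex m Y)
    (a b c : stdSimplex ℝ (Fin (m + 1))) :
    h (σ.sub ![a, b]) * h (σ.sub ![b, c]) = h (σ.sub ![a, c]) :=
  flatOn_sub.1 (hf _)

theorem flat_const {h : SSimplex 1 Y → G} (hf : ∀ σ, FlatOn h σ) (y : Y) :
    h (ContinuousMap.const _ y) = 1 :=
  mul_eq_left.1 (hf (ContinuousMap.const _ y))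

end SSimplex

/-! ### Comparison with the singular chain complex of Mathlib -/

namespace SChain

open SSimplex AlgebraicTopology

variable {Y Z : Type u} [TopologicalSpace Y] [TopologicalSpace Z] {n : ℕ}

/-- The coefficient module. -/
noncomputable abbrev coeffs : ModuleCat.{u} ℤ := ModuleCat.of ℤ (ULift.{u} ℤ)

/-- The singular simplicial set. -/
noncomputable abbrev sing (Y : Type u) [TopologicalSpace Y] : SSet.{u} :=
  TopCat.toSSet.obj (TopCat.of Y)

/-- The singular chain complex of Mathlib, with the coefficients used for `singularH2`. -/
noncomputable abbrev singCx (Y : Type u) [TopologicalSpace Y] : ChainComplex (ModuleCat.{u} ℤ) ℕ :=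
  (sing Y).chainComplex coeffs.{u}

/-- The chain map of Mathlib induced by a continuous map. -/
noncomputable abbrev singMap (f : C(Y, Z)) : singCx Y ⟶ singCx Z :=
  SSet.chainComplexMap (TopCat.toSSet.map (TopCat.ofHom f)) coeffs.{u}

/-- The simplex of the singular simplicial set that corresponds to `σ`. -/
noncomputable def toSing (σ : SSimplex n Y) :
    (sing Y).obj (Opposite.op (SimplexCategory.mk n)) :=
  ((TopCat.of Y).toSSetObjEquiv (Opposite.op (SimplexCategory.mk n))).symm σ

/-- The simplex that corresponds to an element of the singular simplicial set. -/
noncomputable def ofSing (x : (sing Y).obj (Opposite.op (SimplexCategory.mk n))) : SSimplex n Y :=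
  (TopCat.of Y).toSSetObjEquiv (Opposite.op (SimplexCategory.mk n)) x

theorem ofSing_toSing (σ : SSimplex n Y) : ofSing (toSing σ) = σ := Equiv.apply_symm_apply _ _

theorem toSing_ofSing (x : (sing Y).obj (Opposite.op (SimplexCategory.mk n))) :
    toSing (ofSing x) = x := Equiv.symm_apply_apply _ _

/-- The basis element of Mathlib's chain complex that corresponds to a simplex. -/
noncomputable def cxOf (x : (sing Y).obj (Opposite.op (SimplexCategory.mk n))) :
    (singCx Y).X n :=
  ((sing Y).ιChainComplex (R := coeffs.{u}) x).hom (ULift.up 1)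

/-- The comparison map to the singular chain complex of Mathlib. -/
noncomputable def toCx (n : ℕ) (Y : Type u) [TopologicalSpace Y] :
    SChain n Y →ₗ[ℤ] (singCx Y).X n :=
  Finsupp.linearCombination ℤ fun σ => cxOf (toSing σ)

theorem toCx_of (σ : SSimplex n Y) : toCx n Y (of σ) = cxOf (toSing σ) := by
  rw [toCx, Finsupp.linearCombination_single]
  exact @one_smul ℤ ((singCx Y).X n) _ ((singCx Y).X n).isModule.toMulAction _

/-- The inverse of the comparison map, on one summand. -/
noncomputable def fromSummand (x : (sing Y).obj (Opposite.op (SimplexCategory.mk n))) :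
    coeffs.{u} ⟶ ModuleCat.of ℤ (SChain n Y) :=
  ModuleCat.ofHom ((LinearMap.toSpanSingleton ℤ (SChain n Y) (of (ofSing x))).comp
    ULift.moduleEquiv.toLinearMap)

/-- The inverse of the comparison map. -/
noncomputable def fromCx (n : ℕ) (Y : Type u) [TopologicalSpace Y] :
    (singCx Y).X n ⟶ ModuleCat.of ℤ (SChain n Y) :=
  ((sing Y).isColimitChainComplexXCofan coeffs.{u} n).desc
    (Limits.Cofan.mk (ModuleCat.of ℤ (SChain n Y)) fromSummand)

theorem ι_fromCx (x : (sing Y).obj (Opposite.op (SimplexCategory.mk n))) :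
    (sing Y).ιChainComplex x ≫ fromCx n Y = fromSummand x :=
  ((sing Y).isColimitChainComplexXCofan coeffs.{u} n).fac
    (Limits.Cofan.mk (ModuleCat.of ℤ (SChain n Y)) fromSummand) (Discrete.mk x)

theorem fromCx_cxOf (x : (sing Y).obj (Opposite.op (SimplexCategory.mk n))) :
    (fromCx n Y).hom (cxOf x) = of (ofSing x) := by
  have := congrArg (fun f : coeffs.{u} ⟶ ModuleCat.of ℤ (SChain n Y) => f.hom (ULift.up 1))
    (ι_fromCx x)
  refine this.trans ?_
  simp [fromSummand]

theorem fromCx_toCx (z : SChain n Y) : (fromCx n Y).hom (toCx n Y z) = z := by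
  have : ((fromCx n Y).hom ∘ₗ toCx n Y : SChain n Y →ₗ[ℤ] SChain n Y) = LinearMap.id :=
    hom_ext fun σ => by
      rw [LinearMap.comp_apply, toCx_of, fromCx_cxOf, ofSing_toSing]
      rfl
  exact LinearMap.congr_fun this z

theorem cx_hom_ext {M : ModuleCat.{u} ℤ} {f g : (singCx Y).X n ⟶ M}
    (h : ∀ x, f.hom (cxOf x) = g.hom (cxOf x)) : f = g := by
  apply SSet.chainComplex_hom_ext
  intro x
  refine ModuleCat.hom_ext (LinearMap.ext fun c => ?_)
  obtain ⟨c⟩ := c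
  have key : ∀ φ : ULift.{u} ℤ →+ M, φ (ULift.up c) = c • φ (ULift.up 1) := fun φ => by
    rw [← map_zsmul]
    congr 1
    ext
    simp
  exact (key (((sing Y).ιChainComplex x ≫ f).hom.toAddMonoidHom)).trans
    ((congrArg (c • ·) (h x)).trans
      (key (((sing Y).ιChainComplex x ≫ g).hom.toAddMonoidHom)).symm)

theorem toCx_fromCx (x : (singCx Y).X n) : toCx n Y ((fromCx n Y).hom x) = x := by
  have : fromCx n Y ≫ ModuleCat.ofHom (toCx n Y) = 𝟙 _ := by
    apply cx_hom_ext
    intro x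
    change toCx n Y ((fromCx n Y).hom (cxOf x)) = cxOf x
    rw [fromCx_cxOf, toCx_of, toSing_ofSing]
  exact congrArg (fun f : (singCx Y).X n ⟶ (singCx Y).X n => f.hom x) this

theorem toCx_injective : Function.Injective (toCx n Y) :=
  Function.LeftInverse.injective fromCx_toCx

theorem toCx_bdry (z : SChain (n + 1) Y) :
    toCx n Y (bdry z) = ((singCx Y).d (n + 1) n).hom (toCx (n + 1) Y z) := by
  have : (toCx n Y ∘ₗ bdry) = ((singCx Y).d (n + 1) n).hom ∘ₗ toCx (n + 1) Y :=
    hom_ext fun σ => by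
      have := congrArg (fun f : coeffs.{u} ⟶ (singCx Y).X n => f.hom (ULift.up 1))
        ((sing Y).ιChainComplex_d (R := coeffs.{u}) (toSing σ))
      rw [LinearMap.comp_apply, LinearMap.comp_apply, toCx_of]
      refine Eq.trans ?_ this.symm
      rw [bdry_of, map_sum]
      simp only [ModuleCat.hom_sum, LinearMap.sum_apply]
      refine Finset.sum_congr rfl fun i _ => ?_
      rw [map_zsmul, toCx_of]
      rfl
  exact LinearMap.congr_fun this z

theorem toCx_push (f : C(Y, Z)) (z : SChain n Y) :
    toCx n Z (push f z) = ((singMap f).f n).hom (toCx n Y z) := by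
  have : (toCx n Z ∘ₗ push f) = ((singMap f).f n).hom ∘ₗ toCx n Y :=
    hom_ext fun σ => by
      have := congrArg (fun f : coeffs.{u} ⟶ (singCx Z).X n => f.hom (ULift.up 1))
        (SSet.ι_chainComplexMap_f (sing Y) (sing Z) (TopCat.toSSet.map (TopCat.ofHom f))
          coeffs.{u} (toSing σ))
      rw [LinearMap.comp_apply, LinearMap.comp_apply, toCx_of, push_of, toCx_of]
      exact this.symm
  exact LinearMap.congr_fun this z

/-- Homotopic maps send a cycle to homologous cycles. -/
theorem push_homologous {f g : C(Y, Z)} (H : f.Homotopic g) {z : SChain (n + 1) Y}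
    (hz : bdry z = 0) : ∃ t, push f z - push g z = bdry t := by
  obtain ⟨H⟩ := H
  have h : _root_.Homotopy (singMap f) (singMap g) :=
    TopCat.Homotopy.singularChainComplexFunctorObjMap (C := ModuleCat.{u} ℤ)
    (f := TopCat.ofHom f) (g := TopCat.ofHom g) H coeffs.{u}
  have hc := h.comm (n + 1)
  rw [dNext_eq _ (show (ComplexShape.down ℕ).Rel (n + 1) n from rfl),
    prevD_eq _ (show (ComplexShape.down ℕ).Rel (n + 2) (n + 1) from rfl)] at hc
  refine ⟨(fromCx (n + 2) Z).hom ((h.hom (n + 1) (n + 2)).hom (toCx (n + 1) Y z)), ?_⟩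
  apply toCx_injective
  rw [toCx_bdry, toCx_fromCx, map_sub, toCx_push, toCx_push]
  have := congrArg (fun f : (singCx Y).X (n + 1) ⟶ (singCx Z).X (n + 1) =>
    f.hom (toCx (n + 1) Y z)) hc
  rw [sub_eq_iff_eq_add]
  refine this.trans ?_
  simp [← toCx_bdry, hz]

/-- If a continuous map sends every `2`-cycle to a boundary, then it induces the zero map
on `H_2`. -/
theorem singularH2_map_eq_zero (f : C(Y, Z))
    (h : ∀ z : SChain 2 Y, bdry z = 0 → ∃ t, push f z = bdry t) :
    singularH2.map (TopCat.ofHom f) = 0 := by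
  change HomologicalComplex.homologyMap (singMap f) 2 = 0
  rw [← cancel_epi ((singCx Y).homologyπ 2), Limits.comp_zero,
    HomologicalComplex.homologyπ_naturality]
  ext x
  set w := ((singCx Y).iCycles 2).hom x
  have hw : ((singCx Y).d 2 1).hom w = 0 := by
    have := congrArg (fun f : (singCx Y).cycles 2 ⟶ (singCx Y).X 1 => f.hom x)
      ((singCx Y).iCycles_d 2 1)
    exact this
  obtain ⟨t, ht⟩ := h ((fromCx 2 Y).hom w) (toCx_injective (by
    rw [toCx_bdry, toCx_fromCx, hw, map_zero]))
  have hx : ((HomologicalComplex.cyclesMap (singMap f) 2).hom x) =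
      ((singCx Z).toCycles 3 2).hom (toCx 3 Z t) := by
    apply (ModuleCat.mono_iff_injective ((singCx Z).iCycles 2)).1 inferInstance
    have h1 := congrArg (fun f : (singCx Y).cycles 2 ⟶ (singCx Z).X 2 => f.hom x)
      (HomologicalComplex.cyclesMap_i (singMap f) 2)
    have h2 := congrArg (fun f : (singCx Z).X 3 ⟶ (singCx Z).X 2 => f.hom (toCx 3 Z t))
      ((singCx Z).toCycles_i 3 2)
    refine h1.trans (Eq.trans ?_ h2.symm)
    change ((singMap f).f 2).hom w = ((singCx Z).d 3 2).hom _
    rw [← toCx_bdry, ← ht, toCx_push, toCx_fromCx]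
  change ((singCx Z).homologyπ 2).hom ((HomologicalComplex.cyclesMap (singMap f) 2).hom x) = 0
  rw [hx]
  have := congrArg (fun f : (singCx Z).X 3 ⟶ (singCx Z).homology 2 => f.hom (toCx 3 Z t))
    ((singCx Z).toCycles_comp_homologyπ 3 2)
  exact this

end SChain

/-! ### Vanishing of homology -/

namespace SSimplex

variable {Y : Type*} [TopologicalSpace Y]

/-- The affine simplex in the real line with prescribed vertices. -/
noncomputable def realAff {m : ℕ} (v : Fin (m + 1) → ℝ) : SSimplex m ℝ where
  toFun t := ∑ i, t.1 i * v i
  continuous_toFun := continuous_finsetSum _ fun i _ =>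
    ((continuous_apply i).comp continuous_subtype_val).mul continuous_const

theorem face_realAff {m : ℕ} (v : Fin (m + 2) → ℝ) (i : Fin (m + 2)) :
    face (realAff v) i = realAff (v ∘ i.succAbove) := by
  ext t
  have : ∀ j, (stdSimplex.map i.succAbove t).1 j = ∑ k with i.succAbove k = j, t.1 k := fun j =>
    FunOnFinite.linearMap_apply_apply ℝ ℝ i.succAbove t.1 j
  change ∑ j, (stdSimplex.map i.succAbove t).1 j * v j = ∑ k, t.1 k * v (i.succAbove k)
  simp only [this, Finset.sum_mul]
  rw [← Finset.sum_fiberwise (g := i.succAbove)]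
  refine Finset.sum_congr rfl fun j _ => Finset.sum_congr rfl fun k hk => ?_
  rw [Finset.mem_filter] at hk
  rw [hk.2]

/-- The affine path in the real line. -/
noncomputable def line (a b : ℝ) : SSimplex 1 ℝ := realAff ![a, b]

theorem line_apply (a b : ℝ) (t : stdSimplex ℝ (Fin 2)) :
    line a b t = t.1 0 * a + t.1 1 * b := by
  change ∑ i, t.1 i * ![a, b] i = _
  simp [Fin.sum_univ_two]

@[simp] theorem line_vtx_zero (a b : ℝ) : (line a b).vtx 0 = a := by
  simp [line_apply, vtx]

@[simp] theorem line_vtx_one (a b : ℝ) : (line a b).vtx 1 = b := by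
  simp [line_apply, vtx]

/-- A path, as a singular simplex. -/
noncomputable def ofPath {a b : Y} (p : Path a b) : SSimplex 1 Y :=
  (⟨p.extend, p.continuous_extend⟩ : C(ℝ, Y)).comp (line 0 1)

theorem ofPath_apply {a b : Y} (p : Path a b) (t) : ofPath p t = p.extend (line 0 1 t) := rfl

@[simp] theorem ofPath_vtx_zero {a b : Y} (p : Path a b) : (ofPath p).vtx 0 = a := by
  have : (ofPath p).vtx 0 = p.extend ((line 0 1).vtx 0) := rfl
  simp [this]

@[simp] theorem ofPath_vtx_one {a b : Y} (p : Path a b) : (ofPath p).vtx 1 = b := by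
  have : (ofPath p).vtx 1 = p.extend ((line 0 1).vtx 1) := rfl
  simp [this]

theorem ofPath_in {a b : Y} {p : Path a b} {S : Set Y} (h : ∀ t, p t ∈ S) : (ofPath p).In S :=
  fun _ => h _

end SSimplex

namespace SChain

open SSimplex

section

variable {Y : Type u} [TopologicalSpace Y]

/-- The linear map that sends a path to the constant `2`-simplex at its initial point. Constant
simplices of degree `1` are boundaries and those of degree `2` are not cycles; this map exhibits
both facts. -/
noncomputable def constTwo : SChain 1 Y →ₗ[ℤ] SChain 2 Y :=
  Finsupp.linearCombination ℤ fun γ => of (ContinuousMap.const _ (γ.vtx 0))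

theorem face_const {n : ℕ} (y : Y) (i : Fin (n + 2)) :
    face (ContinuousMap.const _ y : SSimplex (n + 1) Y) i = ContinuousMap.const _ y := rfl

theorem bdry_constTwo_const (y : Y) :
    bdry (constTwo (of (ContinuousMap.const _ y : SSimplex 1 Y))) = of (ContinuousMap.const _ y) := by
  simp [constTwo, bdry_of_two, face_const, vtx]

/-- A map that is constant on each simplex sends `2`-cycles to zero, since a constant `2`-simplex
is determined by its boundary. -/
theorem push_two_eq_zero {Z : Type*} [TopologicalSpace Z] {c : C(Y, Z)} {A : Set Y}
    (hc : ∀ σ : SSimplex 2 Y, σ.In A → ∃ y, c.comp σ = ContinuousMap.const _ y) {z : SChain 2 Y}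
    (hA : z ∈ supp 2 A) (hz : bdry z = 0) : push c z = 0 := by
  have : (constTwo ∘ₗ bdry ∘ₗ push c) z = push c z := eqOn_supp (fun σ hσ => by
    obtain ⟨y, hy⟩ := hc σ hσ
    rw [LinearMap.comp_apply, LinearMap.comp_apply, push_of, hy]
    simp [constTwo, bdry_of_two, face_const, vtx]) hA
  rw [← this, LinearMap.comp_apply, LinearMap.comp_apply, bdry_push, hz, map_zero, map_zero]

/-- A map that is constant on each path sends `1`-chains to boundaries. -/
theorem push_one_eq_bdry {c : C(Y, Y)}
    (hc : ∀ σ : SSimplex 1 Y, ∃ y, c.comp σ = ContinuousMap.const _ y) (z : SChain 1 Y) :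
    ∃ t, push c z = bdry t := by
  have : (bdry ∘ₗ constTwo ∘ₗ push c : SChain 1 Y →ₗ[ℤ] _) = push c := hom_ext fun σ => by
    obtain ⟨y, hy⟩ := hc σ
    rw [LinearMap.comp_apply, LinearMap.comp_apply, push_of, hy, bdry_constTwo_const]
  exact ⟨_, (LinearMap.congr_fun this z).symm⟩

theorem exists_bdry_one_of_homotopic {c : C(Y, Y)} (H : (ContinuousMap.id Y).Homotopic c)
    (hc : ∀ σ : SSimplex 1 Y, ∃ y, c.comp σ = ContinuousMap.const _ y) {z : SChain 1 Y}
    (hz : bdry z = 0) : ∃ t, z = bdry t := by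
  obtain ⟨t, ht⟩ := push_homologous H hz
  obtain ⟨s, hs⟩ := push_one_eq_bdry hc z
  refine ⟨t + s, ?_⟩
  rw [map_add, ← ht, ← hs, push_id, sub_add_cancel]

theorem exists_bdry_two_of_homotopic {c : C(Y, Y)} (H : (ContinuousMap.id Y).Homotopic c)
    (hc : ∀ σ : SSimplex 2 Y, ∃ y, c.comp σ = ContinuousMap.const _ y) {z : SChain 2 Y}
    (hz : bdry z = 0) : ∃ t, z = bdry t := by
  obtain ⟨t, ht⟩ := push_homologous H hz
  rw [push_two_eq_zero (fun σ _ => hc σ) (mem_supp_univ z) hz, push_id, sub_zero] at ht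
  exact ⟨t, ht⟩

theorem exists_bdry_of_contractible [ContractibleSpace Y] {z : SChain 1 Y} (hz : bdry z = 0) :
    ∃ t, z = bdry t := by
  obtain ⟨y, hy⟩ := id_nullhomotopic Y
  exact exists_bdry_one_of_homotopic hy (fun σ => ⟨y, rfl⟩) hz

end

section Sigma

universe v

variable {ι : Type u} {E : ι → Type v} [∀ i, TopologicalSpace (E i)]

/-- A disjoint union of contractible spaces can be contracted onto a discrete set. -/
theorem exists_homotopic_sigma [∀ i, ContractibleSpace (E i)] :
    ∃ c : C(Σ i, E i, Σ i, E i), (ContinuousMap.id _).Homotopic c ∧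
      ∀ {n : ℕ} (σ : SSimplex n (Σ i, E i)), ∃ y, c.comp σ = ContinuousMap.const _ y := by
  choose p hp using fun i => id_nullhomotopic (E i)
  let H := fun i => (hp i).some
  have hcont : Continuous fun x : (Σ i, E i) × unitInterval =>
      (⟨x.1.1, H x.1.1 (x.2, x.1.2)⟩ : Σ i, E i) := by
    have : Continuous fun x : Σ i, E i × unitInterval =>
        (⟨x.1, H x.1 (x.2.2, x.2.1)⟩ : Σ i, E i) :=
      continuous_sigma fun i => continuous_sigmaMk.comp
        ((H i).continuous.comp (continuous_snd.prodMk continuous_fst))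
    exact this.comp (Homeomorph.sigmaProdDistrib (X := E) (Y := unitInterval)).continuous
  refine ⟨⟨fun x => ⟨x.1, p x.1⟩, continuous_sigma fun i =>
    continuous_const (y := (⟨i, p i⟩ : Σ i, E i))⟩,
    ⟨{ toFun := fun x => ⟨x.2.1, H x.2.1 (x.1, x.2.2)⟩
       continuous_toFun := hcont.comp continuous_swap
       map_zero_left := fun x => by simp
       map_one_left := fun x => by simp }⟩, fun σ => ?_⟩
  obtain ⟨i, g, -, hg⟩ := σ.continuous.exists_lift_sigma
  refine ⟨⟨i, p i⟩, ContinuousMap.ext fun t => ?_⟩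
  have : σ t = ⟨i, g t⟩ := congrFun hg t
  simp [this]

theorem exists_bdry_one_sigma [∀ i, ContractibleSpace (E i)] {z : SChain 1 (Σ i, E i)}
    (hz : bdry z = 0) : ∃ t, z = bdry t := by
  obtain ⟨c, H, hc⟩ := exists_homotopic_sigma (E := E)
  exact exists_bdry_one_of_homotopic H hc hz

theorem exists_bdry_two_sigma [∀ i, ContractibleSpace (E i)] {z : SChain 2 (Σ i, E i)}
    (hz : bdry z = 0) : ∃ t, z = bdry t := by
  obtain ⟨c, H, hc⟩ := exists_homotopic_sigma (E := E)
  exact exists_bdry_two_of_homotopic H hc hz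

end Sigma

/-! ### The first homology of the sphere -/

variable {Y : Type u} [TopologicalSpace Y] {A B : Set Y}

/-- In a path-connected set, a `0`-chain of total weight zero is a boundary. -/
theorem exists_bdry_zero {S : Set Y} (hS : IsPathConnected S) {w : SChain 0 Y} (hw : w ∈ supp 0 S)
    (h0 : ext0 (fun _ => (1 : ℤ)) w = 0) : ∃ t ∈ supp 1 S, w = bdry t := by
  classical
  obtain ⟨p, hp, hj⟩ := hS
  have : Nonempty (SSimplex 1 Y) := ⟨ContinuousMap.const _ p⟩
  choose! γ hγ using fun y (hy : y ∈ S) => (show ∃ γ : SSimplex 1 Y, γ.In S ∧ γ.vtx 0 = p ∧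
    γ.vtx 1 = y from ⟨ofPath (hj hy).somePath, ofPath_in (hj hy).somePath_mem, by simp, by simp⟩)
  let P : SChain 0 Y →ₗ[ℤ] SChain 1 Y :=
    Finsupp.linearCombination ℤ fun σ => of (γ (σ.vtx 0))
  refine ⟨P w, map_mem_of_supp (fun σ hσ => ?_) hw, ?_⟩
  · simp only [P, Finsupp.linearCombination_single, one_smul]
    exact of_mem_supp (hγ _ (hσ _)).1
  · have : (bdry ∘ₗ P + ext0 fun _ => of (pt0 p) : SChain 0 Y →ₗ[ℤ] SChain 0 Y) w =
        (LinearMap.id : SChain 0 Y →ₗ[ℤ] SChain 0 Y) w := eqOn_supp (fun σ hσ => by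
      obtain ⟨-, h1, h2⟩ := hγ (σ.vtx 0) (hσ _)
      simp only [P, LinearMap.add_apply, LinearMap.comp_apply, Finsupp.linearCombination_single,
        one_smul, bdry_of_one_eq, h1, h2, LinearMap.id_apply, ext0]
      rw [← eq_pt0, sub_add_cancel]) hw
    have h2 : (ext0 fun _ => of (pt0 p)) w =
        (LinearMap.toSpanSingleton ℤ (SChain 0 Y) (of (pt0 p)))
          (ext0 (fun _ => (1 : ℤ)) w) := by
      have : (ext0 fun _ => of (pt0 p) : SChain 0 Y →ₗ[ℤ] SChain 0 Y) =
          (LinearMap.toSpanSingleton ℤ (SChain 0 Y) (of (pt0 p))) ∘ₗ ext0 (fun _ => (1 : ℤ)) :=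
        hom_ext fun σ => by simp [ext0]
      exact LinearMap.congr_fun this w
    rw [LinearMap.add_apply, h2, h0, map_zero, add_zero] at this
    exact this.symm

theorem ext0_one_bdry (z : SChain 1 Y) : ext0 (fun _ => (1 : ℤ)) (bdry z) = 0 := by
  have : ext0 (fun _ => (1 : ℤ)) ∘ₗ bdry = (0 : SChain 1 Y →ₗ[ℤ] ℤ) := hom_ext fun σ => by
    rw [LinearMap.comp_apply, ext0_bdry_of]; simp
  exact LinearMap.congr_fun this z

theorem exists_bdry_of_contractible_set [ContractibleSpace A] {z : SChain 1 Y} (hA : z ∈ supp 1 A)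
    (hz : bdry z = 0) : ∃ t, z = bdry t := by
  let i : C(A, Y) := ⟨Subtype.val, continuous_subtype_val⟩
  obtain ⟨z', rfl⟩ := exists_push_eq_of_isEmbedding (i := i) IsEmbedding.subtypeVal
    (by simpa [i] using hA)
  obtain ⟨t, rfl⟩ := exists_bdry_of_contractible (z := z')
    (push_injective (f := i) Subtype.val_injective (by rw [← bdry_push, hz, map_zero]))
  exact ⟨push i t, (bdry_push _ _).symm⟩

/-- If a space is the union of two contractible open sets with path-connected intersection, then
its `1`-cycles are boundaries. -/
theorem exists_bdry_of_cover [ContractibleSpace A] [ContractibleSpace B] (hA : IsOpen A)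
    (hB : IsOpen B) (hAB : A ∪ B = Set.univ) (hpc : IsPathConnected (A ∩ B)) {z : SChain 1 Y}
    (hz : bdry z = 0) : ∃ t, z = bdry t := by
  have hbb : ∀ t : SChain 2 Y, bdry (bdry t) = 0 := bdry_bdry
  obtain ⟨zA, hzA, zB, hzB, t, ht⟩ := exists_small_one hA hB hAB z
  have h1 : bdry zA + bdry zB = 0 := by rw [← map_add, ht, map_add, hz, hbb, add_zero]
  have h2 : bdry zB = - bdry zA := eq_neg_of_add_eq_zero_right h1
  obtain ⟨s, hs, hs'⟩ := exists_bdry_zero hpc (w := bdry zB)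
    (mem_supp_inter (h2 ▸ neg_mem (bdry_mem_supp hzA)) (bdry_mem_supp hzB)) (ext0_one_bdry zB)
  obtain ⟨a, ha⟩ := exists_bdry_of_contractible_set (A := A) (z := zA + s)
    (add_mem hzA (supp_mono Set.inter_subset_left hs)) (by rw [map_add, ← hs', h1])
  obtain ⟨b, hb⟩ := exists_bdry_of_contractible_set (A := B) (z := zB - s)
    (sub_mem hzB (supp_mono Set.inter_subset_right hs)) (by rw [map_sub, ← hs', sub_self])
  refine ⟨a + b - t, ?_⟩
  rw [map_sub, map_add, ← ha, ← hb, add_add_sub_cancel, ht, add_sub_cancel_right]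

theorem exists_bdry_of_homeomorph {Z : Type*} [TopologicalSpace Z] (φ : Y ≃ₜ Z)
    (h : ∀ z : SChain 1 Z, bdry z = 0 → ∃ t, z = bdry t) {z : SChain 1 Y} (hz : bdry z = 0) :
    ∃ t, z = bdry t := by
  let f : C(Y, Z) := ⟨φ, φ.continuous⟩
  let g : C(Z, Y) := ⟨φ.symm, φ.symm.continuous⟩
  have hgf : g.comp f = ContinuousMap.id Y := ContinuousMap.ext fun y => φ.symm_apply_apply y
  obtain ⟨t, ht⟩ := h (push f z) (by rw [bdry_push, hz, map_zero])
  refine ⟨push g t, ?_⟩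
  rw [bdry_push, ← ht, ← push_comp, hgf, push_id]

open Metric in
/-- The `1`-cycles in the `2`-sphere are boundaries. -/
theorem sphere_exists_bdry {z : SChain 1 (sphere (0 : EuclideanSpace ℝ (Fin 3)) 1)}
    (hz : bdry z = 0) : ∃ t, z = bdry t := by
  have : Fact (Module.finrank ℝ (EuclideanSpace ℝ (Fin 3)) = 2 + 1) := ⟨by simp⟩
  obtain ⟨v⟩ : Nonempty (sphere (0 : EuclideanSpace ℝ (Fin 3)) 1) :=
    ⟨⟨EuclideanSpace.single 0 1, by simp⟩⟩
  have hcontr (w : sphere (0 : EuclideanSpace ℝ (Fin 3)) 1) :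
      ContractibleSpace ({w}ᶜ : Set (sphere (0 : EuclideanSpace ℝ (Fin 3)) 1)) := by
    have e := (stereographic' 2 w).toHomeomorphSourceTarget
    rw [stereographic'_source, stereographic'_target] at e
    have := (Homeomorph.Set.univ (EuclideanSpace ℝ (Fin 2))).contractibleSpace
    exact e.contractibleSpace
  have hv : v ≠ -v := ne_neg_of_mem_unit_sphere ℝ v
  have := hcontr v
  have := hcontr (-v)
  refine exists_bdry_of_cover (A := {v}ᶜ) (B := {-v}ᶜ)
    isOpen_compl_singleton isOpen_compl_singleton ?_ ?_ hz
  · rw [← Set.compl_inter, Set.compl_univ_iff, Set.singleton_inter_eq_empty]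
    exact hv
  · set φ := stereographic' 2 v
    have hs : φ.source = {v}ᶜ := stereographic'_source v
    have ht : φ.target = Set.univ := stereographic'_target v
    have himg : ({v}ᶜ ∩ {-v}ᶜ : Set (sphere (0 : EuclideanSpace ℝ (Fin 3)) 1)) =
        φ.symm '' {φ (-v)}ᶜ := by
      ext x
      constructor
      · rintro ⟨hx, hx'⟩
        rw [← hs] at hx
        exact ⟨φ x, fun h => hx' (φ.injOn hx (hs ▸ hv.symm) h), φ.left_inv hx⟩
      · rintro ⟨y, hy, rfl⟩
        have hy' : y ∈ φ.target := ht ▸ trivial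
        refine ⟨hs ▸ φ.map_target hy', fun h => hy ?_⟩
        rw [Set.mem_singleton_iff, ← Set.mem_singleton_iff.1 h, φ.right_inv hy']
    rw [himg]
    refine IsPathConnected.image' (isPathConnected_compl_singleton_of_one_lt_rank ?_ _)
      (φ.continuousOn_symm.mono (ht ▸ Set.subset_univ _))
    rw [← Module.finrank_eq_rank, finrank_euclideanSpace_fin]
    norm_num

end SChain

/-! ### Flat cochains along paths -/

namespace SSimplex

variable {W : Type*} [TopologicalSpace W] {G : Type*} [Group G] {h : SSimplex 1 W → G}

theorem face_realAff_two (a b c : ℝ) :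
    face (realAff ![a, b, c]) 0 = line b c ∧ face (realAff ![a, b, c]) 1 = line a c ∧
      face (realAff ![a, b, c]) 2 = line a b := by
  simp only [face_realAff, line]
  refine ⟨?_, ?_, ?_⟩ <;> congr 1 <;> ext i : 1 <;> fin_cases i <;> rfl

/-- The value of a flat cochain along the segment from `a` to `b`, pulled back along `l`. -/
noncomputable def hol (h : SSimplex 1 W → G) (l : C(ℝ, W)) (a b : ℝ) : G := h (l.comp (line a b))

theorem hol_mul (hf : ∀ σ, FlatOn h σ) (l : C(ℝ, W)) (a b c : ℝ) :
    hol h l a b * hol h l b c = hol h l a c := by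
  obtain ⟨h0, h1, h2⟩ := face_realAff_two a b c
  have := hf (l.comp (realAff ![a, b, c]))
  rwa [FlatOn, comp_face, comp_face, comp_face, h0, h1, h2] at this

theorem hol_self (hf : ∀ σ, FlatOn h σ) (l : C(ℝ, W)) (a : ℝ) : hol h l a a = 1 :=
  mul_eq_left.1 (hol_mul hf l a a a)

theorem hol_symm (hf : ∀ σ, FlatOn h σ) (l : C(ℝ, W)) (a b : ℝ) : hol h l b a = (hol h l a b)⁻¹ :=
  eq_inv_of_mul_eq_one_left (by rw [hol_mul hf, hol_self hf])

theorem sum_two (t : stdSimplex ℝ (Fin 2)) : t.1 0 + t.1 1 = 1 := by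
  rw [← Fin.sum_univ_two]; exact t.2.2

/-- A flat cochain pulled back to the line depends only on the end points of a path: the square
swept out by the linear homotopy to a segment is cut along its diagonal. -/
theorem hol_path (hf : ∀ σ, FlatOn h σ) (l : C(ℝ, W)) (δ : SSimplex 1 ℝ) :
    h (l.comp δ) = hol h l (δ.vtx 0) (δ.vtx 1) := by
  let S : C(stdSimplex ℝ (Fin 2) × ℝ, ℝ) :=
    ⟨fun p => (1 - p.2) * δ p.1 + p.2 * line (δ.vtx 0) (δ.vtx 1) p.1, by fun_prop⟩
  let sq : ∀ {m : ℕ}, (Fin (m + 1) → stdSimplex ℝ (Fin 2)) → (Fin (m + 1) → ℝ) → SSimplex m ℝ :=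
    fun v r => S.comp ((aff v).prodMk (realAff r))
  have hface : ∀ {m : ℕ} (v : Fin (m + 2) → stdSimplex ℝ (Fin 2)) (r : Fin (m + 2) → ℝ)
      (i : Fin (m + 2)), face (sq v r) i = sq (v ∘ i.succAbove) (r ∘ i.succAbove) := by
    intro m v r i
    ext t
    have h1 : realAff r (stdSimplex.map i.succAbove t) = realAff (r ∘ i.succAbove) t :=
      DFunLike.congr_fun (face_realAff r i) t
    change S (aff v (stdSimplex.map i.succAbove t), realAff r (stdSimplex.map i.succAbove t)) =
      S (aff (v ∘ i.succAbove) t, realAff (r ∘ i.succAbove) t)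
    rw [h1, aff_map]
  have hsq : ∀ (v : Fin 2 → stdSimplex ℝ (Fin 2)) (r : Fin 2 → ℝ) (t : stdSimplex ℝ (Fin 2)),
      sq v r t = (1 - line (r 0) (r 1) t) * δ (aff v t) +
        line (r 0) (r 1) t * line (δ.vtx 0) (δ.vtx 1) (aff v t) := by
    intro v r t
    have : line (r 0) (r 1) = realAff r := by
      rw [line]; congr 1; ext i; fin_cases i <;> rfl
    rw [this]; rfl
  have hc : ∀ (x : ℝ) (t), line x x t = x := fun x t => by
    rw [line_apply, ← add_mul, sum_two, one_mul]
  have hid : ∀ t, aff ![e 0, e 1] t = t := fun t => by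
    have : aff ![e 0, e 1] = ContinuousMap.id (stdSimplex ℝ (Fin 2)) := by
      rw [← aff_id]; congr 1; ext i : 1; fin_cases i <;> rfl
    rw [this]; rfl
  have hconst : ∀ (a t : stdSimplex ℝ (Fin 2)), aff ![a, a] t = a := fun a t => by
    apply Subtype.ext
    rw [aff_coe, Fin.sum_univ_two]
    change t.1 0 • a.1 + t.1 1 • a.1 = a.1
    rw [← add_smul, sum_two, one_smul]
  have hl0 : line (δ.vtx 0) (δ.vtx 1) (e 0) = δ (e 0) := line_vtx_zero _ _
  have hl1 : line (δ.vtx 0) (δ.vtx 1) (e 1) = δ (e 1) := line_vtx_one _ _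
  have E1 : sq ![e 0, e 1] ![0, 0] = δ := by
    ext t; rw [hsq]; simp [hc, hid]
  have E2 : sq ![e 0, e 1] ![1, 1] = line (δ.vtx 0) (δ.vtx 1) := by
    ext t; rw [hsq]; simp [hc, hid]
  have E3 : sq ![e 1, e 1] ![0, 1] = ContinuousMap.const _ (δ.vtx 1) := by
    ext t; rw [hsq, hconst, hl1, ContinuousMap.const_apply, vtx]; ring
  have E4 : sq ![e 0, e 0] ![0, 1] = ContinuousMap.const _ (δ.vtx 0) := by
    ext t; rw [hsq, hconst, hl0, ContinuousMap.const_apply, vtx]; ring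
  have tri : ∀ (a b c : stdSimplex ℝ (Fin 2)) (x y z : ℝ),
      h (l.comp (sq ![a, b] ![x, y])) * h (l.comp (sq ![b, c] ![y, z])) =
        h (l.comp (sq ![a, c] ![x, z])) := by
    intro a b c x y z
    have := hf (l.comp (sq ![a, b, c] ![x, y, z]))
    rw [FlatOn, comp_face l, comp_face l, comp_face l, hface, hface, hface] at this
    have hv : ∀ {α : Type} (a b c : α), ![a, b, c] ∘ (2 : Fin 3).succAbove = ![a, b] ∧
        ![a, b, c] ∘ (0 : Fin 3).succAbove = ![b, c] ∧
        ![a, b, c] ∘ (1 : Fin 3).succAbove = ![a, c] := fun a b c => by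
      refine ⟨?_, ?_, ?_⟩ <;> ext i : 1 <;> fin_cases i <;> rfl
    rwa [(hv a b c).1, (hv a b c).2.1, (hv a b c).2.2, (hv x y z).1, (hv x y z).2.1,
      (hv x y z).2.2] at this
  have T1 := tri (e 0) (e 1) (e 1) 0 0 1
  have T2 := tri (e 0) (e 0) (e 1) 0 1 1
  have K : ∀ y, h (l.comp (ContinuousMap.const _ y)) = 1 := fun y => flat_const hf (l y)
  rw [E1, E3, K, mul_one] at T1
  rw [E4, E2, K, one_mul] at T2
  rw [T1, ← T2, hol]

theorem flat_refl (hf : ∀ σ, FlatOn h σ) (a : W) : h (ofPath (Path.refl a)) = 1 := by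
  have : ofPath (Path.refl a) = ContinuousMap.const _ a := by
    ext t; rw [ofPath_apply, Path.refl_extend]; rfl
  rw [this, flat_const hf]

theorem flat_symm (hf : ∀ σ, FlatOn h σ) {a b : W} (p : Path a b) :
    h (ofPath p.symm) = (h (ofPath p))⁻¹ := by
  have : ofPath p.symm = (⟨p.extend, p.continuous_extend⟩ : C(ℝ, W)).comp (line 1 0) := by
    ext t
    rw [ofPath_apply, Path.extend_symm_apply]
    change p.extend _ = p.extend _
    rw [line_apply, line_apply]
    congr 1; linear_combination -sum_two t
  rw [this]
  exact hol_symm hf _ _ _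

theorem flat_trans (hf : ∀ σ, FlatOn h σ) {a b c : W} (p : Path a b) (q : Path b c) :
    h (ofPath (p.trans q)) = h (ofPath p) * h (ofPath q) := by
  have h1 : ofPath p = (⟨(p.trans q).extend, (p.trans q).continuous_extend⟩ : C(ℝ, W)).comp
      (line 0 (1 / 2)) := by
    ext t
    have := sum_two t
    have := t.2.1 0
    rw [ofPath_apply]
    change p.extend _ = (p.trans q).extend _
    rw [Path.extend_trans_of_le_half, line_apply, line_apply]
    · congr 1; ring
    · rw [line_apply]; linarith
  have h2 : ofPath q = (⟨(p.trans q).extend, (p.trans q).continuous_extend⟩ : C(ℝ, W)).comp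
      (line (1 / 2) 1) := by
    ext t
    have := sum_two t
    have := t.2.1 1
    rw [ofPath_apply]
    change q.extend _ = (p.trans q).extend _
    rw [Path.extend_trans_of_half_le, line_apply, line_apply]
    · congr 1; linear_combination -sum_two t
    · rw [line_apply]; linarith
  rw [h1, h2]
  exact (hol_mul hf _ _ _ _).symm

/-- Along a periodic path, the holonomy from `0` transforms by the holonomy of a period. -/
theorem hol_add_int (hf : ∀ σ, FlatOn h σ) (l : C(ℝ, W)) (hl : ∀ x, l (x + 1) = l x) (x : ℝ)
    (n : ℤ) : hol h l 0 (x + n) = hol h l 0 1 ^ n * hol h l 0 x := by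
  have shift : ∀ a b, hol h l (a + 1) (b + 1) = hol h l a b := fun a b => by
    rw [hol, hol]
    congr 1
    ext t
    rw [ContinuousMap.comp_apply, ContinuousMap.comp_apply, ← hl (line a b t), line_apply,
      line_apply]
    congr 1; linear_combination sum_two t
  have step : ∀ x, hol h l 0 (x + 1) = hol h l 0 1 * hol h l 0 x := fun x => by
    rw [← hol_mul hf l 0 1 (x + 1)]
    congr 1
    simpa using shift 0 x
  induction n with
  | zero => simp
  | succ n ih =>
    rw [Int.cast_add, Int.cast_one, ← add_assoc, step, ih, ← mul_assoc, mul_self_zpow]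
  | pred n ih =>
    have := step (x + ((-n - 1 : ℤ) : ℝ))
    have e : x + ((-(n : ℤ) - 1 : ℤ) : ℝ) + 1 = x + ((-(n : ℤ) : ℤ) : ℝ) := by push_cast; ring
    rw [e, ih] at this
    rw [← mul_right_inj (hol h l 0 1), ← this, ← mul_assoc, mul_self_zpow]
    congr 2; ring

end SSimplex

/-! ### The wedge of circles -/

namespace WedgeOfCircles

open SSimplex SChain

variable {X : Type u}

/-- The point with parameter `s` on the circle `x`. -/
def pt (x : X) (s : unitInterval) : WedgeOfCircles X := Quot.mk _ (Sum.inr ⟨x, s⟩)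

theorem pt_zero (x : X) : pt x 0 = base X := Quot.sound (WedgeRel.zero x)

theorem pt_one (x : X) : pt x 1 = base X := Quot.sound (WedgeRel.one x)

theorem continuous_pt (x : X) : Continuous (pt x) := (loop x).continuous

/-- The quotient map that defines the wedge. -/
def proj (p : Unit ⊕ (Σ _ : X, unitInterval)) : WedgeOfCircles X := Quot.mk _ p

theorem isQuotientMap_proj : IsQuotientMap (proj (X := X)) :=
  isQuotientMap_quot_mk

/-- A function on the wedge, given on the circles. -/
def desc {Z : Type*} (z : Z) (f : X → unitInterval → Z) (h0 : ∀ x, f x 0 = z)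
    (h1 : ∀ x, f x 1 = z) : WedgeOfCircles X → Z :=
  Quot.lift (Sum.elim (fun _ => z) fun p => f p.1 p.2) (by
    rintro _ _ (x | x)
    exacts [h0 x, h1 x])

theorem continuous_desc {Z : Type*} [TopologicalSpace Z] {z : Z} {f : X → unitInterval → Z}
    {h0 : ∀ x, f x 0 = z} {h1 : ∀ x, f x 1 = z} (hf : ∀ x, Continuous (f x)) :
    Continuous (desc z f h0 h1) :=
  isQuotientMap_proj.continuous_iff.2
    (continuous_sum_dom.2 ⟨continuous_const, continuous_sigma fun x => hf x⟩)

theorem eq_base_or_pt (w : WedgeOfCircles X) : w = base X ∨ ∃ x s, w = pt x s := by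
  obtain ⟨⟨⟩ | ⟨x, s⟩, rfl⟩ := Quot.exists_rep w
  exacts [Or.inl rfl, Or.inr ⟨x, s, rfl⟩]

/-- The function `s (1 - s)` of the parameter, which vanishes exactly at the base point. -/
noncomputable def height : WedgeOfCircles X → ℝ :=
  desc 0 (fun _ s => s * (1 - s)) (by simp) (by simp)

theorem continuous_height : Continuous (height (X := X)) :=
  continuous_desc fun _ => by fun_prop

/-- The complement of the base point: the union of the open arcs. -/
def arcs (X : Type u) : Set (WedgeOfCircles X) := {w | 0 < height w}

/-- A neighbourhood of the base point: on each circle, the parameters outside `[1/4, 3/4]`. -/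
def star (X : Type u) : Set (WedgeOfCircles X) := {w | height w < 3 / 16}

theorem isOpen_arcs : IsOpen (arcs X) := isOpen_lt continuous_const continuous_height

theorem isOpen_star : IsOpen (star X) := isOpen_lt continuous_height continuous_const

theorem base_notMem_arcs : base X ∉ arcs X := fun h : (0 : ℝ) < 0 => lt_irrefl _ h

theorem star_union_arcs : star X ∪ arcs X = Set.univ := by
  refine Set.eq_univ_of_forall fun w => ?_
  rcases lt_or_ge 0 (height w) with h | h
  · exact Or.inr h
  · exact Or.inl (show height w < 3 / 16 by linarith)

theorem pt_mem_arcs {x : X} {s : unitInterval} :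
    pt x s ∈ arcs X ↔ (s : ℝ) ∈ Set.Ioo (0 : ℝ) 1 := by
  change 0 < (s : ℝ) * (1 - s) ↔ _
  have h0 := s.2.1
  have h1 := s.2.2
  constructor
  · intro h
    refine ⟨lt_of_le_of_ne h0 fun hs => ?_, lt_of_le_of_ne h1 fun hs => ?_⟩
    · rw [← hs] at h; simp at h
    · rw [hs] at h; simp at h
  · rintro ⟨h, h'⟩
    exact mul_pos h (by linarith)

theorem pt_mem_star {x : X} {s : unitInterval} :
    pt x s ∈ star X ↔ (s : ℝ) < 1 / 4 ∨ 3 / 4 < (s : ℝ) := by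
  change (s : ℝ) * (1 - s) < 3 / 16 ↔ _
  constructor
  · intro h
    by_contra! h'
    nlinarith
  · rintro (h | h) <;> nlinarith

open Classical in
/-- The circle and the parameter of a point that is not the base point. -/
noncomputable def coord : WedgeOfCircles X → Option (X × ℝ) :=
  desc none (fun x s => if (s : ℝ) ∈ Set.Ioo (0 : ℝ) 1 then some (x, (s : ℝ)) else none)
    (by simp) (by simp)

theorem coord_pt {x : X} {s : unitInterval} (h : (s : ℝ) ∈ Set.Ioo (0 : ℝ) 1) :
    coord (pt x s) = some (x, (s : ℝ)) :=
  if_pos h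

section ArcMap

variable {ι : Type u} {x : ι → X} {lo hi : ι → ℝ} (h0 : ∀ i, 0 ≤ lo i) (h1 : ∀ i, hi i ≤ 1)

/-- The inclusion of a family of open sub-arcs of the circles. -/
def arcMap (x : ι → X) (h0 : ∀ i, 0 ≤ lo i) (h1 : ∀ i, hi i ≤ 1) :
    C(Σ i, Set.Ioo (lo i) (hi i), WedgeOfCircles X) where
  toFun p := pt (x p.1) ⟨p.2, (h0 p.1).trans p.2.2.1.le, p.2.2.2.le.trans (h1 p.1)⟩
  continuous_toFun := continuous_sigma fun i =>
    (continuous_pt (x i)).comp (f := fun s : Set.Ioo (lo i) (hi i) =>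
      (⟨s, (h0 i).trans s.2.1.le, s.2.2.le.trans (h1 i)⟩ : unitInterval))
      (continuous_subtype_val.subtype_mk _)

theorem coord_arcMap (i : ι) (s : Set.Ioo (lo i) (hi i)) :
    coord (arcMap x h0 h1 ⟨i, s⟩) = some (x i, (s : ℝ)) :=
  coord_pt (x := x i) (s := ⟨s, (h0 i).trans s.2.1.le, s.2.2.le.trans (h1 i)⟩)
    ⟨(h0 i).trans_lt s.2.1, s.2.2.trans_le (h1 i)⟩

theorem arcMap_isOpenEmbedding
    (hinj : ∀ i j s, s ∈ Set.Ioo (lo i) (hi i) → s ∈ Set.Ioo (lo j) (hi j) → x i = x j → i = j) :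
    IsOpenEmbedding (arcMap x h0 h1) := by
  have hIoo : ∀ i (s : ℝ), s ∈ Set.Ioo (lo i) (hi i) → s ∈ Set.Ioo (0 : ℝ) 1 := fun i s hs =>
    ⟨(h0 i).trans_lt hs.1, hs.2.trans_le (h1 i)⟩
  refine .of_continuous_injective_isOpenMap (arcMap x h0 h1).continuous ?_ fun U hU => ?_
  · rintro ⟨i, s, hs⟩ ⟨j, t, ht⟩ h
    have := congrArg coord h
    rw [coord_arcMap, coord_arcMap] at this
    simp only [Option.some.injEq, Prod.mk.injEq] at this
    obtain ⟨hx, rfl⟩ := this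
    obtain rfl := hinj i j s hs ht hx
    rfl
  · rw [← isQuotientMap_proj.isOpen_preimage, isOpen_sum_iff]
    constructor
    · exact isOpen_discrete _
    · rw [isOpen_sigma_iff]
      intro y
      have : (Sigma.mk y ⁻¹' (Sum.inr ⁻¹' (proj ⁻¹' (arcMap x h0 h1 '' U)))) =
          ⋃ (i : ι) (_ : x i = y), (Subtype.val : unitInterval → ℝ) ⁻¹'
            ((Subtype.val : Set.Ioo (lo i) (hi i) → ℝ) '' 
              (Sigma.mk (β := fun i => Set.Ioo (lo i) (hi i)) i ⁻¹' U)) := by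
        ext s
        simp only [Set.mem_preimage, Set.mem_iUnion, Set.mem_image, exists_prop]
        constructor
        · rintro ⟨⟨i, t, ht⟩, hU', h⟩
          have hs : pt y s ∈ arcs X := by
            rw [show pt y s = _ from h.symm]
            exact (pt_mem_arcs (s := ⟨t, _⟩)).2 (hIoo i t ht)
          have := ((coord_arcMap h0 h1 i ⟨t, ht⟩).symm.trans (congrArg coord h)).trans
            (coord_pt (x := y) (pt_mem_arcs.1 hs))
          simp only [Option.some.injEq, Prod.mk.injEq] at this
          exact ⟨i, this.1, ⟨t, ht⟩, hU', this.2⟩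
        · rintro ⟨i, rfl, t, hU', ht⟩
          exact ⟨⟨i, t⟩, hU', congrArg (pt (x i)) (Subtype.ext ht)⟩
      rw [this]
      exact isOpen_iUnion fun i => isOpen_iUnion fun _ =>
        (isOpen_Ioo.isOpenMap_subtype_val _ (isOpen_sigma_iff.1 hU i)).preimage
          continuous_subtype_val

end ArcMap

theorem contractibleSpace_Ioo {a b : ℝ} (h : a < b) : ContractibleSpace (Set.Ioo a b) :=
  (convex_Ioo a b).contractibleSpace (Set.nonempty_Ioo.2 h)

/-- The open arcs. -/
def openArc (X : Type u) : C(Σ _ : X, Set.Ioo (0 : ℝ) 1, WedgeOfCircles X) :=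
  arcMap (ι := X) (lo := fun _ => 0) (hi := fun _ => 1) id (fun _ => le_rfl) fun _ => le_rfl

theorem openArc_isOpenEmbedding : IsOpenEmbedding (openArc X) :=
  arcMap_isOpenEmbedding _ _ fun _ _ _ _ _ h => h

theorem range_openArc : Set.range (openArc X) = arcs X := by
  ext w
  constructor
  · rintro ⟨⟨x, s⟩, rfl⟩
    exact (pt_mem_arcs (s := ⟨s, _⟩)).2 s.2
  · intro hw
    rcases eq_base_or_pt w with rfl | ⟨x, s, rfl⟩
    · exact absurd hw base_notMem_arcs
    · exact ⟨⟨x, (s : ℝ), pt_mem_arcs.1 hw⟩, rfl⟩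

/-- The lower end of one of the two halves of `star ∩ arcs` on a circle. -/
noncomputable def endLo (i : X × Bool) : ℝ := if i.2 then 3 / 4 else 0

/-- The upper end of one of the two halves of `star ∩ arcs` on a circle. -/
noncomputable def endHi (i : X × Bool) : ℝ := if i.2 then 1 else 1 / 4

theorem endLo_nonneg (i : X × Bool) : 0 ≤ endLo i := by
  unfold endLo; split_ifs <;> norm_num

theorem endHi_le (i : X × Bool) : endHi i ≤ 1 := by
  unfold endHi; split_ifs <;> norm_num

theorem endLo_lt (i : X × Bool) : endLo i < endHi i := by
  unfold endHi endLo; split_ifs <;> norm_num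

/-- The initial and final parts of the open arcs. -/
noncomputable def endArc (X : Type u) :
    C(Σ i : X × Bool, Set.Ioo (endLo i) (endHi i), WedgeOfCircles X) :=
  arcMap (fun i : X × Bool => i.1) endLo_nonneg endHi_le

theorem endArc_isOpenEmbedding : IsOpenEmbedding (endArc X) := by
  refine arcMap_isOpenEmbedding _ _ ?_
  rintro ⟨x, _ | _⟩ ⟨y, _ | _⟩ s hs ht (rfl : x = y)
  · rfl
  · have h1 := hs.2; have h2 := ht.1
    simp only [endLo, endHi, Bool.false_eq_true, if_true, if_false] at h1 h2
    linarith
  · have h1 := hs.1; have h2 := ht.2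
    simp only [endLo, endHi, Bool.false_eq_true, if_true, if_false] at h1 h2
    linarith
  · rfl

theorem range_endArc : Set.range (endArc X) = star X ∩ arcs X := by
  ext w
  constructor
  · rintro ⟨⟨⟨x, b⟩, s, hs⟩, rfl⟩
    refine ⟨(pt_mem_star (s := ⟨s, _⟩)).2 ?_, (pt_mem_arcs (s := ⟨s, _⟩)).2
      ⟨(endLo_nonneg _).trans_lt hs.1, hs.2.trans_le (endHi_le _)⟩⟩
    cases b
    · exact Or.inl hs.2
    · exact Or.inr hs.1
  · rintro ⟨hs, ha⟩
    rcases eq_base_or_pt w with rfl | ⟨x, s, rfl⟩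
    · exact absurd ha base_notMem_arcs
    · rw [pt_mem_arcs] at ha
      rcases pt_mem_star.1 hs with h | h
      · exact ⟨⟨(x, false), (s : ℝ), ha.1, h⟩, rfl⟩
      · exact ⟨⟨(x, true), (s : ℝ), h, ha.2⟩, rfl⟩

/-! ### The holonomy of the wedge of circles -/

open Classical in
/-- A potential for the holonomy on the open arcs, which jumps by `x` at the middle of the circle
`x`, outside the star. -/
noncomputable def pot : WedgeOfCircles X → FreeGroup X :=
  desc 1 (fun x s => if 1 / 2 ≤ (s : ℝ) ∧ (s : ℝ) < 1 then FreeGroup.of x else 1)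
    (fun x => if_neg (by norm_num)) (fun x => if_neg (by norm_num))

theorem pot_pt_of_lt (x : X) {s : unitInterval} (h : (s : ℝ) < 1 / 2) : pot (pt x s) = 1 :=
  if_neg fun h' => not_lt.2 h'.1 h

theorem pot_pt_of_ge (x : X) {s : unitInterval} (h : 1 / 2 ≤ (s : ℝ)) (h' : (s : ℝ) < 1) :
    pot (pt x s) = FreeGroup.of x :=
  if_pos ⟨h, h'⟩

open Classical in
/-- The holonomy of the paths in the star, where it is trivial, and of those in an open arc, where
it is the difference of the potential. -/
noncomputable def localHol (γ : SSimplex 1 (WedgeOfCircles X)) : FreeGroup X :=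
  if γ.In (arcs X) then (pot (γ.vtx 0))⁻¹ * pot (γ.vtx 1) else 1

theorem localHol_arcs {γ : SSimplex 1 (WedgeOfCircles X)} (h : γ.In (arcs X)) :
    localHol γ = (pot (γ.vtx 0))⁻¹ * pot (γ.vtx 1) := if_pos h

/-- On the intersection of the star with the open arcs the potential is constant along each path,
so the two prescriptions for the holonomy agree. -/
theorem localHol_star {γ : SSimplex 1 (WedgeOfCircles X)} (h : γ.In (star X)) :
    localHol γ = 1 := by
  by_cases h' : γ.In (arcs X)
  · obtain ⟨γ', rfl⟩ := exists_comp_eq_of_isEmbedding endArc_isOpenEmbedding.isEmbedding (σ := γ)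
      (fun t => by rw [range_endArc]; exact ⟨h t, h' t⟩)
    obtain ⟨⟨x, b⟩, g, -, hg⟩ := γ'.continuous.exists_lift_sigma
    have hpot : ∀ i, pot (vtx ((endArc X).comp γ') i) = if b then FreeGroup.of x else 1 := by
      intro i
      have : γ' (e i) = ⟨(x, b), g (e i)⟩ := congrFun hg _
      change pot (endArc X (γ' (e i))) = _
      rw [this]
      have hlt := (g (e i)).2
      cases b
      · exact pot_pt_of_lt x (by
          have := hlt.2
          simp only [endHi, Bool.false_eq_true, if_false] at this
          exact this.trans (by norm_num))
      · exact pot_pt_of_ge x (by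
          have := hlt.1
          simp only [endLo, if_true] at this
          exact le_trans (by norm_num) this.le) (by
          have := hlt.2
          simpa only [endHi, if_true] using this)
    rw [localHol_arcs h', hpot, hpot, inv_mul_cancel]
  · exact if_neg h'

theorem localHol_flat {σ : SSimplex 2 (WedgeOfCircles X)} (h : σ.In (star X) ∨ σ.In (arcs X)) :
    FlatOn localHol σ := by
  rcases h with h | h
  · rw [FlatOn, localHol_star (h.face _), localHol_star (h.face _), localHol_star (h.face _),
      mul_one]
  · rw [FlatOn, localHol_arcs (h.face _), localHol_arcs (h.face _), localHol_arcs (h.face _)]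
    simp only [vtx_face_two]
    group

/-- The point of the standard `1`-simplex with parameter `s`. -/
noncomputable def param (s : ℝ) (hs : s ∈ Set.Icc (0 : ℝ) 1) : stdSimplex ℝ (Fin 2) :=
  ⟨![1 - s, s], by
    constructor
    · intro i; fin_cases i
      · simpa using hs.2
      · simpa using hs.1
    · simp⟩

/-- The holonomy of the wedge of circles: a flat cochain with values in the free group, which takes
the value `x` on the loop around the circle `x`. -/
theorem exists_holonomy (X : Type u) : ∃ h : SSimplex 1 (WedgeOfCircles X) → FreeGroup X,
    (∀ σ, FlatOn h σ) ∧ ∀ x, h (ofPath (loop x)) = FreeGroup.of x := by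
  obtain ⟨h, hf, hloc⟩ := exists_flat_extension isOpen_star isOpen_arcs star_union_arcs
    (localHol (X := X)) fun σ hσ => localHol_flat hσ
  refine ⟨h, hf, fun x => ?_⟩
  -- The circle is cut at the parameters `1/8` and `7/8`.
  have hpath : ∀ t : stdSimplex ℝ (Fin 2), ofPath (loop x) t = pt x ⟨t.1 1, t.2.1 1,
      by linarith [t.2.1 0, sum_two t]⟩ := by
    intro t
    have : line 0 1 t = t.1 1 := by rw [line_apply]; ring
    rw [ofPath_apply, this, Path.extend_apply]
    rfl
  have hsub : ∀ a b (ha : a ∈ Set.Icc (0 : ℝ) 1) (hb : b ∈ Set.Icc (0 : ℝ) 1) t,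
      (aff ![param a ha, param b hb] t).1 1 = t.1 0 * a + t.1 1 * b := by
    intro a b ha hb t
    rw [aff_coe, Fin.sum_univ_two]
    simp [param]
  have m0 : (0 : ℝ) ∈ Set.Icc (0 : ℝ) 1 := by norm_num
  have m1 : (1 / 8 : ℝ) ∈ Set.Icc (0 : ℝ) 1 := by norm_num
  have m2 : (7 / 8 : ℝ) ∈ Set.Icc (0 : ℝ) 1 := by norm_num
  have m3 : (1 : ℝ) ∈ Set.Icc (0 : ℝ) 1 := by norm_num
  have he0 : param 0 m0 = e 0 := by
    apply Subtype.ext; ext i; fin_cases i <;> simp [param]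
  have he1 : param 1 m3 = e 1 := by
    apply Subtype.ext; ext i; fin_cases i <;> simp [param]
  set γ := ofPath (loop x)
  have hγ : γ.sub ![param 0 m0, param 1 m3] = γ := by rw [he0, he1, sub_vertex_one]
  have hst : ∀ (a b : ℝ) (ha hb) (t : stdSimplex ℝ (Fin 2)),
      (γ.sub ![param a ha, param b hb]) t = pt x ⟨t.1 0 * a + t.1 1 * b, by
        rw [← hsub a b ha hb]; exact ⟨(aff _ t).2.1 1, by
          linarith [(aff ![param a ha, param b hb] t).2.1 0,
            sum_two (aff ![param a ha, param b hb] t)]⟩⟩ := by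
    intro a b ha hb t
    change γ (aff _ t) = _
    rw [hpath]
    congr 1
    exact Subtype.ext (hsub a b ha hb t)
  have p1 : h (γ.sub ![param 0 m0, param (1 / 8) m1]) = 1 := by
    have : (γ.sub ![param 0 m0, param (1 / 8) m1]).In (star X) := fun t => by
      rw [hst]
      exact pt_mem_star.2 (Or.inl (by
        have := sum_two t; have := t.2.1 0
        change t.1 0 * 0 + t.1 1 * (1 / 8) < 1 / 4
        linarith))
    rw [hloc _ (Or.inl this), localHol_star this]
  have p2 : h (γ.sub ![param (7 / 8) m2, param 1 m3]) = 1 := by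
    have : (γ.sub ![param (7 / 8) m2, param 1 m3]).In (star X) := fun t => by
      rw [hst]
      exact pt_mem_star.2 (Or.inr (by
        have := sum_two t; have := t.2.1 1
        change 3 / 4 < t.1 0 * (7 / 8) + t.1 1 * 1
        linarith))
    rw [hloc _ (Or.inl this), localHol_star this]
  have p3 : h (γ.sub ![param (1 / 8) m1, param (7 / 8) m2]) = FreeGroup.of x := by
    have : (γ.sub ![param (1 / 8) m1, param (7 / 8) m2]).In (arcs X) := fun t => by
      rw [hst]
      refine pt_mem_arcs.2 ?_
      have := sum_two t; have := t.2.1 1; have := t.2.1 0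
      constructor
      · change 0 < t.1 0 * (1 / 8) + t.1 1 * (7 / 8)
        linarith
      · change t.1 0 * (1 / 8) + t.1 1 * (7 / 8) < 1
        linarith
    rw [hloc _ (Or.inr this), localHol_arcs this, vtx_sub, vtx_sub]
    change (pot (γ (param (1 / 8) m1)))⁻¹ * pot (γ (param (7 / 8) m2)) = _
    rw [hpath, hpath, pot_pt_of_lt, pot_pt_of_ge, inv_one, one_mul]
    · change 1 / 2 ≤ (7 / 8 : ℝ); norm_num
    · change (7 / 8 : ℝ) < 1; norm_num
    · change (1 / 8 : ℝ) < 1 / 2; norm_num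
  rw [← hγ, ← flat_mul hf γ (param 0 m0) (param (7 / 8) m2),
    ← flat_mul hf γ (param 0 m0) (param (1 / 8) m1), p1, p2, p3, one_mul, mul_one]

theorem holonomy_wordLoop {h : SSimplex 1 (WedgeOfCircles X) → FreeGroup X}
    (hf : ∀ σ, FlatOn h σ) (hl : ∀ x, h (ofPath (loop x)) = FreeGroup.of x)
    (w : List (X × Bool)) : h (ofPath (wordLoop w)) = FreeGroup.mk w := by
  induction w with
  | nil => exact flat_refl hf _
  | cons a w ih =>
    rw [wordLoop, flat_trans hf, ih, ← List.singleton_append, ← FreeGroup.mul_mk]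
    congr 1
    obtain ⟨x, _ | _⟩ := a
    · rw [letterLoop, if_neg (by simp), flat_symm hf, hl]
      rfl
    · rw [letterLoop, if_pos rfl, hl]
      rfl

theorem holonomy_relatorLoop {h : SSimplex 1 (WedgeOfCircles X) → FreeGroup X}
    (hf : ∀ σ, FlatOn h σ) (hl : ∀ x, h (ofPath (loop x)) = FreeGroup.of x)
    (r : FreeGroup X) : h (ofPath (relatorLoop r)) = r := by
  classical
  rw [relatorLoop, holonomy_wordLoop hf hl]
  exact FreeGroup.mk_toWord

/-! ### The second homology of the wedge of circles -/

/-- A homotopy, stationary at the base point, from the identity to a map that sends the star to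
the base point: at time `t` the parameter `s` is moved away from `1/2`, to `s + t (s - 1/2)`. -/
noncomputable def spread (p : WedgeOfCircles X × unitInterval) : WedgeOfCircles X :=
  desc (base X) (fun x s => pt x (Set.projIcc 0 1 zero_le_one ((s : ℝ) + p.2 * (s - 1 / 2))))
    (fun x => by
      rw [Set.projIcc_of_le_left _ (by
        have := p.2.2.1
        simp only [Set.Icc.coe_zero]
        linarith)]
      exact pt_zero x)
    (fun x => by
      rw [Set.projIcc_of_right_le _ (by
        have := p.2.2.1
        simp only [Set.Icc.coe_one]
        linarith)]
      exact pt_one x) p.1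

theorem spread_pt (x : X) (s t : unitInterval) :
    spread (pt x s, t) = pt x (Set.projIcc 0 1 zero_le_one ((s : ℝ) + t * (s - 1 / 2))) := rfl

theorem continuous_spread : Continuous (spread (X := X)) := by
  refine isQuotientMap_proj.continuous_lift_prod_left ?_
  have h1 : Continuous fun q : Unit × unitInterval =>
      spread (X := X) (Quot.mk _ (Sum.inl q.1), q.2) :=
    continuous_const (y := base X)
  have h2 : Continuous fun q : (Σ _ : X, unitInterval) × unitInterval =>
      spread (X := X) (Quot.mk _ (Sum.inr q.1), q.2) := by
    have : Continuous fun q : Σ _ : X, unitInterval × unitInterval =>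
        pt q.1 (Set.projIcc 0 1 zero_le_one ((q.2.1 : ℝ) + q.2.2 * (q.2.1 - 1 / 2))) :=
      continuous_sigma fun x => (continuous_pt x).comp
        (continuous_projIcc.comp (by fun_prop))
    exact this.comp (Homeomorph.sigmaProdDistrib (X := fun _ : X => unitInterval)
      (Y := unitInterval)).continuous
  exact ((h1.sumElim h2).comp (Homeomorph.sumProdDistrib (X := Unit) (Y := Σ _ : X, unitInterval)
    (Z := unitInterval)).continuous).congr (by rintro ⟨_ | _, _⟩ <;> rfl)

/-- The final map of the homotopy `spread`. -/
noncomputable def spreadMap (X : Type u) : C(WedgeOfCircles X, WedgeOfCircles X) :=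
  ⟨fun w => spread (w, 1), continuous_spread.comp (by fun_prop)⟩

theorem homotopic_spreadMap : (ContinuousMap.id (WedgeOfCircles X)).Homotopic (spreadMap X) :=
  ⟨{ toFun := fun p => spread (p.2, p.1)
     continuous_toFun := continuous_spread.comp continuous_swap
     map_zero_left := fun w => by
       rcases eq_base_or_pt w with rfl | ⟨x, s, rfl⟩
       · rfl
       · rw [spread_pt]
         simp
     map_one_left := fun w => rfl }⟩

theorem spreadMap_star {w : WedgeOfCircles X} (hw : w ∈ star X) : spreadMap X w = base X := by
  rcases eq_base_or_pt w with rfl | ⟨x, s, rfl⟩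
  · rfl
  · change spread (pt x s, 1) = _
    rw [spread_pt]
    rcases pt_mem_star.1 hw with h | h
    · rw [Set.projIcc_of_le_left _ (by rw [Set.Icc.coe_one]; linarith)]
      exact pt_zero x
    · rw [Set.projIcc_of_right_le _ (by rw [Set.Icc.coe_one]; linarith)]
      exact pt_one x

/-- The `2`-cycles in a wedge of circles are boundaries. -/
theorem exists_bdry {z : SChain 2 (WedgeOfCircles X)} (hz : bdry z = 0) : ∃ t, z = bdry t := by
  have (i : X × Bool) := contractibleSpace_Ioo (endLo_lt i)
  have := contractibleSpace_Ioo (zero_lt_one (α := ℝ))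
  obtain ⟨zA, hzA, zB, hzB, t, ht⟩ := exists_small_two isOpen_star isOpen_arcs star_union_arcs hz
  have hbb : ∀ t : SChain 3 (WedgeOfCircles X), bdry (bdry t) = 0 := bdry_bdry_three
  have h1 : bdry zA + bdry zB = 0 := by rw [← map_add, ht, map_add, hz, hbb, add_zero]
  have h2 : bdry zB = - bdry zA := eq_neg_of_add_eq_zero_right h1
  -- The common boundary lies in `star ∩ arcs`, and bounds there.
  obtain ⟨y, hy⟩ := exists_push_eq_of_isEmbedding endArc_isOpenEmbedding.isEmbedding (z := bdry zB)
    (by rw [range_endArc]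
        exact mem_supp_inter (h2 ▸ neg_mem (bdry_mem_supp hzA)) (bdry_mem_supp hzB))
  obtain ⟨s, rfl⟩ := exists_bdry_one_sigma (z := y) (push_injective endArc_isOpenEmbedding.injective
    (by rw [← bdry_push, hy, bdry_bdry, map_zero]))
  rw [← bdry_push] at hy
  have hs : push (endArc X) s ∈ supp 2 (star X ∩ arcs X) :=
    push_mem_supp (A := Set.univ) (fun p _ => range_endArc ▸ Set.mem_range_self p) (mem_supp_univ s)
  set s' := push (endArc X) s
  -- The part in the open arcs.
  obtain ⟨b, hb⟩ := exists_push_eq_of_isEmbedding openArc_isOpenEmbedding.isEmbedding (z := zB - s')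
    (by rw [range_openArc]; exact sub_mem hzB (supp_mono Set.inter_subset_right hs))
  obtain ⟨b, rfl⟩ := exists_bdry_two_sigma (z := b)
    (push_injective openArc_isOpenEmbedding.injective
      (by rw [← bdry_push, hb, map_sub, hy, sub_self, map_zero]))
  -- The part in the star.
  have ha : bdry (zA + s') = 0 := by rw [map_add, hy, h1]
  obtain ⟨a, ha'⟩ := push_homologous homotopic_spreadMap ha
  have hc : ∀ σ : SSimplex 2 (WedgeOfCircles X), σ.In (star X) →
      ∃ p, (spreadMap X).comp σ = ContinuousMap.const _ p := fun σ hσ =>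
    ⟨base X, ContinuousMap.ext fun t => spreadMap_star (hσ t)⟩
  rw [push_two_eq_zero hc (add_mem hzA (supp_mono Set.inter_subset_left hs)) ha, push_id,
    sub_zero] at ha'
  refine ⟨a + push (openArc X) b - t, ?_⟩
  rw [map_sub, map_add, ← ha', bdry_push, hb, add_add_sub_cancel, ht, add_sub_cancel_right]

end WedgeOfCircles

/-! ### The presentation complex: the collar of the one-skeleton -/

namespace PresentationComplex

open SSimplex SChain WedgeOfCircles

variable {X : Type u} {rels : Set (FreeGroup X)}

/-- The point with coordinate `z` in the closed disc attached along `u`. -/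
def cell (u : rels) (z : ClosedDisc) : PresentationComplex rels := Quot.mk _ (Sum.inr ⟨u, z⟩)

/-- The inclusion of the one-skeleton. -/
def incl (rels : Set (FreeGroup X)) : C(WedgeOfCircles X, PresentationComplex rels) :=
  ⟨fun w => Quot.mk _ (Sum.inl w), continuous_quot_mk.comp continuous_inl⟩

theorem continuous_cell (u : rels) : Continuous (cell u) :=
  continuous_quot_mk.comp
    (continuous_inr.comp (continuous_sigmaMk (σ := fun _ : rels => ClosedDisc)))

theorem cell_discBoundary (u : rels) (t : unitInterval) :
    cell u (discBoundary t) = incl rels (relatorLoop (u : FreeGroup X) t) :=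
  Quot.sound (PresentationRel.attach u t)

theorem eq_incl_or_cell (p : PresentationComplex rels) :
    (∃ w, p = incl rels w) ∨ ∃ u z, p = cell u z := by
  obtain ⟨w | ⟨u, z⟩, rfl⟩ := Quot.exists_rep p
  exacts [Or.inl ⟨w, rfl⟩, Or.inr ⟨u, z, rfl⟩]

/-- The quotient map that defines the complex. -/
def proj (p : WedgeOfCircles X ⊕ (Σ _ : rels, ClosedDisc)) : PresentationComplex rels :=
  Quot.mk _ p

theorem isQuotientMap_proj : IsQuotientMap (proj (rels := rels)) := isQuotientMap_quot_mk

/-- A function on the complex, given on the one-skeleton and on the discs. -/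
def desc {Z : Type*} (f : WedgeOfCircles X → Z) (g : rels → ClosedDisc → Z)
    (h : ∀ u t, g u (discBoundary t) = f (relatorLoop (u : FreeGroup X) t)) :
    PresentationComplex rels → Z :=
  Quot.lift (Sum.elim f fun p => g p.1 p.2) (by
    rintro _ _ ⟨u, t⟩
    exact h u t)

theorem continuous_desc {Z : Type*} [TopologicalSpace Z] {f : WedgeOfCircles X → Z}
    {g : rels → ClosedDisc → Z}
    {h : ∀ u t, g u (discBoundary t) = f (relatorLoop (u : FreeGroup X) t)}
    (hf : Continuous f) (hg : ∀ u, Continuous (g u)) : Continuous (desc f g h) :=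
  isQuotientMap_proj.continuous_iff.2 (continuous_sum_dom.2 ⟨hf, continuous_sigma hg⟩)

theorem norm_discBoundary (t : unitInterval) : ‖(discBoundary t : ℂ)‖ = 1 := by
  have h := Complex.norm_exp_ofReal_mul_I (2 * Real.pi * (t : ℝ))
  push_cast at h
  exact h

theorem norm_le_one (z : ClosedDisc) : ‖(z : ℂ)‖ ≤ 1 := mem_closedBall_zero_iff.1 z.2

/-- The distance to the centre of a disc; it is `1` on the one-skeleton. -/
noncomputable def radius : PresentationComplex rels → ℝ :=
  desc (fun _ => 1) (fun _ z => ‖(z : ℂ)‖) fun _ t => norm_discBoundary t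

theorem radius_cell (u : rels) (z : ClosedDisc) : radius (cell u z) = ‖(z : ℂ)‖ := rfl

theorem continuous_radius : Continuous (radius (rels := rels)) :=
  continuous_desc continuous_const fun _ => by fun_prop

/-- An open neighbourhood of the one-skeleton. -/
def collar (rels : Set (FreeGroup X)) : Set (PresentationComplex rels) := {p | 1 / 2 < radius p}

/-- The union of the open discs. -/
def openDiscs (rels : Set (FreeGroup X)) : Set (PresentationComplex rels) := {p | radius p < 1}

theorem isOpen_collar : IsOpen (collar rels) := isOpen_lt continuous_const continuous_radius

theorem isOpen_openDiscs : IsOpen (openDiscs rels) := isOpen_lt continuous_radius continuous_const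

theorem collar_union_openDiscs : collar rels ∪ openDiscs rels = Set.univ := by
  refine Set.eq_univ_of_forall fun p => ?_
  rcases lt_or_ge (1 / 2) (radius p) with h | h
  · exact Or.inl h
  · exact Or.inr (show radius p < 1 by linarith)

theorem incl_notMem_openDiscs (w : WedgeOfCircles X) : incl rels w ∉ openDiscs rels :=
  fun h : (1 : ℝ) < 1 => lt_irrefl _ h

/-- The attaching loop of `u`, as a function of the angle. -/
noncomputable def attach (u : FreeGroup X) : C(Real.Angle, WedgeOfCircles X) where
  toFun := Function.Periodic.lift (f := fun θ : ℝ =>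
      (relatorLoop u).extend (Int.fract (θ / (2 * Real.pi)))) (c := 2 * Real.pi) fun θ => by
    dsimp only
    rw [add_div, div_self Real.two_pi_pos.ne', Int.fract_add_one]
  continuous_toFun := by
    refine Continuous.quotient_liftOn' (f := fun θ : ℝ =>
      (relatorLoop u).extend (Int.fract (θ / (2 * Real.pi)))) ?_ _
    have : Continuous ((relatorLoop u).extend ∘ (Int.fract : ℝ → ℝ)) :=
      ((relatorLoop u).continuous_extend.continuousOn).comp_fract'' (by simp)
    exact this.comp (by fun_prop)

theorem attach_coe (u : FreeGroup X) (θ : ℝ) :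
    attach u (θ : Real.Angle) = (relatorLoop u).extend (Int.fract (θ / (2 * Real.pi))) := rfl

theorem attach_two_pi_mul (u : FreeGroup X) (τ : ℝ) :
    attach u ((2 * Real.pi * τ : ℝ) : Real.Angle) = (relatorLoop u).extend (Int.fract τ) := by
  rw [attach_coe, mul_div_cancel_left₀ _ Real.two_pi_pos.ne']

theorem attach_unitInterval (u : FreeGroup X) (t : unitInterval) :
    attach u ((2 * Real.pi * (t : ℝ) : ℝ) : Real.Angle) = relatorLoop u t := by
  rw [attach_two_pi_mul]
  rcases t.2.2.lt_or_eq with h | h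
  · rw [Int.fract_eq_self.2 ⟨t.2.1, h⟩, Path.extend_apply _ t.2]
  · have ht : t = 1 := Subtype.ext h
    subst ht
    simp

theorem arg_exp_coe (θ : ℝ) {ρ : ℝ} (hρ : 0 < ρ) :
    (Complex.arg (ρ * Complex.exp (θ * Complex.I)) : Real.Angle) = θ := by
  rw [Complex.exp_mul_I]
  simpa using Complex.arg_mul_cos_add_sin_mul_I_coe_angle hρ (θ : Real.Angle)

/-- The radial retraction of the collar to the one-skeleton. At the centres of the discs its value
is arbitrary. -/
noncomputable def retr : PresentationComplex rels → WedgeOfCircles X :=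
  desc id (fun u z => attach (u : FreeGroup X) (Complex.arg z : Real.Angle)) fun u t => by
    have := arg_exp_coe (2 * Real.pi * (t : ℝ)) one_pos
    push_cast at this
    rw [one_mul] at this
    rw [discBoundary, this]
    exact attach_unitInterval _ t

theorem retr_incl (w : WedgeOfCircles X) : retr (incl rels w) = w := rfl

theorem retr_cell (u : rels) (z : ClosedDisc) :
    retr (cell u z) = attach (u : FreeGroup X) (Complex.arg z : Real.Angle) := rfl

theorem incl_injective : Function.Injective (incl rels) := Function.LeftInverse.injective retr_incl

theorem continuousOn_retr : ContinuousOn (retr (rels := rels)) (collar rels) := by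
  rw [isQuotientMap_proj.continuousOn_isOpen_iff isOpen_collar]
  rintro (w | ⟨u, z⟩) hz
  · refine ContinuousAt.continuousWithinAt ?_
    rw [ContinuousAt, nhds_inl, Filter.tendsto_map'_iff]
    exact Filter.tendsto_id
  · refine ContinuousAt.continuousWithinAt ?_
    rw [ContinuousAt, nhds_inr, Filter.tendsto_map'_iff, Sigma.nhds_mk, Filter.tendsto_map'_iff]
    have hz0 : (z : ℂ) ≠ 0 := by
      rintro h
      have : (1 / 2 : ℝ) < ‖(z : ℂ)‖ := hz
      rw [h, norm_zero] at this
      norm_num at this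
    exact ((attach (u : FreeGroup X)).continuous.continuousAt.comp
      (Complex.continuousAt_arg_coe_angle hz0)).comp
      (continuous_subtype_val (p := fun z : ℂ => z ∈ Metric.closedBall 0 1)).continuousAt

/-- The point of the boundary circle at angle `θ` is attached to the point `attach u θ`. -/
theorem cell_exp (u : rels) (θ : ℝ) (z : ClosedDisc) (hz : (z : ℂ) = Complex.exp (θ * Complex.I)) :
    cell u z = incl rels (attach (u : FreeGroup X) (θ : Real.Angle)) := by
  let t : unitInterval := ⟨Int.fract (θ / (2 * Real.pi)), Int.fract_nonneg _, (Int.fract_lt_one _).le⟩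
  have h1 : attach (u : FreeGroup X) (θ : Real.Angle) = relatorLoop (u : FreeGroup X) t := by
    rw [attach_coe, Path.extend_apply _ t.2]
  have h2 : z = discBoundary t := by
    apply Subtype.ext
    rw [hz, discBoundary, Complex.exp_eq_exp_iff_exists_int]
    refine ⟨⌊θ / (2 * Real.pi)⌋, ?_⟩
    have : (θ : ℂ) = 2 * Real.pi * (Int.fract (θ / (2 * Real.pi)) : ℝ) +
        ⌊θ / (2 * Real.pi)⌋ * (2 * Real.pi) := by
      rw [Int.fract]
      have := Real.pi_pos.ne'
      push_cast
      field_simp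
      ring
    change (θ : ℂ) * Complex.I = 2 * Real.pi * (Int.fract (θ / (2 * Real.pi)) : ℝ) * Complex.I + _
    linear_combination Complex.I * this
  rw [h1, h2, cell_discBoundary]

theorem max_half_pos (z : ClosedDisc) (t : unitInterval) :
    0 < 1 - (t : ℝ) + t * max (1 / 2) ‖(z : ℂ)‖ := by
  have h0 := t.2.1
  have h1 := t.2.2
  have : (1 / 2 : ℝ) ≤ max (1 / 2) ‖(z : ℂ)‖ := le_max_left _ _
  nlinarith

/-- The radial dilation that stretches, at time `1`, the disc of radius `1/2` to the whole disc and
pushes the rest to the boundary circle. -/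
noncomputable def dilate (z : ClosedDisc) (t : unitInterval) : ClosedDisc :=
  ⟨((1 - (t : ℝ) + t * max (1 / 2) ‖(z : ℂ)‖)⁻¹ : ℝ) • (z : ℂ), by
    rw [mem_closedBall_zero_iff, norm_smul, Real.norm_eq_abs, abs_of_pos (inv_pos.2 (max_half_pos z t)),
      inv_mul_le_iff₀ (max_half_pos z t), mul_one]
    have h0 := t.2.1
    have h1 := t.2.2
    have h2 := norm_le_one z
    have : ‖(z : ℂ)‖ ≤ max (1 / 2) ‖(z : ℂ)‖ := le_max_right _ _
    nlinarith⟩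

theorem continuous_dilate : Continuous fun q : ClosedDisc × unitInterval => dilate q.1 q.2 := by
  have h : Continuous fun q : ClosedDisc × unitInterval =>
      ((1 - (q.2 : ℝ) + q.2 * max (1 / 2) ‖(q.1 : ℂ)‖)⁻¹ : ℝ) :=
    Continuous.inv₀ (by fun_prop) fun q => (max_half_pos q.1 q.2).ne'
  exact (h.smul (continuous_subtype_val.comp continuous_fst)).subtype_mk _

theorem dilate_zero (z : ClosedDisc) : dilate z 0 = z := Subtype.ext (by simp [dilate])

theorem dilate_discBoundary (s t : unitInterval) : dilate (discBoundary s) t = discBoundary s := by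
  apply Subtype.ext
  rw [dilate]
  simp only [norm_discBoundary]
  rw [max_eq_right (by norm_num), mul_one, sub_add_cancel, inv_one, one_smul]

/-- The dilation of the discs, extended by the identity of the one-skeleton. -/
noncomputable def dilation (q : PresentationComplex rels × unitInterval) : PresentationComplex rels :=
  desc (incl rels) (fun u z => cell u (dilate z q.2)) (fun u s => by
    rw [dilate_discBoundary, cell_discBoundary]) q.1

theorem continuous_dilation : Continuous (dilation (rels := rels)) := by
  refine isQuotientMap_proj.continuous_lift_prod_left ?_
  have h1 : Continuous fun q : WedgeOfCircles X × unitInterval => incl rels q.1 := by fun_prop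
  have h2 : Continuous fun q : (Σ _ : rels, ClosedDisc) × unitInterval =>
      cell q.1.1 (dilate q.1.2 q.2) := by
    have : Continuous fun q : Σ _ : rels, ClosedDisc × unitInterval =>
        cell q.1 (dilate q.2.1 q.2.2) :=
      continuous_sigma fun u => (continuous_cell u).comp continuous_dilate
    exact this.comp (Homeomorph.sigmaProdDistrib (X := fun _ : rels => ClosedDisc)
      (Y := unitInterval)).continuous
  exact ((h1.sumElim h2).comp (Homeomorph.sumProdDistrib (X := WedgeOfCircles X)
    (Y := Σ _ : rels, ClosedDisc) (Z := unitInterval)).continuous).congr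
      (by rintro ⟨_ | _, _⟩ <;> rfl)

/-- The final map of the dilation. -/
noncomputable def crush (rels : Set (FreeGroup X)) :
    C(PresentationComplex rels, PresentationComplex rels) :=
  ⟨fun p => dilation (p, 1), continuous_dilation.comp (by fun_prop)⟩

theorem homotopic_crush : (ContinuousMap.id (PresentationComplex rels)).Homotopic (crush rels) :=
  ⟨{ toFun := fun q => dilation (q.2, q.1)
     continuous_toFun := continuous_dilation.comp continuous_swap
     map_zero_left := fun p => by
       rcases eq_incl_or_cell p with ⟨w, rfl⟩ | ⟨u, z, rfl⟩
       · rfl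
       · exact congrArg (cell u) (dilate_zero z)
     map_one_left := fun _ => rfl }⟩

theorem crush_collar {p : PresentationComplex rels} (hp : p ∈ collar rels) :
    crush rels p = incl rels (retr p) := by
  rcases eq_incl_or_cell p with ⟨w, rfl⟩ | ⟨u, z, rfl⟩
  · rfl
  · have hz : (1 / 2 : ℝ) < ‖(z : ℂ)‖ := hp
    rw [retr_cell]
    refine cell_exp u _ (dilate z 1) ?_
    have hz0 : (‖(z : ℂ)‖ : ℂ) ≠ 0 := by
      rw [Complex.ofReal_ne_zero]; linarith
    rw [dilate]
    simp only [Set.Icc.coe_one, sub_self, zero_add, one_mul]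
    rw [max_eq_right hz.le, Complex.real_smul, Complex.ofReal_inv, inv_mul_eq_iff_eq_mul₀ hz0,
      Complex.norm_mul_exp_arg_mul_I]

/-- The inclusion of the open discs. -/
def discIncl (rels : Set (FreeGroup X)) :
    C(Σ _ : rels, Metric.ball (0 : ℂ) 1, PresentationComplex rels) where
  toFun p := cell p.1 ⟨p.2, Metric.ball_subset_closedBall p.2.2⟩
  continuous_toFun := continuous_sigma fun u => (continuous_cell u).comp
    (f := fun z : Metric.ball (0 : ℂ) 1 => (⟨z, Metric.ball_subset_closedBall z.2⟩ : ClosedDisc))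
    (continuous_subtype_val.subtype_mk _)

open Classical in
/-- The disc and the coordinate of a point that is not in the one-skeleton. -/
noncomputable def coord : PresentationComplex rels → Option (rels × ℂ) :=
  desc (fun _ => none) (fun u z => if ‖(z : ℂ)‖ < 1 then some (u, (z : ℂ)) else none)
    fun _ t => if_neg (norm_discBoundary t).not_lt

theorem coord_cell (u : rels) {z : ClosedDisc} (hz : ‖(z : ℂ)‖ < 1) :
    coord (cell u z) = some (u, (z : ℂ)) := if_pos hz

theorem coord_discIncl (u : rels) (z : Metric.ball (0 : ℂ) 1) :
    coord (discIncl rels ⟨u, z⟩) = some (u, (z : ℂ)) :=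
  coord_cell u (z := ⟨z, Metric.ball_subset_closedBall z.2⟩) (mem_ball_zero_iff.1 z.2)

theorem discIncl_isOpenEmbedding : IsOpenEmbedding (discIncl rels) := by
  refine .of_continuous_injective_isOpenMap (discIncl rels).continuous ?_ fun U hU => ?_
  · rintro ⟨u, z⟩ ⟨v, w⟩ h
    have := congrArg coord h
    rw [coord_discIncl, coord_discIncl] at this
    simp only [Option.some.injEq, Prod.mk.injEq] at this
    obtain ⟨rfl, hzw⟩ := this
    exact congrArg (Sigma.mk u) (Subtype.ext hzw)
  · rw [← isQuotientMap_proj.isOpen_preimage, isOpen_sum_iff]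
    constructor
    · convert isOpen_empty
      refine Set.eq_empty_of_forall_notMem ?_
      rintro w ⟨⟨u, z⟩, -, h⟩
      have := (coord_discIncl u z).symm.trans (congrArg coord h)
      exact Option.some_ne_none _ this
    · rw [isOpen_sigma_iff]
      intro u
      have : (Sigma.mk u ⁻¹' (Sum.inr ⁻¹' (proj ⁻¹' (discIncl rels '' U)))) =
          (Subtype.val : ClosedDisc → ℂ) ⁻¹' ((Subtype.val : Metric.ball (0 : ℂ) 1 → ℂ) ''
            (Sigma.mk (β := fun _ : rels => Metric.ball (0 : ℂ) 1) u ⁻¹' U)) := by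
        ext z
        simp only [Set.mem_preimage, Set.mem_image]
        constructor
        · rintro ⟨⟨v, w⟩, hU', h⟩
          have hz : ‖(z : ℂ)‖ < 1 := by
            have : radius (cell u z) = ‖(w : ℂ)‖ := congrArg radius h.symm
            rw [← radius_cell u z, this]
            exact mem_ball_zero_iff.1 w.2
          have := ((coord_discIncl v w).symm.trans (congrArg coord h)).trans (coord_cell u hz)
          simp only [Option.some.injEq, Prod.mk.injEq] at this
          obtain ⟨rfl, hzw⟩ := this
          exact ⟨w, hU', hzw⟩
        · rintro ⟨w, hU', h⟩
          exact ⟨⟨u, w⟩, hU', congrArg (cell u) (Subtype.ext h)⟩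
      rw [this]
      exact (Metric.isOpen_ball.isOpenMap_subtype_val _ (isOpen_sigma_iff.1 hU u)).preimage
        continuous_subtype_val

theorem range_discIncl : Set.range (discIncl rels) = openDiscs rels := by
  ext p
  constructor
  · rintro ⟨⟨u, z⟩, rfl⟩
    exact mem_ball_zero_iff.1 z.2
  · intro hp
    rcases eq_incl_or_cell p with ⟨w, rfl⟩ | ⟨u, z, rfl⟩
    · exact absurd hp (incl_notMem_openDiscs w)
    · exact ⟨⟨u, (z : ℂ), mem_ball_zero_iff.2 hp⟩, rfl⟩

end PresentationComplex

/-! ### Holonomy and winding numbers in the presentation complex -/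

namespace PresentationComplex

open SSimplex SChain WedgeOfCircles

variable {X : Type u} {rels : Set (FreeGroup X)}

/-- The intersection of the collar with the open discs: one open annulus for each relator. -/
def annuli (rels : Set (FreeGroup X)) : Set (PresentationComplex rels) :=
  collar rels ∩ openDiscs rels

/-- The attaching loop of `u`, as a function on the line with period `1`. -/
noncomputable def winding (u : FreeGroup X) : C(ℝ, WedgeOfCircles X) :=
  ⟨fun τ => attach u ((2 * Real.pi * τ : ℝ) : Real.Angle),
    (attach u).continuous.comp (Real.Angle.continuous_coe.comp (by fun_prop))⟩

theorem winding_apply (u : FreeGroup X) (τ : ℝ) :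
    winding u τ = attach u ((2 * Real.pi * τ : ℝ) : Real.Angle) := rfl

theorem winding_add_one (u : FreeGroup X) (τ : ℝ) : winding u (τ + 1) = winding u τ := by
  rw [winding_apply, winding_apply, attach_two_pi_mul, attach_two_pi_mul, Int.fract_add_one]

theorem winding_comp_line (u : FreeGroup X) : (winding u).comp (line 0 1) = ofPath (relatorLoop u) := by
  ext t
  have ht : line 0 1 t = t.1 1 := by rw [line_apply]; ring
  have hm : t.1 1 ∈ Set.Icc (0 : ℝ) 1 := ⟨t.2.1 1, by linarith [t.2.1 0, sum_two t]⟩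
  rw [ofPath_apply, ContinuousMap.comp_apply, ht, Path.extend_apply _ hm]
  exact attach_unitInterval u ⟨_, hm⟩

/-- The universal cover of the open annulus: the angle (in turns) and the radius. -/
abbrev AnnulusCover : Type := ℝ × Set.Ioo (1 / 2 : ℝ) 1

instance : ContractibleSpace AnnulusCover :=
  have := contractibleSpace_Ioo (show (1 / 2 : ℝ) < 1 by norm_num)
  inferInstance

/-- The point of the disc with polar coordinates `t`. -/
noncomputable def polar (t : AnnulusCover) : ClosedDisc :=
  ⟨(t.2 : ℝ) * Complex.exp ((2 * Real.pi * t.1 : ℝ) * Complex.I), by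
    rw [mem_closedBall_zero_iff, norm_mul, Complex.norm_exp_ofReal_mul_I, mul_one, Complex.norm_real,
      Real.norm_eq_abs, abs_of_pos (by linarith [t.2.2.1])]
    exact t.2.2.2.le⟩

theorem norm_polar (t : AnnulusCover) : ‖(polar t : ℂ)‖ = t.2 := by
  rw [polar, norm_mul, Complex.norm_exp_ofReal_mul_I, mul_one, Complex.norm_real,
      Real.norm_eq_abs, abs_of_pos (by linarith [t.2.2.1])]

/-- The projection of the universal cover of the annulus in the disc attached along `u`. -/
noncomputable def annulus (u : rels) : C(AnnulusCover, PresentationComplex rels) :=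
  ⟨fun t => cell u (polar t), (continuous_cell u).comp (Continuous.subtype_mk (by fun_prop) _)⟩

theorem radius_annulus (u : rels) (t : AnnulusCover) : radius (annulus u t) = t.2 := norm_polar t

theorem annulus_mem (u : rels) (t : AnnulusCover) : annulus u t ∈ annuli rels := by
  constructor
  · change 1 / 2 < radius _
    rw [radius_annulus]
    exact t.2.2.1
  · change radius _ < 1
    rw [radius_annulus]
    exact t.2.2.2

theorem retr_annulus (u : rels) (t : AnnulusCover) :
    retr (annulus u t) = winding (u : FreeGroup X) t.1 := by
  change attach _ (Complex.arg ((t.2 : ℝ) * Complex.exp ((2 * Real.pi * t.1 : ℝ) * Complex.I)) :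
    Real.Angle) = _
  rw [arg_exp_coe _ (by linarith [t.2.2.1]), winding_apply]

/-- The deck transformation of the universal cover of the annulus. -/
noncomputable def shift (n : ℤ) : C(AnnulusCover, AnnulusCover) :=
  ⟨fun t => (t.1 + n, t.2), by fun_prop⟩

theorem annulus_shift (u : rels) (n : ℤ) (t : AnnulusCover) :
    annulus u (shift n t) = annulus u t := by
  refine congrArg (cell u) (Subtype.ext ?_)
  change ((t.2 : ℝ) : ℂ) * Complex.exp ((2 * Real.pi * (t.1 + n) : ℝ) * Complex.I) =
    (t.2 : ℝ) * Complex.exp ((2 * Real.pi * t.1 : ℝ) * Complex.I)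
  congr 1
  rw [Complex.exp_eq_exp_iff_exists_int]
  refine ⟨n, ?_⟩
  push_cast
  ring

/-- The fibres of the universal cover are the orbits of the deck transformations. -/
theorem exists_shift_of_annulus_eq {u v : rels} {s t : AnnulusCover}
    (h : annulus u s = annulus v t) : u = v ∧ ∃ n : ℤ, s = shift n t := by
  have hr : s.2 = t.2 := by
    have := congrArg radius h
    rw [radius_annulus, radius_annulus] at this
    exact Subtype.ext this
  have hc := congrArg coord h
  change coord (cell u (polar s)) = coord (cell v (polar t)) at hc
  rw [coord_cell u (by rw [norm_polar]; exact s.2.2.2),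
    coord_cell v (by rw [norm_polar]; exact t.2.2.2)] at hc
  simp only [Option.some.injEq, Prod.mk.injEq] at hc
  refine ⟨hc.1, ?_⟩
  have h2 : ((s.2 : ℝ) : ℂ) * Complex.exp ((2 * Real.pi * s.1 : ℝ) * Complex.I) =
    (t.2 : ℝ) * Complex.exp ((2 * Real.pi * t.1 : ℝ) * Complex.I) := hc.2
  have h0 : ((t.2 : ℝ) : ℂ) ≠ 0 := by
    rw [Complex.ofReal_ne_zero]; linarith [t.2.2.1]
  rw [hr] at h2
  obtain ⟨n, hn⟩ := Complex.exp_eq_exp_iff_exists_int.1 (mul_left_cancel₀ h0 h2)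
  refine ⟨n, Prod.ext ?_ hr⟩
  have h3 : ((2 * Real.pi * s.1 : ℝ) : ℂ) = ((2 * Real.pi * t.1 + n * (2 * Real.pi) : ℝ) : ℂ) := by
    apply mul_right_cancel₀ Complex.I_ne_zero
    rw [hn]
    push_cast
    ring
  have h4 := Complex.ofReal_injective h3
  change s.1 = t.1 + n
  have := Real.pi_pos
  nlinarith

/-- Paths in the annuli lift to the universal covers. -/
theorem exists_annulus_comp {δ : SSimplex 1 (PresentationComplex rels)} (h : δ.In (annuli rels)) :
    ∃ (u : rels) (η : SSimplex 1 AnnulusCover), (annulus u).comp η = δ := by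
  obtain ⟨δ', rfl⟩ := exists_comp_eq_of_isEmbedding discIncl_isOpenEmbedding.isEmbedding (σ := δ)
    (fun t => by rw [range_discIncl]; exact (h t).2)
  obtain ⟨u, g, hgc, hg⟩ := δ'.continuous.exists_lift_sigma
  have hg' : ∀ t, δ' t = ⟨u, g t⟩ := fun t => congrFun hg t
  have hrad : ∀ t, ‖(g t : ℂ)‖ ∈ Set.Ioo (1 / 2 : ℝ) 1 := fun t => by
    have := h t
    rw [ContinuousMap.comp_apply, hg'] at this
    exact this
  have hne : ∀ t, (g t : ℂ) ≠ 0 := fun t h0 => by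
    have := (hrad t).1
    rw [h0, norm_zero] at this
    norm_num at this
  -- The direction of the path, as a path in the circle on the unit interval.
  let c : C(stdSimplex ℝ (Fin 2), Circle) :=
    ⟨fun t => ⟨(g t : ℂ) / ‖(g t : ℂ)‖, mem_sphere_zero_iff_norm.2 (by
      rw [norm_div, Complex.norm_real, norm_norm, div_self (norm_ne_zero_iff.2 (hne t))])⟩,
      Continuous.subtype_mk (by
        refine Continuous.div (by fun_prop) (by fun_prop) fun t => ?_
        exact Complex.ofReal_ne_zero.2 (norm_ne_zero_iff.2 (hne t))) _⟩
  let φ := stdSimplexHomeomorphUnitInterval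
  let γ : C(unitInterval, Circle) := c.comp ⟨φ.symm, φ.symm.continuous⟩
  obtain ⟨Γ, hΓ, -⟩ := Circle.isCoveringMap_exp.exists_path_lifts γ (Complex.arg (γ 0 : ℂ))
    (Circle.exp_arg _).symm
  have hΓ' : ∀ t, Circle.exp (Γ (φ t)) = c t := fun t => by
    have := congrFun hΓ (φ t)
    simpa [γ] using this
  refine ⟨u, ⟨fun t => (Γ (φ t) / (2 * Real.pi), ⟨‖(g t : ℂ)‖, hrad t⟩),
    by
      refine Continuous.prodMk ?_ (Continuous.subtype_mk (by fun_prop) _)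
      have := φ.continuous
      fun_prop⟩, ContinuousMap.ext fun t => ?_⟩
  rw [ContinuousMap.comp_apply, ContinuousMap.comp_apply, hg']
  refine congrArg (cell u) (Subtype.ext ?_)
  change ((‖(g t : ℂ)‖ : ℝ) : ℂ) *
    Complex.exp ((2 * Real.pi * (Γ (φ t) / (2 * Real.pi)) : ℝ) * Complex.I) = g t
  rw [mul_div_cancel₀ _ Real.two_pi_pos.ne', ← Circle.coe_exp, hΓ']
  exact mul_div_cancel₀ _ (Complex.ofReal_ne_zero.2 (norm_ne_zero_iff.2 (hne t)))

open Classical in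
/-- The pull-back of a cochain of the wedge to the collar. -/
noncomputable def pullback {G : Type*} [Group G] (h : SSimplex 1 (WedgeOfCircles X) → G)
    (δ : SSimplex 1 (PresentationComplex rels)) : G :=
  if hc : Continuous (retr ∘ δ) then h ⟨retr ∘ δ, hc⟩ else 1

theorem pullback_eq {G : Type*} [Group G] {h : SSimplex 1 (WedgeOfCircles X) → G}
    {δ : SSimplex 1 (PresentationComplex rels)} {γ : SSimplex 1 (WedgeOfCircles X)}
    (hγ : ∀ t, retr (δ t) = γ t) : pullback h δ = h γ := by
  have : retr ∘ δ = γ := funext hγ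
  rw [pullback, dif_pos (this ▸ γ.continuous)]
  congr 1
  exact ContinuousMap.ext hγ

theorem pullback_flat {G : Type*} [Group G] {h : SSimplex 1 (WedgeOfCircles X) → G}
    (hf : ∀ σ, FlatOn h σ) {σ : SSimplex 2 (PresentationComplex rels)} (hσ : σ.In (collar rels)) :
    FlatOn (pullback h) σ := by
  let τ : SSimplex 2 (WedgeOfCircles X) :=
    ⟨fun t => retr (σ t), continuousOn_retr.comp_continuous σ.continuous hσ⟩
  have := hf τ
  rw [FlatOn, pullback_eq (γ := face τ 2) fun _ => rfl, pullback_eq (γ := face τ 0) fun _ => rfl,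
    pullback_eq (γ := face τ 1) fun _ => rfl]
  exact this

/-- The homology classes of the paths in the universal cover of the annulus, modulo the boundaries
in the annuli, are the differences of a function of the end points, on which the deck
transformations act by translations. -/
theorem exists_primitive (u : rels) {M : Type*} [AddCommGroup M] {q : SChain 1
    (PresentationComplex rels) →ₗ[ℤ] M} (hq : ∀ t ∈ supp 2 (annuli rels), q (bdry t) = 0) :
    ∃ (m : AnnulusCover → M) (Ψ : M),
      (∀ η : SSimplex 1 AnnulusCover,
        q (of ((annulus u).comp η)) = m (η.vtx 1) - m (η.vtx 0)) ∧
      ∀ (n : ℤ) t, m (shift n t) = n • Ψ + m t := by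
  have hloop : ∀ z : SChain 1 AnnulusCover, bdry z = 0 → q (push (annulus u) z) = 0 := by
    intro z hz
    obtain ⟨t, rfl⟩ := exists_bdry_of_contractible hz
    rw [← bdry_push]
    exact hq _ (push_mem_supp (A := Set.univ) (fun p _ => annulus_mem u p) (mem_supp_univ t))
  let t0 : AnnulusCover := (0, ⟨3 / 4, by norm_num, by norm_num⟩)
  let p (t : AnnulusCover) : SSimplex 1 AnnulusCover := ofPath (PathConnectedSpace.somePath t0 t)
  let m (t : AnnulusCover) : M := q (of ((annulus u).comp (p t)))
  have hm : ∀ η : SSimplex 1 AnnulusCover,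
      q (of ((annulus u).comp η)) = m (η.vtx 1) - m (η.vtx 0) := by
    intro η
    have := hloop (of (p (η.vtx 0)) + of η - of (p (η.vtx 1))) (by
      rw [map_sub, map_add, bdry_of_one_eq, bdry_of_one_eq, bdry_of_one_eq, ofPath_vtx_zero,
        ofPath_vtx_zero, ofPath_vtx_one, ofPath_vtx_one]
      abel)
    rw [map_sub, map_add, push_of, push_of, push_of, map_sub, map_add] at this
    exact eq_sub_of_add_eq' (sub_eq_zero.1 this)
  have hshift : ∀ n t, m (shift n t) - m (shift n t0) = m t - m t0 := by
    intro n t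
    have h1 := hm ((shift n).comp (p t))
    have h2 := hm (p t)
    have h3 : (annulus u).comp ((shift n).comp (p t)) = (annulus u).comp (p t) :=
      ContinuousMap.ext fun s => annulus_shift u n _
    have h4 : ∀ i, vtx ((shift n).comp (p t)) i = shift n ((p t).vtx i) := fun _ => rfl
    rw [h3, h2, h4, h4, ofPath_vtx_zero, ofPath_vtx_one] at h1
    exact h1.symm
  let D : ℤ →+ M := AddMonoidHom.mk' (fun n => m (shift n t0) - m t0) (by
    intro a b
    have h1 := hshift a (shift b t0)
    have h2 : shift a (shift b t0) = shift (a + b) t0 := by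
      change ((t0.1 + b + a, t0.2) : AnnulusCover) = (t0.1 + (a + b : ℤ), t0.2)
      push_cast
      congr 1
      ring
    rw [h2] at h1
    rw [← h1]
    abel_nf)
  refine ⟨m, D 1, hm, fun n t => ?_⟩
  rw [← map_zsmul, smul_eq_mul, mul_one]
  have := hshift n t
  change m (shift n t) = m (shift n t0) - m t0 + m t
  rw [sub_eq_sub_iff_add_eq_add] at this
  rw [eq_sub_of_add_eq this]
  abel

/-- On the presentation complex there are a cochain `h`, flat on the collar, and a cochain `Ω`
which counts the windings in the annuli, and determines `h` there up to a gauge transformation. A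
`1`-cycle in the annuli on which `Ω` vanishes is a boundary in the annuli. -/
theorem exists_cochains (rels : Set (FreeGroup X)) :
    ∃ (h : SSimplex 1 (PresentationComplex rels) → FreeGroup X)
      (Ω : SChain 1 (PresentationComplex rels) →ₗ[ℤ] (rels →₀ ℤ))
      (g : PresentationComplex rels → FreeGroup X),
      (∀ σ : SSimplex 2 (PresentationComplex rels), σ.In (collar rels) → FlatOn h σ) ∧
      (∀ δ : SSimplex 1 (PresentationComplex rels), δ.In (annuli rels) → ∃ (u : rels) (w : ℤ),
        Ω (of δ) = Finsupp.single u w ∧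
          h δ = (g (δ.vtx 0))⁻¹ * (u : FreeGroup X) ^ w * g (δ.vtx 1)) ∧
      ∀ z ∈ supp 1 (annuli rels), bdry z = 0 → Ω z = 0 →
        ∃ t ∈ supp 2 (annuli rels), z = bdry t := by
  classical
  obtain ⟨h, hf, hl⟩ := exists_holonomy X
  let B := (supp 2 (annuli rels)).map (bdry (n := 1))
  have hB : ∀ t ∈ supp 2 (annuli rels), B.mkQ (bdry t) = 0 := fun t ht =>
    (Submodule.Quotient.mk_eq_zero B).2 ⟨t, ht, rfl⟩
  choose m Ψ hm hmshift using fun u : rels => exists_primitive u hB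
  let κ (u : rels) (t : AnnulusCover) : FreeGroup X := hol h (winding (u : FreeGroup X)) 0 t.1
  have hκ : ∀ u (n : ℤ) t, κ u (shift n t) = (u : FreeGroup X) ^ n * κ u t := by
    intro u n t
    have h1 : hol h (winding (u : FreeGroup X)) 0 1 = u := by
      rw [hol, winding_comp_line, holonomy_relatorLoop hf hl]
    change hol h _ 0 (t.1 + n) = _
    rw [hol_add_int hf _ (winding_add_one _), h1]
  have hpull : ∀ u (η : SSimplex 1 AnnulusCover), pullback h ((annulus u).comp η) =
      (κ u (η.vtx 0))⁻¹ * κ u (η.vtx 1) := by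
    intro u η
    let η' : SSimplex 1 ℝ := ⟨fun t => (η t).1, by fun_prop⟩
    rw [pullback_eq (γ := (winding (u : FreeGroup X)).comp η') fun t => retr_annulus u (η t),
      hol_path hf, eq_inv_mul_iff_mul_eq]
    exact hol_mul hf _ _ _ _
  -- A base point is chosen in each fibre of the universal covers.
  have key : ∃ (g : PresentationComplex rels → FreeGroup X)
      (φ : PresentationComplex rels → SChain 1 (PresentationComplex rels) ⧸ B),
      ∀ u t, ∃ a : ℤ, κ u t = (u : FreeGroup X) ^ a * g (annulus u t) ∧
        m u t = a • Ψ u + φ (annulus u t) := by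
    refine ⟨fun p => if hp : ∃ q : rels × AnnulusCover, annulus q.1 q.2 = p then
        κ hp.choose.1 hp.choose.2 else 1,
      fun p => if hp : ∃ q : rels × AnnulusCover, annulus q.1 q.2 = p then
        m hp.choose.1 hp.choose.2 else 0, fun u t => ?_⟩
    have hp : ∃ q : rels × AnnulusCover, annulus q.1 q.2 = annulus u t := ⟨(u, t), rfl⟩
    have hspec := hp.choose_spec
    beta_reduce
    rw [dif_pos hp, dif_pos hp]
    generalize hp.choose = q at hspec ⊢
    obtain ⟨v, s⟩ := q
    obtain ⟨rfl, n, rfl⟩ := exists_shift_of_annulus_eq hspec.symm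
    exact ⟨n, hκ _ _ _, hmshift _ _ _⟩
  obtain ⟨g, φ, hgφ⟩ := key
  choose a hag haφ using hgφ
  let ω (δ : SSimplex 1 (PresentationComplex rels)) : rels →₀ ℤ :=
    if hδ : ∃ q : rels × SSimplex 1 AnnulusCover, (annulus q.1).comp q.2 = δ then
      Finsupp.single hδ.choose.1
        (a hδ.choose.1 (hδ.choose.2.vtx 1) - a hδ.choose.1 (hδ.choose.2.vtx 0))
    else 0
  have hω : ∀ δ : SSimplex 1 (PresentationComplex rels), δ.In (annuli rels) →
      ∃ (u : rels) (η : SSimplex 1 AnnulusCover), (annulus u).comp η = δ ∧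
        ω δ = Finsupp.single u (a u (η.vtx 1) - a u (η.vtx 0)) := by
    intro δ hδ
    obtain ⟨u, η, h⟩ := exists_annulus_comp hδ
    have hδ : ∃ q : rels × SSimplex 1 AnnulusCover, (annulus q.1).comp q.2 = δ := ⟨(u, η), h⟩
    exact ⟨_, _, hδ.choose_spec, dif_pos hδ⟩
  let Ω : SChain 1 (PresentationComplex rels) →ₗ[ℤ] (rels →₀ ℤ) := Finsupp.linearCombination ℤ ω
  have hΩ : ∀ δ, Ω (of δ) = ω δ := fun δ => by simp [Ω]
  refine ⟨pullback h, Ω, g, fun σ hσ => pullback_flat hf hσ, ?_, ?_⟩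
  · intro δ hδ
    obtain ⟨u, η, rfl, h2⟩ := hω δ hδ
    refine ⟨u, _, (hΩ _).trans h2, ?_⟩
    rw [hpull, hag, hag]
    change _ = (g (annulus u (η.vtx 0)))⁻¹ * _ * g (annulus u (η.vtx 1))
    rw [sub_eq_neg_add, zpow_add, zpow_neg, mul_inv_rev]
    simp only [mul_assoc]
  · intro z hz hbz hΩz
    have hlin : ∀ {z}, z ∈ supp 1 (annuli rels) →
        B.mkQ z = (Finsupp.linearCombination ℤ Ψ ∘ₗ Ω + ext0 φ ∘ₗ bdry) z := fun hz =>
      eqOn_supp (fun δ hδ => by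
        obtain ⟨u, η, rfl, h2⟩ := hω δ hδ
        rw [LinearMap.add_apply, LinearMap.comp_apply, LinearMap.comp_apply, hΩ, h2, ext0_bdry_of,
          hm, haφ, haφ, Finsupp.linearCombination_single, sub_smul]
        change _ = _ + (φ (annulus u (η.vtx 1)) - φ (annulus u (η.vtx 0)))
        abel) hz
    have h0 := hlin hz
    rw [LinearMap.add_apply, LinearMap.comp_apply, LinearMap.comp_apply, hΩz, hbz, map_zero,
      map_zero, add_zero] at h0
    obtain ⟨t, ht, h⟩ := (Submodule.Quotient.mk_eq_zero B).1 h0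
    exact ⟨t, ht, h.symm⟩

end PresentationComplex

/-! ### Classes in the lower central quotients -/

section Lcs

variable {G : Type u} [Group G]

theorem lcsTerm_antitone : Antitone (lcsTerm G) := antitone_nat_of_succ_le fun n => by
  rcases Nat.eq_zero_or_pos n with rfl | hn
  · exact le_top
  · rw [lcsTerm_succ G n hn]
    exact Subgroup.commutator_le_right _ _

theorem commutator_top_le_lcsTerm_succ {n : ℕ} (hn : 1 ≤ n) {N : Subgroup G}
    (hN : N ≤ lcsTerm G n) : ⁅N, (⊤ : Subgroup G)⁆ ≤ lcsTerm G (n + 1) := by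
  rw [lcsTerm_succ G n hn, Subgroup.commutator_comm]
  exact Subgroup.commutator_mono le_rfl hN

open Classical in
/-- The class of an element of `G_n` in `G_n / G_{n+1}`, extended by zero to all of `G`. -/
noncomputable def lcsCl (n : ℕ) (g : G) : Additive (LcsQuotient G n) :=
  if hg : g ∈ lcsTerm G n then lcsClass n g hg else 0

theorem lcsCl_of_mem {n : ℕ} {g : G} (hg : g ∈ lcsTerm G n) : lcsCl n g = lcsClass n g hg :=
  dif_pos hg

theorem lcsCl_mul {n : ℕ} {a b : G} (ha : a ∈ lcsTerm G n) (hb : b ∈ lcsTerm G n) :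
    lcsCl n (a * b) = lcsCl n a + lcsCl n b := by
  rw [lcsCl_of_mem ha, lcsCl_of_mem hb, lcsCl_of_mem (mul_mem ha hb)]
  rfl

theorem lcsCl_eq_zero_iff {n : ℕ} {a : G} (ha : a ∈ lcsTerm G n) :
    lcsCl n a = 0 ↔ a ∈ lcsTerm G (n + 1) := by
  rw [lcsCl_of_mem ha, lcsClass, ofMul_eq_zero, QuotientGroup.eq_one_iff,
    Subgroup.mem_subgroupOf]

theorem lcsCl_one (n : ℕ) : lcsCl n (1 : G) = 0 := (lcsCl_eq_zero_iff (one_mem _)).2 (one_mem _)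

theorem lcsCl_inv {n : ℕ} {a : G} (ha : a ∈ lcsTerm G n) : lcsCl n a⁻¹ = - lcsCl n a := by
  rw [eq_neg_iff_add_eq_zero, ← lcsCl_mul (inv_mem ha) ha, inv_mul_cancel, lcsCl_one]

theorem lcsCl_mul_inv {n : ℕ} {a b : G} (ha : a ∈ lcsTerm G n) (hb : b ∈ lcsTerm G n) :
    lcsCl n (a * b⁻¹) = lcsCl n a - lcsCl n b := by
  rw [lcsCl_mul ha (inv_mem hb), lcsCl_inv hb, sub_eq_add_neg]

theorem lcsCl_conj {n : ℕ} (hn : 1 ≤ n) {a : G} (ha : a ∈ lcsTerm G n) (g : G) :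
    lcsCl n (g * a * g⁻¹) = lcsCl n a := by
  have hm := (lcsTerm_normal G n).conj_mem a ha g
  rw [← sub_eq_zero, ← lcsCl_mul_inv hm ha, lcsCl_eq_zero_iff (mul_mem hm (inv_mem ha)),
    lcsTerm_succ G n hn]
  exact Subgroup.commutator_mem_commutator (Subgroup.mem_top g) ha

theorem lcsCl_zpow {n : ℕ} {a : G} (ha : a ∈ lcsTerm G n) (w : ℤ) :
    lcsCl n (a ^ w) = w • lcsCl n a := by
  rw [lcsCl_of_mem ha, lcsCl_of_mem (zpow_mem ha w)]
  rfl

theorem exists_lcsCl_eq (n : ℕ) (m : Additive (LcsQuotient G n)) :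
    ∃ d ∈ lcsTerm G n, lcsCl n d = m := by
  obtain ⟨⟨d, hd⟩, h⟩ := QuotientGroup.mk_surjective (Additive.toMul m)
  exact ⟨d, hd, (lcsCl_of_mem hd).trans (congrArg Additive.ofMul h)⟩

/-! ### Intersections of normal closures -/

/-- Modulo `[R, G]` an element of the normal closure `R` of `t` is a product of powers of elements
of `t`; if all the exponents vanish, then it lies in `[R, G]`. -/
theorem exists_exponents {n : ℕ} (hn : 1 ≤ n) {T t : Set G} (htT : t ⊆ T)
    (hT : ∀ w ∈ T, w ∈ lcsTerm G n) {w : G} (hw : w ∈ Subgroup.normalClosure t) :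
    w ∈ lcsTerm G n ∧ ∃ a ∈ Finsupp.supported ℤ ℤ {i : T | (i : G) ∈ t},
      Finsupp.linearCombination ℤ (fun i : T => lcsCl n (i : G)) a = lcsCl n w ∧
        (a = 0 → w ∈ ⁅Subgroup.normalClosure t, (⊤ : Subgroup G)⁆) := by
  classical
  set R := Subgroup.normalClosure t with hR
  set C := ⁅R, (⊤ : Subgroup G)⁆ with hC
  have hcen : ∀ g : G, g ∈ R → (QuotientGroup.mk g : G ⧸ C) ∈ Subgroup.center (G ⧸ C) := by
    intro g hg
    rw [Subgroup.mem_center_iff]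
    rintro ⟨x⟩
    refine QuotientGroup.eq.2 ?_
    have := Subgroup.commutator_mem_commutator (inv_mem hg) (Subgroup.mem_top x⁻¹)
    rw [← hC, commutatorElement_def] at this
    simpa [mul_assoc] using this
  let _ : CommGroup (Subgroup.center (G ⧸ C)) :=
    { (inferInstance : Group (Subgroup.center (G ⧸ C))) with
      mul_comm := fun a b => Subtype.ext (Subgroup.mem_center_iff.1 b.2 a) }
  -- The product of the powers of the elements of `t`, in the centre of `G ⧸ [R, G]`.
  let θ : (T →₀ ℤ) →ₗ[ℤ] Additive (Subgroup.center (G ⧸ C)) :=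
    Finsupp.linearCombination ℤ fun i : T => if hi : (i : G) ∈ t then
      Additive.ofMul ⟨QuotientGroup.mk (i : G), hcen _ (Subgroup.subset_normalClosure hi)⟩ else 0
  suffices h : w ∈ lcsTerm G n ∧ ∃ a ∈ Finsupp.supported ℤ ℤ {i : T | (i : G) ∈ t},
      Finsupp.linearCombination ℤ (fun i : T => lcsCl n (i : G)) a = lcsCl n w ∧
        ((Additive.toMul (θ a) : Subgroup.center (G ⧸ C)) : G ⧸ C) = QuotientGroup.mk w by
    obtain ⟨h1, a, ha, h2, h3⟩ := h
    refine ⟨h1, a, ha, h2, fun h0 => ?_⟩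
    rw [h0, map_zero] at h3
    exact (QuotientGroup.eq_one_iff w).1 h3.symm
  rw [hR, Subgroup.normalClosure] at hw
  induction hw using Subgroup.closure_induction with
  | mem x hx =>
    obtain ⟨i, hi, hx⟩ := Group.mem_conjugatesOfSet_iff.1 hx
    obtain ⟨c, rfl⟩ := isConj_iff.1 hx
    have hin := hT i (htT hi)
    refine ⟨(lcsTerm_normal G n).conj_mem i hin c, Finsupp.single ⟨i, htT hi⟩ 1,
      Finsupp.single_mem_supported ℤ 1 hi, ?_, ?_⟩
    · rw [Finsupp.linearCombination_single, one_smul, lcsCl_conj hn hin]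
    · have h1 : θ (Finsupp.single ⟨i, htT hi⟩ 1) = Additive.ofMul
          ⟨QuotientGroup.mk i, hcen _ (Subgroup.subset_normalClosure hi)⟩ := by
        simp only [θ, Finsupp.linearCombination_single, one_smul]
        exact dif_pos hi
      rw [h1]
      change (QuotientGroup.mk i : G ⧸ C) = QuotientGroup.mk c * QuotientGroup.mk i *
        (QuotientGroup.mk c)⁻¹
      rw [Subgroup.mem_center_iff.1 (hcen _ (Subgroup.subset_normalClosure hi)), mul_assoc,
        mul_inv_cancel, mul_one]
  | one => exact ⟨one_mem _, 0, zero_mem _, by rw [map_zero, lcsCl_one], by rw [map_zero]; rfl⟩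
  | mul x y _ _ hx hy =>
    obtain ⟨h1, a, ha, h2, h3⟩ := hx
    obtain ⟨h1', b, hb, h2', h3'⟩ := hy
    refine ⟨mul_mem h1 h1', a + b, add_mem ha hb, ?_, ?_⟩
    · rw [map_add, h2, h2', lcsCl_mul h1 h1']
    · rw [map_add, toMul_add, Subgroup.coe_mul, h3, h3']
      rfl
  | inv x _ hx =>
    obtain ⟨h1, a, ha, h2, h3⟩ := hx
    refine ⟨inv_mem h1, -a, neg_mem ha, ?_, ?_⟩
    · rw [map_neg, h2, lcsCl_inv h1]
    · rw [map_neg, toMul_neg, Subgroup.coe_inv, h3]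
      rfl

theorem normalClosure_inf_le {r s : Set G} (hrs : Disjoint r s) {n : ℕ} (hn : 1 ≤ n)
    (hmem : ∀ w ∈ r ∪ s, w ∈ lcsTerm G n)
    (hind : LinearIndependent ℤ fun w : ↥(r ∪ s) => lcsCl n (w : G)) :
    Subgroup.normalClosure r ⊓ Subgroup.normalClosure s ≤
      ⁅Subgroup.normalClosure r, (⊤ : Subgroup G)⁆ ⊓
        ⁅Subgroup.normalClosure s, (⊤ : Subgroup G)⁆ := by
  rintro w ⟨hr, hs⟩
  obtain ⟨-, a, ha, h1, h2⟩ := exists_exponents hn Set.subset_union_left hmem hr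
  obtain ⟨-, b, hb, h1', h2'⟩ := exists_exponents hn Set.subset_union_right hmem hs
  obtain rfl : a = b := hind (h1.trans h1'.symm)
  have h0 : a = 0 := by
    ext i
    by_contra hi
    exact Set.disjoint_left.1 hrs (ha (Finsupp.mem_support_iff.2 hi))
      (hb (Finsupp.mem_support_iff.2 hi))
  exact ⟨h2 h0, h2' h0⟩

end Lcs

/-! ### Holonomy and the lower central series -/

namespace SChain

open SSimplex

variable {Y : Type*} [TopologicalSpace Y] {A B : Set Y}

/-- A `1`-cochain on `A` that vanishes on the cycles in `A` is a coboundary. -/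
theorem exists_primitive {M : Type*} [AddCommGroup M] {L : SChain 1 Y →ₗ[ℤ] M}
    (hL : ∀ z ∈ supp 1 A, bdry z = 0 → L z = 0) :
    ∃ φ : Y → M, ∀ γ : SSimplex 1 Y, γ.In A → L (of γ) = φ (γ.vtx 1) - φ (γ.vtx 0) := by
  -- A base point is chosen in each class of points joined by a chain in `A`.
  let S : Setoid Y :=
    { r := fun x y => ∃ c ∈ supp 1 A, bdry c = of (pt0 y) - of (pt0 x)
      iseqv :=
        { refl := fun x => ⟨0, zero_mem _, by simp⟩
          symm := fun ⟨c, hc, h⟩ => ⟨-c, neg_mem hc, by rw [map_neg, h, neg_sub]⟩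
          trans := fun ⟨c, hc, h⟩ ⟨d, hd, h'⟩ => ⟨c + d, add_mem hc hd, by
            rw [map_add, h, h']; abel⟩ } }
  have hrep : ∀ y, ∃ c ∈ supp 1 A, bdry c = of (pt0 y) - of (pt0 (Quotient.mk S y).out) :=
    fun y => Quotient.mk_out (s := S) y
  choose c hcA hc using hrep
  refine ⟨fun y => L (c y), fun γ hγ => ?_⟩
  have heq : (Quotient.mk S (γ.vtx 0)) = Quotient.mk S (γ.vtx 1) :=
    Quotient.sound ⟨of γ, of_mem_supp hγ, bdry_of_one_eq γ⟩
  have := hL (c (γ.vtx 0) + of γ - c (γ.vtx 1))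
    (sub_mem (add_mem (hcA _) (of_mem_supp hγ)) (hcA _)) (by
      rw [map_sub, map_add, hc, hc, bdry_of_one_eq, heq]
      abel)
  rw [map_sub, map_add] at this
  exact eq_sub_of_add_eq' (sub_eq_zero.1 this)

variable {G : Type u} [Group G] {ι : Type*} {rel : ι → G} {n : ℕ} {h : SSimplex 1 Y → G}
  {Ω : SChain 1 Y →ₗ[ℤ] (ι →₀ ℤ)} {g k : Y → G}

/-- The class in `G_j / G_{j+1}` of a gauge transform of a cochain with values in `G`. -/
noncomputable def gaugeCl (j : ℕ) (h : SSimplex 1 Y → G) (k : Y → G) :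
    SChain 1 Y →ₗ[ℤ] Additive (LcsQuotient G j) :=
  Finsupp.linearCombination ℤ fun γ => lcsCl j (k (γ.vtx 0) * h γ * (k (γ.vtx 1))⁻¹)

theorem gaugeCl_of (j : ℕ) (h : SSimplex 1 Y → G) (k : Y → G) (γ : SSimplex 1 Y) :
    gaugeCl j h k (of γ) = lcsCl j (k (γ.vtx 0) * h γ * (k (γ.vtx 1))⁻¹) := by
  simp [gaugeCl]

theorem gaugeCl_bdry (hflat : ∀ σ : SSimplex 2 Y, σ.In A → FlatOn h σ) {j : ℕ}
    (hk : ∀ γ : SSimplex 1 Y, γ.In A → k (γ.vtx 0) * h γ * (k (γ.vtx 1))⁻¹ ∈ lcsTerm G j)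
    {z : SChain 2 Y} (hz : z ∈ supp 2 A) : gaugeCl j h k (bdry z) = 0 := by
  refine eqOn_supp (f := gaugeCl j h k ∘ₗ bdry) (g := 0) (fun σ hσ => ?_) hz
  rw [LinearMap.comp_apply, bdry_of_two, map_add, map_sub, gaugeCl_of, gaugeCl_of, gaugeCl_of,
    LinearMap.zero_apply]
  have h0 := hk _ (hσ.face 0)
  have h1 := hk _ (hσ.face 1)
  have h2 := hk _ (hσ.face 2)
  rw [← lcsCl_mul_inv h0 h1, add_comm, ← lcsCl_mul h2 (mul_mem h0 (inv_mem h1)), ← hflat σ hσ]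
  simp only [vtx_face_two]
  convert lcsCl_one j using 2
  group

/-- On the cycles in `A ∩ B`, the class of the holonomy is the combination of the classes of the
relators given by the winding numbers. -/
theorem gaugeCl_eq (hrel : ∀ i, rel i ∈ lcsTerm G n) {j : ℕ} (hj : 1 ≤ j) (hjn : j ≤ n)
    (hΩ : ∀ γ : SSimplex 1 Y, γ.In (A ∩ B) → ∃ (i : ι) (w : ℤ), Ω (of γ) = Finsupp.single i w ∧
      h γ = (g (γ.vtx 0))⁻¹ * rel i ^ w * g (γ.vtx 1))
    (hk : ∀ γ : SSimplex 1 Y, γ.In A → k (γ.vtx 0) * h γ * (k (γ.vtx 1))⁻¹ ∈ lcsTerm G j)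
    {z : SChain 1 Y} (hz : z ∈ supp 1 (A ∩ B)) (hz0 : bdry z = 0) :
    gaugeCl j h k z = Finsupp.linearCombination ℤ (fun i => lcsCl j (rel i)) (Ω z) := by
  -- The quotient of the two gauges is split as an element of `G_j` times a representative of its
  -- coset.
  let c (y : Y) : G := k y * (g y)⁻¹
  let b (y : Y) : G := c y * (Quotient.out (QuotientGroup.mk (c y) : G ⧸ lcsTerm G j))⁻¹
  have hb : ∀ y, b y ∈ lcsTerm G j := fun y => by
    have h1 : (QuotientGroup.mk (Quotient.out (QuotientGroup.mk (c y) : G ⧸ lcsTerm G j)) :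
        G ⧸ lcsTerm G j) = QuotientGroup.mk (c y) := Quotient.out_eq _
    exact (lcsTerm_normal G j).mem_comm (QuotientGroup.eq.1 h1)
  have hlin := eqOn_supp (f := gaugeCl j h k)
    (g := Finsupp.linearCombination ℤ (fun i => lcsCl j (rel i)) ∘ₗ Ω -
      ext0 (fun y => lcsCl j (b y)) ∘ₗ bdry) (fun γ hγ => ?_) hz
  · rw [hlin, LinearMap.sub_apply, LinearMap.comp_apply, LinearMap.comp_apply, hz0, map_zero,
      sub_zero]
  obtain ⟨i, w, h1, h2⟩ := hΩ γ hγ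
  have h3 := hk γ fun t => (hγ t).1
  have hi : rel i ∈ lcsTerm G j := lcsTerm_antitone hjn (hrel i)
  have h4 : k (γ.vtx 0) * h γ * (k (γ.vtx 1))⁻¹ =
      c (γ.vtx 0) * rel i ^ w * (c (γ.vtx 0))⁻¹ * (c (γ.vtx 0) * (c (γ.vtx 1))⁻¹) := by
    simp only [h2, c]
    group
  have h5 : c (γ.vtx 0) * rel i ^ w * (c (γ.vtx 0))⁻¹ ∈ lcsTerm G j :=
    (lcsTerm_normal G j).conj_mem _ (zpow_mem hi w) _
  have h6 : c (γ.vtx 0) * (c (γ.vtx 1))⁻¹ ∈ lcsTerm G j := by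
    rw [h4] at h3
    exact (Subgroup.mul_mem_cancel_left _ h5).1 h3
  have h7 : (QuotientGroup.mk (c (γ.vtx 1)) : G ⧸ lcsTerm G j) = QuotientGroup.mk (c (γ.vtx 0)) :=
    QuotientGroup.eq.2 ((lcsTerm_normal G j).mem_comm h6)
  have h8 : c (γ.vtx 0) * (c (γ.vtx 1))⁻¹ = b (γ.vtx 0) * (b (γ.vtx 1))⁻¹ := by
    simp only [b, h7]
    group
  rw [gaugeCl_of, h4, lcsCl_mul h5 h6, lcsCl_conj hj (zpow_mem hi w), lcsCl_zpow hi, h8,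
    lcsCl_mul_inv (hb _) (hb _), LinearMap.sub_apply, LinearMap.comp_apply, LinearMap.comp_apply,
    h1, Finsupp.linearCombination_single, ext0_bdry_of]
  abel

/-- If the relators lie in `G_n`, then the holonomy of the paths in `A` can be gauged into
`G_n`: in `G_j / G_{j+1}`, for `j < n`, the relators vanish, and so does the holonomy of the cycles
in `A`, each of which bounds in the union of `A` and `B`. -/
theorem exists_gauge (hA : IsOpen A) (hB : IsOpen B) (hAB : A ∪ B = Set.univ)
    (hY : ∀ z : SChain 1 Y, bdry z = 0 → ∃ t, z = bdry t)
    (hrel : ∀ i, rel i ∈ lcsTerm G n) (hflat : ∀ σ : SSimplex 2 Y, σ.In A → FlatOn h σ)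
    (hΩ : ∀ γ : SSimplex 1 Y, γ.In (A ∩ B) → ∃ (i : ι) (w : ℤ), Ω (of γ) = Finsupp.single i w ∧
      h γ = (g (γ.vtx 0))⁻¹ * rel i ^ w * g (γ.vtx 1)) {j : ℕ} (hj : 1 ≤ j) (hjn : j ≤ n) :
    ∃ k : Y → G, ∀ γ : SSimplex 1 Y, γ.In A →
      k (γ.vtx 0) * h γ * (k (γ.vtx 1))⁻¹ ∈ lcsTerm G j := by
  induction j, hj using Nat.le_induction with
  | base => exact ⟨fun _ => 1, fun _ _ => Subgroup.mem_top _⟩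
  | succ j hj ih =>
    obtain ⟨k, hk⟩ := ih (by omega)
    obtain ⟨φ, hφ⟩ := exists_primitive (A := A) (L := gaugeCl j h k) fun z hz hz0 => by
      obtain ⟨t, rfl⟩ := hY z hz0
      obtain ⟨zA, hzA, zB, hzB, ht⟩ := exists_small_filling hA hB hAB hz
      have h1 : bdry zB ∈ supp 1 (A ∩ B) := mem_supp_inter (by
        rw [← sub_eq_iff_eq_add'.2 ht]
        exact sub_mem hz (bdry_mem_supp hzA)) (bdry_mem_supp hzB)
      have h2 : (fun i => lcsCl j (rel i)) = fun _ => 0 := funext fun i =>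
        (lcsCl_eq_zero_iff (lcsTerm_antitone (by omega) (hrel i))).2
          (lcsTerm_antitone hjn (hrel i))
      rw [ht, map_add, gaugeCl_bdry hflat hk hzA, gaugeCl_eq hrel hj (by omega) hΩ hk h1
        (bdry_bdry zB), h2, zero_add]
      simp [Finsupp.linearCombination_apply]
    -- Lifts of the primitive to `G_j` correct the gauge.
    choose d hd hdφ using fun y => exists_lcsCl_eq j (φ y)
    refine ⟨fun y => d y * k y, fun γ hγ => ?_⟩
    have h1 := hk γ hγ
    have h2 : d (γ.vtx 0) * k (γ.vtx 0) * h γ * (d (γ.vtx 1) * k (γ.vtx 1))⁻¹ =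
        d (γ.vtx 0) * (k (γ.vtx 0) * h γ * (k (γ.vtx 1))⁻¹) * (d (γ.vtx 1))⁻¹ := by
      group
    have h3 := mul_mem (hd (γ.vtx 0)) h1
    rw [h2, ← lcsCl_eq_zero_iff (mul_mem h3 (inv_mem (hd _))), lcsCl_mul_inv h3 (hd _),
      lcsCl_mul (hd _) h1, hdφ, hdφ, ← gaugeCl_of, hφ γ hγ]
    abel

/-- The winding numbers of the boundary of the part of a `2`-cycle in `B` vanish, if the relators
are linearly independent in `G_n / G_{n+1}`. -/
theorem winding_bdry_eq_zero (hA : IsOpen A) (hB : IsOpen B) (hAB : A ∪ B = Set.univ)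
    (hY : ∀ z : SChain 1 Y, bdry z = 0 → ∃ t, z = bdry t) (hn : 1 ≤ n)
    (hrel : ∀ i, rel i ∈ lcsTerm G n) (hind : LinearIndependent ℤ fun i => lcsCl n (rel i))
    (hflat : ∀ σ : SSimplex 2 Y, σ.In A → FlatOn h σ)
    (hΩ : ∀ γ : SSimplex 1 Y, γ.In (A ∩ B) → ∃ (i : ι) (w : ℤ), Ω (of γ) = Finsupp.single i w ∧
      h γ = (g (γ.vtx 0))⁻¹ * rel i ^ w * g (γ.vtx 1))
    {zA zB : SChain 2 Y} (hzA : zA ∈ supp 2 A) (hzB : zB ∈ supp 2 B)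
    (hz : bdry zA + bdry zB = 0) : Ω (bdry zB) = 0 := by
  obtain ⟨k, hk⟩ := exists_gauge hA hB hAB hY hrel hflat hΩ hn le_rfl
  have h1 : bdry zB = - bdry zA := eq_neg_of_add_eq_zero_right hz
  have h2 : bdry zB ∈ supp 1 (A ∩ B) :=
    mem_supp_inter (h1 ▸ neg_mem (bdry_mem_supp hzA)) (bdry_mem_supp hzB)
  have h3 := gaugeCl_eq hrel hn le_rfl hΩ hk h2 (bdry_bdry zB)
  rw [h1, map_neg, gaugeCl_bdry hflat hk hzA, neg_zero, ← h1] at h3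
  exact hind (h3.symm.trans (map_zero _).symm)

end SChain

/-! ### Spherical maps to the presentation complex -/

namespace PresentationComplex

open SSimplex SChain

variable {X : Type u} {rels : Set (FreeGroup X)}

/-- A `2`-cycle in the open discs is a boundary. -/
theorem exists_bdry_of_mem_openDiscs {z : SChain 2 (PresentationComplex rels)}
    (hz : z ∈ supp 2 (openDiscs rels)) (hz0 : bdry z = 0) : ∃ t, z = bdry t := by
  have : ContractibleSpace (Metric.ball (0 : ℂ) 1) :=
    (convex_ball (0 : ℂ) 1).contractibleSpace ⟨0, by simp⟩
  obtain ⟨b, rfl⟩ := exists_push_eq_of_isEmbedding discIncl_isOpenEmbedding.isEmbedding (z := z)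
    (by rwa [range_discIncl])
  obtain ⟨t, rfl⟩ := exists_bdry_two_sigma (z := b)
    (push_injective discIncl_isOpenEmbedding.injective (by rw [← bdry_push, hz0, map_zero]))
  exact ⟨push (discIncl rels) t, (bdry_push _ _).symm⟩

/-- A `2`-cycle in the collar is a boundary, since the collar retracts to the wedge of circles
inside the complex. -/
theorem exists_bdry_of_mem_collar {z : SChain 2 (PresentationComplex rels)}
    (hz : z ∈ supp 2 (collar rels)) (hz0 : bdry z = 0) : ∃ t, z = bdry t := by
  obtain ⟨a, ha⟩ := push_homologous homotopic_crush hz0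
  obtain ⟨y, hy⟩ := exists_push_eq (g := crush rels) (i := incl rels) (fun σ hσ =>
    ⟨⟨fun t => retr (σ t), continuousOn_retr.comp_continuous σ.continuous hσ⟩,
      ContinuousMap.ext fun t => (crush_collar (hσ t)).symm⟩) hz
  obtain ⟨s, rfl⟩ := WedgeOfCircles.exists_bdry (z := y)
    (push_injective incl_injective (by rw [← bdry_push, hy, bdry_push, hz0, map_zero, map_zero]))
  refine ⟨a + push (incl rels) s, ?_⟩
  rw [map_add, ← ha, bdry_push, hy, push_id, sub_add_cancel]

/-- The `2`-cycles of a space with trivial first homology become boundaries in the presentation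
complex. -/
theorem exists_push_eq_bdry {n : ℕ} (hn : 1 ≤ n) (hrel : ∀ w : rels, (w : FreeGroup X) ∈ lcsTerm _ n)
    (hind : LinearIndependent ℤ fun w : rels => lcsCl n (w : FreeGroup X))
    {Y : Type u} [TopologicalSpace Y] (hY : ∀ z : SChain 1 Y, bdry z = 0 → ∃ t, z = bdry t)
    (f : C(Y, PresentationComplex rels)) {z : SChain 2 Y} (hz : bdry z = 0) :
    ∃ t, push f z = bdry t := by
  obtain ⟨h, Ω, g, hflat, hΩ, hbd⟩ := exists_cochains rels
  have hA : IsOpen (f ⁻¹' collar rels) := isOpen_collar.preimage f.continuous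
  have hB : IsOpen (f ⁻¹' openDiscs rels) := isOpen_openDiscs.preimage f.continuous
  have hAB : f ⁻¹' collar rels ∪ f ⁻¹' openDiscs rels = Set.univ := by
    rw [← Set.preimage_union, collar_union_openDiscs, Set.preimage_univ]
  obtain ⟨zA, hzA, zB, hzB, t, ht⟩ := exists_small_two hA hB hAB hz
  have h1 : bdry zA + bdry zB = 0 := by
    rw [← map_add, ht, map_add, hz, bdry_bdry_three, add_zero]
  have h2 : bdry zB = - bdry zA := eq_neg_of_add_eq_zero_right h1
  have h3 : bdry zB ∈ supp 1 (f ⁻¹' collar rels ∩ f ⁻¹' openDiscs rels) :=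
    mem_supp_inter (h2 ▸ neg_mem (bdry_mem_supp hzA)) (bdry_mem_supp hzB)
  have h4 : (Ω ∘ₗ push f) (bdry zB) = 0 := winding_bdry_eq_zero hA hB hAB hY hn hrel hind
    (h := fun γ => h (f.comp γ)) (g := fun y => g (f y))
    (fun σ hσ => hflat (f.comp σ) hσ) (fun γ hγ => by
      obtain ⟨u, w, h5, h6⟩ := hΩ (f.comp γ) hγ
      exact ⟨u, w, by rw [LinearMap.comp_apply, push_of, h5], h6⟩) hzA hzB h1
  -- The common boundary bounds a chain in the annuli, along which the two parts are closed up.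
  obtain ⟨s, hs, hs'⟩ := hbd (push f (bdry zB)) (push_mem_supp (fun y hy => hy) h3)
    (by rw [bdry_push, bdry_bdry, map_zero]) h4
  rw [← bdry_push] at hs'
  obtain ⟨b, hb⟩ := exists_bdry_of_mem_openDiscs (z := push f zB - s)
    (sub_mem (push_mem_supp (fun y hy => hy) hzB) (supp_mono Set.inter_subset_right hs))
    (by rw [map_sub, hs', sub_self])
  obtain ⟨a, ha⟩ := exists_bdry_of_mem_collar (z := push f zA + s)
    (add_mem (push_mem_supp (fun y hy => hy) hzA) (supp_mono Set.inter_subset_left hs))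
    (by rw [map_add, ← hs', bdry_push, bdry_push, ← map_add, h1, map_zero])
  refine ⟨a + b - push f t, ?_⟩
  rw [map_sub, map_add, ← ha, ← hb, bdry_push, add_add_sub_cancel, ← map_add, ht, map_add,
    add_sub_cancel_right]

theorem isCockcroft {n : ℕ} (hn : 1 ≤ n) (hrel : ∀ w : rels, (w : FreeGroup X) ∈ lcsTerm _ n)
    (hind : LinearIndependent ℤ fun w : rels => lcsCl n (w : FreeGroup X)) :
    IsCockcroft (PresentationComplex rels) := fun f =>
  singularH2_map_eq_zero f.hom fun _ hz => exists_push_eq_bdry hn hrel hind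
    (fun _ => exists_bdry_of_homeomorph Homeomorph.ulift fun _ => sphere_exists_bdry) f.hom hz

end PresentationComplex

theorem mainTheorem3 {X : Type u} (r s : Set (FreeGroup X)) (hrs : Disjoint r s)
    (n : ℕ) (hn : 1 ≤ n)
    (hmem : ∀ w ∈ r ∪ s, w ∈ lcsTerm (FreeGroup X) n)
    (hind : LinearIndependent ℤ
      (fun w : ↥(r ∪ s) => lcsClass n (w : FreeGroup X) (hmem w w.2))) :
    Subgroup.normalClosure r ⊓ Subgroup.normalClosure s ≤
        ⁅Subgroup.normalClosure r, (⊤ : Subgroup (FreeGroup X))⁆ ⊓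
          ⁅Subgroup.normalClosure s, (⊤ : Subgroup (FreeGroup X))⁆ ∧
      Subgroup.normalClosure r ⊓ Subgroup.normalClosure s ≤ lcsTerm (FreeGroup X) (n + 1) ∧
      IsCockcroft (PresentationComplex (r ∪ s)) := by
  have hind' : LinearIndependent ℤ fun w : ↥(r ∪ s) => lcsCl n (w : FreeGroup X) := by
    convert hind using 2 with w
    exact lcsCl_of_mem (hmem w w.2)
  have hinf := normalClosure_inf_le hrs hn hmem hind'
  have hR : Subgroup.normalClosure r ≤ lcsTerm (FreeGroup X) n :=
    Subgroup.normalClosure_le_normal fun w hw => hmem w (Or.inl hw)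
  exact ⟨hinf, (hinf.trans inf_le_left).trans (commutator_top_le_lcsTerm_succ hn hR),
    PresentationComplex.isCockcroft hn (fun w => hmem w w.2) hind'⟩
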